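/- Let $A$ and $B$ be associative unital rings (for instance algebras over a commutative ring $k$ acting centrally on all bimodules), let $\mathfrak C$ be an $A$-coring and $\mathfrak D$ a $B$-coring (coassociative and counital), let $X$ be a $(\mathfrak C,\mathfrak D)$-bicomodule and $\Lambda$ a $(\mathfrak D,\mathfrak C)$-bicomodule. For a right $\mathfrak C$-comodule $(M,\rho_M)$ and a left $\mathfrak C$-comodule $(N,\lambda_N)$ write $M\square_{\mathfrak C}N=\ker(\rho_M\otimes_A N-M\otimes_A\lambda_N)\subseteq M\otimes_A N$; a left $\mathfrak C$-comodule $N$ is coflat if $-\square_{\mathfrak C}N$ is exact on right $\mathfrak C$-comodules, and $\mathfrak C$ is coseparable if its coproduct $\Delta_{\mathfrak C}$ is a section in the category of $\mathfrak C$-bicomodules. Assume that at least one of the following holds: 1. ${}_A\mathfrak C$, ${}_B\mathfrak D$, $\mathfrak C_A$, $\mathfrak D_B$ are flat, and ${}_{\mathfrak C}X$ and ${}_{\mathfrak D}\Lambda$ are coflat; 2. $A$ and $B$ are von Neumann regular rings; 3. ${}_A\mathfrak C$ and ${}_B\mathfrak D$ are flat, and $\mathfrak C$ and $\mathfrak D$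 are coseparable. Then $X\square_{\mathfrak D}\Lambda$ carries a unique structure of $\mathfrak C$-bicomodule, and $\Lambda\square_{\mathfrak C}X$ a unique structure of $\mathfrak D$-bicomodule, for which the inclusions into $X\otimes_B\Lambda$ and $\Lambda\otimes_A X$ are bicolinear, and there are unique isomorphisms $(\Lambda\square_{\mathfrak C}X)\square_{\mathfrak D}\Lambda\simeq\Lambda\square_{\mathfrak C}(X\square_{\mathfrak D}\Lambda)$ and $(X\square_{\mathfrak D}\Lambda)\square_{\mathfrak C}X\simeq X\square_{\mathfrak D}(\Lambda\square_{\mathfrak C}X)$ compatible with the associativity isomorphisms of the tensor products. Suppose moreover that $\psi:\mathfrak C\to X\square_{\mathfrak D}\Lambda$ and $\omega:\Lambda\square_{\mathfrak C}X\to\mathfrak D$ are morphisms of $\mathfrak C$-bicomodules and of $\mathfrak D$-bicomodules, respectively, such that the composites $$\Lambda\simeq\Lambda\square_{\mathfrak C}\mathfrak C\xrightarrow{\Lambda\square\psi}\Lambda\square_{\mathfrak C}(X\square_{\mathfrak D}\Lambda)\simeq(\Lambda\square_{\mathfrak C}X)\square_{\mathfrak D}\Lambda\xrightarrow{\omega\square\Lambda}\mathfrak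 D\square_{\mathfrak D}\Lambda,$$ $$X\simeq\mathfrak C\square_{\mathfrak C}X\xrightarrow{\psi\square X}(X\square_{\mathfrak D}\Lambda)\square_{\mathfrak C}X\simeq X\square_{\mathfrak D}(\Lambda\square_{\mathfrak C}X)\xrightarrow{X\square\omega}X\square_{\mathfrak D}\mathfrak D$$ are the canonical isomorphisms $\Lambda\simeq\mathfrak D\square_{\mathfrak D}\Lambda$ and $X\simeq X\square_{\mathfrak D}\mathfrak D$ given by the coactions. Then the $B$-bimodule $\Lambda\square_{\mathfrak C}X$ is a $B$-coring with counit $\epsilon_{\mathfrak D}\circ\omega$ and with coproduct the composite $$\Lambda\square_{\mathfrak C}X\simeq\Lambda\square_{\mathfrak C}(\mathfrak C\square_{\mathfrak C}X)\xrightarrow{\Lambda\square(\psi\square X)}\Lambda\square_{\mathfrak C}((X\square_{\mathfrak D}\Lambda)\square_{\mathfrak C}X)\simeq(\Lambda\square_{\mathfrak C}X)\square_{\mathfrak D}(\Lambda\square_{\mathfrak C}X)\hookrightarrow(\Lambda\square_{\mathfrak C}X)\otimes_B(\Lambda\square_{\mathfrak C}X).$$ Here the composite is the unique map $\Delta$ with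 values in $(\Lambda\square_{\mathfrak C}X)\square_{\mathfrak D}(\Lambda\square_{\mathfrak C}X)$ such that, for the inclusion $\iota:\Lambda\square_{\mathfrak C}X\to\Lambda\otimes_A X$, the map $(\iota\otimes_B\iota)\circ\Delta$ sends $\sum\lambda\otimes x$ to $\sum\lambda\otimes\psi(x_{(-1)})\otimes x_{(0)}$ in $\Lambda\otimes_A X\otimes_B\Lambda\otimes_A X$. -/

import Mathlib

universe u

open MulOpposite

namespace NCCoring

/-! ## Tensor products over a noncommutative ring

Left `R`-modules are `Module R M`, right `R`-modules are `Module Rᵐᵒᵖ M`, and an `(A, B)`-bimodule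
is a left `A`-module and right `B`-module with commuting actions (`SMulCommClass A Bᵐᵒᵖ M`). -/

section Tensor

variable (R : Type u) [Ring R] (M N : Type u) [AddCommGroup M] [Module Rᵐᵒᵖ M]
  [AddCommGroup N] [Module R N]

/-- The relations `m r ⊗ n = m ⊗ r n`. -/
def balanced : AddSubgroup (TensorProduct ℤ M N) :=
  AddSubgroup.closure
    {t | ∃ (r : R) (m : M) (n : N),
      t = TensorProduct.tmul ℤ (op r • m) n - TensorProduct.tmul ℤ m (r • n)}

/-- The tensor product `M ⊗_R N` of a right `R`-module and a left `R`-module over an arbitrary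
ring `R`, an abelian group. -/
def BTensor : Type u := TensorProduct ℤ M N ⧸ balanced R M N

instance : AddCommGroup (BTensor R M N) :=
  inferInstanceAs (AddCommGroup (TensorProduct ℤ M N ⧸ balanced R M N))

end Tensor

namespace BTensor

variable {R : Type u} [Ring R] {M N P : Type u} [AddCommGroup M] [Module Rᵐᵒᵖ M]
  [AddCommGroup N] [Module R N] [AddCommGroup P]

variable (R) in
/-- The pure tensor `m ⊗ n`. -/
def tmul (m : M) (n : N) : BTensor R M N :=
  QuotientAddGroup.mk (TensorProduct.tmul ℤ m n)

theorem add_tmul (m m' : M) (n : N) : tmul R (m + m') n = tmul R m n + tmul R m' n := by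
  unfold tmul
  rw [TensorProduct.add_tmul]
  rfl

theorem tmul_add (m : M) (n n' : N) : tmul R m (n + n') = tmul R m n + tmul R m n' := by
  unfold tmul
  rw [TensorProduct.tmul_add]
  rfl

theorem smul_tmul (r : R) (m : M) (n : N) : tmul R (op r • m) n = tmul R m (r • n) := by
  refine (QuotientAddGroup.eq_iff_sub_mem).2 ?_
  exact AddSubgroup.subset_closure ⟨r, m, n, rfl⟩

@[elab_as_elim]
theorem induction {p : BTensor R M N → Prop} (t : BTensor R M N)
    (tmul' : ∀ m n, p (tmul R m n)) (add' : ∀ x y, p x → p y → p (x + y)) : p t := by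
  obtain ⟨t, rfl⟩ := QuotientAddGroup.mk_surjective t
  induction t with
  | zero =>
    have h := tmul' 0 0
    unfold tmul at h
    rwa [TensorProduct.zero_tmul] at h
  | tmul m n => exact tmul' m n
  | add x y hx hy => exact add' _ _ hx hy

/-- A biadditive map from its values. -/
def mk2 {M N P : Type u} [AddCommGroup M] [AddCommGroup N] [AddCommGroup P] (f : M → N → P)
    (h1 : ∀ m m' n, f (m + m') n = f m n + f m' n)
    (h2 : ∀ m n n', f m (n + n') = f m n + f m n') : M →+ N →+ P :=
  AddMonoidHom.mk' (fun m => AddMonoidHom.mk' (f m) (h2 m))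
    (fun m m' => AddMonoidHom.ext (h1 m m'))

@[simp]
theorem mk2_apply {M N P : Type u} [AddCommGroup M] [AddCommGroup N] [AddCommGroup P]
    (f : M → N → P) (h1) (h2) (m : M) (n : N) : mk2 f h1 h2 m n = f m n := rfl

/-- Biadditive `R`-balanced maps induce maps on `M ⊗_R N`. -/
def lift (f : M →+ N →+ P) (hf : ∀ (r : R) m n, f (op r • m) n = f m (r • n)) :
    BTensor R M N →+ P :=
  QuotientAddGroup.lift (balanced R M N)
    (TensorProduct.liftAddHom f (fun z m n => by simp)) (by
      unfold balanced
      rw [AddSubgroup.closure_le]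
      rintro _ ⟨r, m, n, rfl⟩
      simp [hf])

@[simp]
theorem lift_tmul (f : M →+ N →+ P) (hf) (m : M) (n : N) :
    lift (R := R) f hf (tmul R m n) = f m n := rfl

theorem hom_ext {f g : BTensor R M N →+ P} (h : ∀ m n, f (tmul R m n) = g (tmul R m n)) :
    f = g := by
  ext t
  induction t using BTensor.induction with
  | tmul' m n => exact h m n
  | add' x y hx hy => simp [hx, hy]

variable {M' N' M'' N'' : Type u} [AddCommGroup M'] [Module Rᵐᵒᵖ M'] [AddCommGroup N'] [Module R N']
  [AddCommGroup M''] [Module Rᵐᵒᵖ M''] [AddCommGroup N''] [Module R N'']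

/-- The map `f ⊗_R g`. -/
def map (f : M →ₗ[Rᵐᵒᵖ] M') (g : N →ₗ[R] N') : BTensor R M N →+ BTensor R M' N' :=
  lift
    (mk2 (fun m n => tmul R (f m) (g n))
      (fun m m' n => by rw [map_add, add_tmul])
      (fun m n n' => by rw [map_add, tmul_add]))
    (fun r m n => by
      change tmul R (f (op r • m)) (g n) = tmul R (f m) (g (r • n))
      rw [map_smul, map_smul, smul_tmul])

@[simp]
theorem map_tmul (f : M →ₗ[Rᵐᵒᵖ] M') (g : N →ₗ[R] N') (m : M) (n : N) :
    map f g (tmul R m n) = tmul R (f m) (g n) := rfl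

theorem map_map (f : M →ₗ[Rᵐᵒᵖ] M') (g : N →ₗ[R] N') (f' : M' →ₗ[Rᵐᵒᵖ] M'') (g' : N' →ₗ[R] N'')
    (t : BTensor R M N) : map f' g' (map f g t) = map (f' ∘ₗ f) (g' ∘ₗ g) t := by
  induction t using BTensor.induction with
  | tmul' m n => rfl
  | add' x y hx hy => simp only [map_add, hx, hy]

section Left

variable {S : Type u} [Ring S] [Module S M] [SMulCommClass S Rᵐᵒᵖ M]

/-- For an `(S, R)`-bimodule `M`, the left `S`-action on `M ⊗_R N`: `s (m ⊗ n) = s m ⊗ n`. -/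
instance instLeftModule : Module S (BTensor R M N) where
  smul s := map (Module.toModuleEnd Rᵐᵒᵖ (S := S) M s) LinearMap.id
  one_smul t := by
    change map _ _ t = t
    induction t using BTensor.induction with
    | tmul' m n => simp
    | add' x y hx hy => rw [map_add, hx, hy]
  mul_smul s s' t := by
    change map _ _ t = map _ _ (map _ _ t)
    induction t using BTensor.induction with
    | tmul' m n => simp [mul_smul]
    | add' x y hx hy => simp only [map_add, hx, hy]
  smul_zero s := map_zero _
  smul_add s := map_add _
  add_smul s s' t := by
    change map _ _ t = map _ _ t + map _ _ t
    induction t using BTensor.induction with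
    | tmul' m n => simp [add_smul, add_tmul]
    | add' x y hx hy =>
      simp only [map_add] at hx hy ⊢
      rw [hx, hy]
      abel
  zero_smul t := by
    change map _ _ t = 0
    induction t using BTensor.induction with
    | tmul' m n =>
      rw [map_tmul]
      have h : tmul R (0 : M) n + tmul R (0 : M) n = tmul R (0 : M) n := by
        rw [← add_tmul, add_zero]
      simpa using h
    | add' x y hx hy => rw [map_add, hx, hy, add_zero]

@[simp]
theorem smul_tmul_left (s : S) (m : M) (n : N) : s • tmul R m n = tmul R (s • m) n := rfl

end Left

section Right

variable {T : Type u} [Ring T] [Module Tᵐᵒᵖ N] [SMulCommClass R Tᵐᵒᵖ N]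

/-- For an `(R, T)`-bimodule `N`, the right `T`-action on `M ⊗_R N`: `(m ⊗ n) t = m ⊗ n t`. -/
instance instRightModule : Module Tᵐᵒᵖ (BTensor R M N) :=
  letI : SMulCommClass Tᵐᵒᵖ R N := SMulCommClass.symm R Tᵐᵒᵖ N
  { smul := fun s => map LinearMap.id (Module.toModuleEnd R (S := Tᵐᵒᵖ) N s)
    one_smul := fun t => by
      change map _ _ t = t
      induction t using BTensor.induction with
      | tmul' m n => simp
      | add' x y hx hy => rw [map_add, hx, hy]
    mul_smul := fun s s' t => by
      change map _ _ t = map _ _ (map _ _ t)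
      induction t using BTensor.induction with
      | tmul' m n => simp [mul_smul]
      | add' x y hx hy => simp only [map_add, hx, hy]
    smul_zero := fun s => map_zero _
    smul_add := fun s => map_add _
    add_smul := fun s s' t => by
      change map _ _ t = map _ _ t + map _ _ t
      induction t using BTensor.induction with
      | tmul' m n => simp [add_smul, tmul_add]
      | add' x y hx hy =>
        simp only [map_add] at hx hy ⊢
        rw [hx, hy]
        abel
    zero_smul := fun t => by
      change map _ _ t = 0
      induction t using BTensor.induction with
      | tmul' m n =>
        rw [map_tmul]
        have h : tmul R m (0 : N) + tmul R m (0 : N) = tmul R m (0 : N) := by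
          rw [← tmul_add, add_zero]
        simpa using h
      | add' x y hx hy => rw [map_add, hx, hy, add_zero] }

@[simp]
theorem smul_tmul_right (t : Tᵐᵒᵖ) (m : M) (n : N) : t • tmul R m n = tmul R m (t • n) := rfl

end Right

instance instBimodule {S T : Type u} [Ring S] [Ring T] [Module S M] [SMulCommClass S Rᵐᵒᵖ M]
    [Module Tᵐᵒᵖ N] [SMulCommClass R Tᵐᵒᵖ N] : SMulCommClass S Tᵐᵒᵖ (BTensor R M N) where
  smul_comm s t x := by
    induction x using BTensor.induction with
    | tmul' m n => simp
    | add' x y hx hy => simp only [smul_add, hx, hy]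

section Assoc

variable {S : Type u} [Ring S] {L : Type u} [AddCommGroup L] [Module S L] [Module Sᵐᵒᵖ N]
  [SMulCommClass R Sᵐᵒᵖ N]

/-- `m ⊗ n ↦ m ⊗ (n ⊗ l)` for fixed `l`. -/
def assocAux (l : L) : BTensor R M N →+ BTensor R M (BTensor S N L) :=
  lift (mk2 (fun m n => tmul R m (tmul S n l))
      (fun m m' n => add_tmul m m' _)
      (fun m n n' => by rw [add_tmul, tmul_add]))
    (fun r m n => by
      rw [mk2_apply, mk2_apply, smul_tmul, smul_tmul_left])

theorem assocAux_tmul (l : L) (m : M) (n : N) :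
    assocAux l (tmul R m n) = tmul R m (tmul S n l) := rfl

/-- `n ⊗ l ↦ (m ⊗ n) ⊗ l` for fixed `m`. -/
def assocInvAux (m : M) : BTensor S N L →+ BTensor S (BTensor R M N) L :=
  lift (mk2 (fun n l => tmul S (tmul R m n) l)
      (fun n n' l => by rw [tmul_add, add_tmul])
      (fun n l l' => tmul_add _ l l'))
    (fun s n l => by
      rw [mk2_apply, mk2_apply, ← smul_tmul, smul_tmul_right])

theorem assocInvAux_tmul (m : M) (n : N) (l : L) :
    assocInvAux m (tmul S n l) = tmul S (tmul R m n) l := rfl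

variable (M N L) in
/-- `(m ⊗ n) ⊗ l ↦ m ⊗ (n ⊗ l)`. -/
def assocHom : BTensor S (BTensor R M N) L →+ BTensor R M (BTensor S N L) :=
  lift
    (mk2 (fun t l => assocAux l t)
      (fun t t' l => map_add _ t t')
      (fun t l l' => by
        induction t using BTensor.induction with
        | tmul' m n => rw [assocAux_tmul, assocAux_tmul, assocAux_tmul, tmul_add, tmul_add]
        | add' x y hx hy =>
          rw [map_add, map_add, map_add, hx, hy]
          abel))
    (fun s t l => by
      rw [mk2_apply, mk2_apply]
      induction t using BTensor.induction with
      | tmul' m n => rw [smul_tmul_right, assocAux_tmul, assocAux_tmul, smul_tmul]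
      | add' x y hx hy => rw [smul_add, map_add, map_add, hx, hy])

variable (M N L) in
/-- `m ⊗ (n ⊗ l) ↦ (m ⊗ n) ⊗ l`. -/
def assocInv : BTensor R M (BTensor S N L) →+ BTensor S (BTensor R M N) L :=
  lift
    (mk2 (fun m t => assocInvAux m t)
      (fun m m' t => by
        induction t using BTensor.induction with
        | tmul' n l =>
          rw [assocInvAux_tmul, assocInvAux_tmul, assocInvAux_tmul, add_tmul, add_tmul]
        | add' x y hx hy =>
          rw [map_add, map_add, map_add, hx, hy]
          abel)
      (fun m t t' => map_add _ t t'))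
    (fun r m t => by
      rw [mk2_apply, mk2_apply]
      induction t using BTensor.induction with
      | tmul' n l => rw [smul_tmul_left, assocInvAux_tmul, assocInvAux_tmul, smul_tmul]
      | add' x y hx hy => rw [smul_add, map_add, map_add, hx, hy])

variable (M N L) in
/-- The associativity isomorphism `(M ⊗_R N) ⊗_S L ≃ M ⊗_R (N ⊗_S L)`. -/
def assoc : BTensor S (BTensor R M N) L ≃+ BTensor R M (BTensor S N L) :=
  { assocHom M N L with
    invFun := assocInv M N L
    left_inv := fun t => by
      change ((assocInv M N L).comp (assocHom M N L)) t = AddMonoidHom.id _ t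
      congr 1
      apply hom_ext
      intro t l
      induction t using BTensor.induction with
      | tmul' m n => rfl
      | add' x y hx hy => simp only [add_tmul, map_add, hx, hy]
    right_inv := fun t => by
      change ((assocHom M N L).comp (assocInv M N L)) t = AddMonoidHom.id _ t
      congr 1
      apply hom_ext
      intro m t
      induction t using BTensor.induction with
      | tmul' n l => rfl
      | add' x y hx hy => simp only [tmul_add, map_add, hx, hy] }

@[simp]
theorem assoc_tmul (m : M) (n : N) (l : L) :
    assoc M N L (tmul S (tmul R m n) l) = tmul R m (tmul S n l) := rfl

/-- `f ⊗ N` as a homomorphism of right modules. -/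
def rTensor (N : Type u) [AddCommGroup N] [Module R N] [Module Sᵐᵒᵖ N] [SMulCommClass R Sᵐᵒᵖ N]
    (f : M →ₗ[Rᵐᵒᵖ] M') : BTensor R M N →ₗ[Sᵐᵒᵖ] BTensor R M' N :=
  { map f (LinearMap.id : N →ₗ[R] N) with
    map_smul' := fun s t => by
      change map f LinearMap.id (s • t) = s • map f LinearMap.id t
      induction t using BTensor.induction with
      | tmul' m n => rfl
      | add' x y hx hy => rw [smul_add, map_add, map_add, smul_add, hx, hy] }

/-- `N ⊗ g` as a homomorphism of left modules. -/
def lTensor (N : Type u) [AddCommGroup N] [Module R N] [Module Sᵐᵒᵖ N] [SMulCommClass R Sᵐᵒᵖ N]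
    {L' : Type u} [AddCommGroup L'] [Module S L'] (g : L →ₗ[S] L') :
    BTensor S N L →ₗ[R] BTensor S N L' :=
  { map (LinearMap.id : N →ₗ[Sᵐᵒᵖ] N) g with
    map_smul' := fun s t => by
      change map LinearMap.id g (s • t) = s • map LinearMap.id g t
      induction t using BTensor.induction with
      | tmul' m n => rfl
      | add' x y hx hy => rw [smul_add, map_add, map_add, smul_add, hx, hy] }

theorem assoc_map {L' : Type u} [AddCommGroup L'] [Module S L'] (f : M →ₗ[Rᵐᵒᵖ] M')
    (g : L →ₗ[S] L') (w : BTensor S (BTensor R M N) L) :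
    assoc M' N L' (map (rTensor N f) g w) = map f (lTensor N g) (assoc M N L w) := by
  induction w using BTensor.induction with
  | tmul' t n =>
    induction t using BTensor.induction with
    | tmul' m c => rfl
    | add' x y hx hy => rw [add_tmul, map_add, map_add, hx, hy, map_add, map_add]
  | add' x y hx hy => rw [map_add, map_add, hx, hy, map_add, map_add]

end Assoc

/-- The canonical map `R ⊗_R N → N`, `r ⊗ n ↦ r n`. -/
def lid (R N : Type u) [Ring R] [AddCommGroup N] [Module R N] : BTensor R R N →+ N :=
  lift (smulAddHom R N) (fun r s n => by simp [mul_smul])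

/-- The canonical map `M ⊗_R R → M`, `m ⊗ r ↦ m r`. -/
def rid (R M : Type u) [Ring R] [AddCommGroup M] [Module Rᵐᵒᵖ M] : BTensor R M R →+ M :=
  lift
    (AddMonoidHom.mk' (fun m => AddMonoidHom.mk' (fun r => op r • m)
      (fun r s => by rw [op_add, add_smul]))
      (fun m m' => by
        ext r
        simp))
    (fun r m s => by simp [mul_smul])

end BTensor

/-! ## Bimodule maps, flatness, regularity -/

/-- Homomorphisms of `(A, B)`-bimodules. -/
structure BimodHom (A B M N : Type u) [Ring A] [Ring B] [AddCommGroup M] [Module A M]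
    [Module Bᵐᵒᵖ M] [AddCommGroup N] [Module A N] [Module Bᵐᵒᵖ N] extends M →+ N where
  map_smul_left : ∀ (a : A) (m : M), toFun (a • m) = a • toFun m
  map_smul_right : ∀ (b : B) (m : M), toFun (op b • m) = op b • toFun m

namespace BimodHom

variable {A B M N : Type u} [Ring A] [Ring B] [AddCommGroup M] [Module A M]
    [Module Bᵐᵒᵖ M] [AddCommGroup N] [Module A N] [Module Bᵐᵒᵖ N]

instance : CoeFun (BimodHom A B M N) (fun _ => M → N) := ⟨fun f => f.toFun⟩

/-- The underlying homomorphism of left modules. -/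
def left (f : BimodHom A B M N) : M →ₗ[A] N :=
  { f.toAddMonoidHom with map_smul' := f.map_smul_left }

/-- The underlying homomorphism of right modules. -/
def right (f : BimodHom A B M N) : M →ₗ[Bᵐᵒᵖ] N :=
  { f.toAddMonoidHom with map_smul' := fun b m => f.map_smul_right (unop b) m }

end BimodHom

/-- The left `R`-module `M` is flat: `- ⊗_R M` preserves injections of right `R`-modules. -/
def IsFlatLeft (R M : Type u) [Ring R] [AddCommGroup M] [Module R M] : Prop :=
  ∀ (P Q : Type u) [AddCommGroup P] [Module Rᵐᵒᵖ P] [AddCommGroup Q] [Module Rᵐᵒᵖ Q]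
    (f : P →ₗ[Rᵐᵒᵖ] Q), Function.Injective f →
      Function.Injective (BTensor.map f (LinearMap.id : M →ₗ[R] M))

/-- The right `R`-module `M` is flat: `M ⊗_R -` preserves injections of left `R`-modules. -/
def IsFlatRight (R M : Type u) [Ring R] [AddCommGroup M] [Module Rᵐᵒᵖ M] : Prop :=
  ∀ (P Q : Type u) [AddCommGroup P] [Module R P] [AddCommGroup Q] [Module R Q]
    (f : P →ₗ[R] Q), Function.Injective f →
      Function.Injective (BTensor.map (LinearMap.id : M →ₗ[Rᵐᵒᵖ] M) f)

/-- Von Neumann regular rings. -/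
def IsVonNeumannRegular (R : Type u) [Ring R] : Prop := ∀ a : R, ∃ x : R, a * x * a = a

/-! ## Corings, comodules, bicomodules -/

/-- An `A`-coring structure on the `A`-bimodule `C`. -/
structure Coring (A C : Type u) [Ring A] [AddCommGroup C] [Module A C] [Module Aᵐᵒᵖ C]
    [SMulCommClass A Aᵐᵒᵖ C] where
  comul : BimodHom A A C (BTensor A C C)
  counit : BimodHom A A C A
  coassoc : ∀ c, BTensor.assoc C C C (BTensor.map comul.right LinearMap.id (comul c)) =
    BTensor.map LinearMap.id comul.left (comul c)
  counit_comul : ∀ c, BTensor.lid A C (BTensor.map counit.right LinearMap.id (comul c)) = c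
  comul_counit : ∀ c, BTensor.rid A C (BTensor.map LinearMap.id counit.left (comul c)) = c

section Comodules

variable {A C : Type u} [Ring A] [AddCommGroup C] [Module A C] [Module Aᵐᵒᵖ C]
  [SMulCommClass A Aᵐᵒᵖ C]

/-- A right `C`-comodule structure on the right `A`-module `M`. -/
structure RightComodule (K : Coring A C) (M : Type u) [AddCommGroup M] [Module Aᵐᵒᵖ M] where
  coact : M →ₗ[Aᵐᵒᵖ] BTensor A M C
  coassoc : ∀ m, BTensor.assoc M C C (BTensor.map coact LinearMap.id (coact m)) =
    BTensor.map LinearMap.id K.comul.left (coact m)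
  counit : ∀ m, BTensor.rid A M (BTensor.map LinearMap.id K.counit.left (coact m)) = m

/-- A left `C`-comodule structure on the left `A`-module `M`. -/
structure LeftComodule (K : Coring A C) (M : Type u) [AddCommGroup M] [Module A M] where
  coact : M →ₗ[A] BTensor A C M
  coassoc : ∀ m, BTensor.assoc C C M (BTensor.map K.comul.right LinearMap.id (coact m)) =
    BTensor.map LinearMap.id coact (coact m)
  counit : ∀ m, BTensor.lid A M (BTensor.map K.counit.right LinearMap.id (coact m)) = m

variable {K : Coring A C}

/-- `f` is a morphism of right `C`-comodules. -/
def IsRightColinear {M N : Type u} [AddCommGroup M] [Module Aᵐᵒᵖ M] [AddCommGroup N]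
    [Module Aᵐᵒᵖ N] (ρ : RightComodule K M) (ρ' : RightComodule K N) (f : M →ₗ[Aᵐᵒᵖ] N) : Prop :=
  ∀ m, ρ'.coact (f m) = BTensor.map f LinearMap.id (ρ.coact m)

/-- `f` is a morphism of left `C`-comodules. -/
def IsLeftColinear {M N : Type u} [AddCommGroup M] [Module A M] [AddCommGroup N]
    [Module A N] (l : LeftComodule K M) (l' : LeftComodule K N) (f : M →ₗ[A] N) : Prop :=
  ∀ m, l'.coact (f m) = BTensor.map LinearMap.id f (l.coact m)

/-- The cotensor product `M □_C N` as an additive subgroup of `M ⊗_A N`: the kernel of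
`ρ_M ⊗ N - M ⊗ λ_N`. -/
def cotensor {M N : Type u} [AddCommGroup M] [Module Aᵐᵒᵖ M] [AddCommGroup N] [Module A N]
    (ρ : RightComodule K M) (l : LeftComodule K N) : AddSubgroup (BTensor A M N) where
  carrier := {z | BTensor.assoc M C N (BTensor.map ρ.coact LinearMap.id z) =
    BTensor.map LinearMap.id l.coact z}
  zero_mem' := by simp
  add_mem' := by
    intro a b ha hb
    simp only [Set.mem_ofPred_eq, map_add] at ha hb ⊢
    rw [ha, hb]
  neg_mem' := by
    intro a ha
    simp only [Set.mem_ofPred_eq, map_neg] at ha ⊢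
    rw [ha]

theorem map_mem_cotensor {M N M' N' : Type u} [AddCommGroup M] [Module Aᵐᵒᵖ M] [AddCommGroup N]
    [Module A N] [AddCommGroup M'] [Module Aᵐᵒᵖ M'] [AddCommGroup N'] [Module A N']
    {ρ : RightComodule K M} {l : LeftComodule K N} {ρ' : RightComodule K M'}
    {l' : LeftComodule K N'} {f : M →ₗ[Aᵐᵒᵖ] M'} {g : N →ₗ[A] N'}
    (hf : IsRightColinear ρ ρ' f) (hg : IsLeftColinear l l' g) {z : BTensor A M N}
    (hz : z ∈ cotensor ρ l) : BTensor.map f g z ∈ cotensor ρ' l' := by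
  have hz' : BTensor.assoc M C N (BTensor.map ρ.coact LinearMap.id z) =
    BTensor.map LinearMap.id l.coact z := hz
  have h := BTensor.assoc_map f g (BTensor.map ρ.coact LinearMap.id z)
  rw [hz'] at h
  change BTensor.assoc M' C N' (BTensor.map ρ'.coact LinearMap.id (BTensor.map f g z)) =
    BTensor.map LinearMap.id l'.coact (BTensor.map f g z)
  have e1 : (ρ'.coact ∘ₗ f) = BTensor.rTensor C f ∘ₗ ρ.coact := LinearMap.ext hf
  have e2 : (l'.coact ∘ₗ g) = BTensor.lTensor C g ∘ₗ l.coact := LinearMap.ext hg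
  rw [BTensor.map_map] at h ⊢
  rw [BTensor.map_map] at h ⊢
  rw [e1, e2]
  exact h

/-- The map `f □_C g : M □_C N → M' □_C N'`, the restriction of `f ⊗ g`. -/
def cotensorMap {M N M' N' : Type u} [AddCommGroup M] [Module Aᵐᵒᵖ M] [AddCommGroup N]
    [Module A N] [AddCommGroup M'] [Module Aᵐᵒᵖ M'] [AddCommGroup N'] [Module A N']
    {ρ : RightComodule K M} {l : LeftComodule K N} {ρ' : RightComodule K M'}
    {l' : LeftComodule K N'} (f : M →ₗ[Aᵐᵒᵖ] M') (g : N →ₗ[A] N')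
    (hf : IsRightColinear ρ ρ' f) (hg : IsLeftColinear l l' g) :
    cotensor ρ l →+ cotensor ρ' l' :=
  ((BTensor.map f g).comp (cotensor ρ l).subtype).codRestrict (cotensor ρ' l')
    (fun z => map_mem_cotensor hf hg z.2)

theorem isLeftColinear_id {M : Type u} [AddCommGroup M] [Module A M] (l : LeftComodule K M) :
    IsLeftColinear l l LinearMap.id := fun m => by
  change l.coact m = BTensor.map _ _ (l.coact m)
  generalize l.coact m = t
  induction t using BTensor.induction with
  | tmul' m n => rfl
  | add' x y hx hy => rw [map_add, ← hx, ← hy]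

theorem isRightColinear_id {M : Type u} [AddCommGroup M] [Module Aᵐᵒᵖ M]
    (ρ : RightComodule K M) : IsRightColinear ρ ρ LinearMap.id := fun m => by
  change ρ.coact m = BTensor.map _ _ (ρ.coact m)
  generalize ρ.coact m = t
  induction t using BTensor.induction with
  | tmul' m n => rfl
  | add' x y hx hy => rw [map_add, ← hx, ← hy]

/-- The left `C`-comodule `X` is coflat: the functor `- □_C X` from right `C`-comodules to abelian
groups is exact. (The notion is used when `C` is flat as a left `A`-module; then the exact sequences
of right `C`-comodules are those that are exact as sequences of right `A`-modules.) -/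
def IsCoflatLeft {X : Type u} [AddCommGroup X] [Module A X] (l : LeftComodule K X) : Prop :=
  ∀ (M₁ M₂ M₃ : Type u) [AddCommGroup M₁] [Module Aᵐᵒᵖ M₁] [AddCommGroup M₂] [Module Aᵐᵒᵖ M₂]
    [AddCommGroup M₃] [Module Aᵐᵒᵖ M₃] (ρ₁ : RightComodule K M₁) (ρ₂ : RightComodule K M₂)
    (ρ₃ : RightComodule K M₃) (f : M₁ →ₗ[Aᵐᵒᵖ] M₂) (g : M₂ →ₗ[Aᵐᵒᵖ] M₃)
    (hf : IsRightColinear ρ₁ ρ₂ f) (hg : IsRightColinear ρ₂ ρ₃ g),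
    Function.Injective f → Function.Exact f g → Function.Surjective g →
      Function.Injective (cotensorMap f LinearMap.id hf (isLeftColinear_id l)) ∧
      Function.Exact (cotensorMap f LinearMap.id hf (isLeftColinear_id l))
        (cotensorMap g LinearMap.id hg (isLeftColinear_id l)) ∧
      Function.Surjective (cotensorMap g LinearMap.id hg (isLeftColinear_id l))

/-- The coring `C` is coseparable: its coproduct is a section in the category of `C`-bicomodules,
where `C ⊗_A C` has the coactions `Δ ⊗ C` and `C ⊗ Δ`. -/
def IsCoseparable (K : Coring A C) : Prop :=
  ∃ π : BimodHom A A (BTensor A C C) C,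
    (∀ t, K.comul (π t) = BTensor.map LinearMap.id π.left
      (BTensor.assoc C C C (BTensor.map K.comul.right LinearMap.id t))) ∧
    (∀ t, K.comul (π t) = BTensor.map π.right LinearMap.id
      ((BTensor.assoc C C C).symm (BTensor.map LinearMap.id K.comul.left t))) ∧
    ∀ c, π (K.comul c) = c

end Comodules

section Bicomodules

variable {A B E : Type u} [Ring A] [Ring B] [Ring E]
  {C : Type u} [AddCommGroup C] [Module A C] [Module Aᵐᵒᵖ C] [SMulCommClass A Aᵐᵒᵖ C]
  {D : Type u} [AddCommGroup D] [Module B D] [Module Bᵐᵒᵖ D] [SMulCommClass B Bᵐᵒᵖ D]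
  {G : Type u} [AddCommGroup G] [Module E G] [Module Eᵐᵒᵖ G] [SMulCommClass E Eᵐᵒᵖ G]

/-- A `(C, D)`-bicomodule structure on the `(A, B)`-bimodule `M`. -/
@[ext]
structure Bicomodule (K : Coring A C) (H : Coring B D) (M : Type u) [AddCommGroup M] [Module A M]
    [Module Bᵐᵒᵖ M] [SMulCommClass A Bᵐᵒᵖ M] where
  lcoact : BimodHom A B M (BTensor A C M)
  rcoact : BimodHom A B M (BTensor B M D)
  lcoassoc : ∀ m, BTensor.assoc C C M (BTensor.map K.comul.right LinearMap.id (lcoact m)) =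
    BTensor.map LinearMap.id lcoact.left (lcoact m)
  lcounit : ∀ m, BTensor.lid A M (BTensor.map K.counit.right LinearMap.id (lcoact m)) = m
  rcoassoc : ∀ m, BTensor.assoc M D D (BTensor.map rcoact.right LinearMap.id (rcoact m)) =
    BTensor.map LinearMap.id H.comul.left (rcoact m)
  rcounit : ∀ m, BTensor.rid B M (BTensor.map LinearMap.id H.counit.left (rcoact m)) = m
  comm : ∀ m, BTensor.assoc C M D (BTensor.map lcoact.right LinearMap.id (rcoact m)) =
    BTensor.map LinearMap.id rcoact.left (lcoact m)

namespace Bicomodule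

variable {K : Coring A C} {H : Coring B D} {M : Type u} [AddCommGroup M] [Module A M]
    [Module Bᵐᵒᵖ M] [SMulCommClass A Bᵐᵒᵖ M]

/-- The underlying left comodule. -/
def toLeft (s : Bicomodule K H M) : LeftComodule K M where
  coact := s.lcoact.left
  coassoc := s.lcoassoc
  counit := s.lcounit

/-- The underlying right comodule. -/
def toRight (s : Bicomodule K H M) : RightComodule H M where
  coact := s.rcoact.right
  coassoc := s.rcoassoc
  counit := s.rcounit

end Bicomodule

/-- `C` as a bicomodule over itself. -/
def Coring.regular (K : Coring A C) : Bicomodule K K C where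
  lcoact := K.comul
  rcoact := K.comul
  lcoassoc := K.coassoc
  lcounit := K.counit_comul
  rcoassoc := K.coassoc
  rcounit := K.comul_counit
  comm := K.coassoc

/-- Morphisms of bicomodules (bicolinear maps). -/
structure BicomodHom {K : Coring A C} {H : Coring B D} {M N : Type u} [AddCommGroup M] [Module A M]
    [Module Bᵐᵒᵖ M] [SMulCommClass A Bᵐᵒᵖ M] [AddCommGroup N] [Module A N]
    [Module Bᵐᵒᵖ N] [SMulCommClass A Bᵐᵒᵖ N] (s : Bicomodule K H M) (t : Bicomodule K H N)
    extends BimodHom A B M N where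
  left_colinear : IsLeftColinear s.toLeft t.toLeft toBimodHom.left
  right_colinear : IsRightColinear s.toRight t.toRight toBimodHom.right

/-- The identity morphism of a bicomodule. -/
def BicomodHom.id {K : Coring A C} {H : Coring B D} {M : Type u} [AddCommGroup M] [Module A M]
    [Module Bᵐᵒᵖ M] [SMulCommClass A Bᵐᵒᵖ M] (s : Bicomodule K H M) : BicomodHom s s where
  toAddMonoidHom := AddMonoidHom.id M
  map_smul_left _ _ := rfl
  map_smul_right _ _ := rfl
  left_colinear := isLeftColinear_id s.toLeft
  right_colinear := isRightColinear_id s.toRight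

section CotensorBimodule

variable {K : Coring A C} {H : Coring B D} {J : Coring E G}
  {M : Type u} [AddCommGroup M] [Module A M] [Module Bᵐᵒᵖ M] [SMulCommClass A Bᵐᵒᵖ M]
  {N : Type u} [AddCommGroup N] [Module B N] [Module Eᵐᵒᵖ N] [SMulCommClass B Eᵐᵒᵖ N]

/-- The cotensor product `M □_D N` of a `(C, D)`-bicomodule and a `(D, G)`-bicomodule; a
sub-bimodule of `M ⊗_B N`. -/
def Cotensor (s : Bicomodule K H M) (t : Bicomodule H J N) : Type u :=
  cotensor s.toRight t.toLeft

variable (s : Bicomodule K H M) (t : Bicomodule H J N)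

instance : AddCommGroup (Cotensor s t) :=
  inferInstanceAs (AddCommGroup (cotensor s.toRight t.toLeft))

theorem smul_left_mem (a : A) {z : BTensor B M N} (hz : z ∈ cotensor s.toRight t.toLeft) :
    a • z ∈ cotensor s.toRight t.toLeft := by
  have hz' : BTensor.assoc M D N (BTensor.map s.toRight.coact LinearMap.id z) =
    BTensor.map LinearMap.id t.toLeft.coact z := hz
  change BTensor.assoc M D N (BTensor.map s.toRight.coact LinearMap.id (a • z)) =
    BTensor.map LinearMap.id t.toLeft.coact (a • z)
  have h1 : BTensor.map s.toRight.coact LinearMap.id (a • z) =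
      a • BTensor.map s.toRight.coact LinearMap.id z := by
    clear hz hz'
    induction z using BTensor.induction with
    | tmul' m n =>
      simp only [BTensor.smul_tmul_left, BTensor.map_tmul]
      congr 1
      exact s.rcoact.map_smul_left a m
    | add' x y hx hy => simp only [smul_add, map_add, hx, hy]
  have h2 : ∀ w : BTensor B (BTensor B M D) N,
      BTensor.assoc M D N (a • w) = a • BTensor.assoc M D N w := by
    intro w
    induction w using BTensor.induction with
    | tmul' w n =>
      induction w using BTensor.induction with
      | tmul' m d => rfl
      | add' x y hx hy => simp only [BTensor.add_tmul, smul_add, map_add, hx, hy]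
    | add' x y hx hy => simp only [smul_add, map_add, hx, hy]
  have h3 : BTensor.map LinearMap.id t.toLeft.coact (a • z) =
      a • BTensor.map (LinearMap.id : M →ₗ[Bᵐᵒᵖ] M) t.toLeft.coact z := by
    clear hz hz' h1
    induction z using BTensor.induction with
    | tmul' m n => rfl
    | add' x y hx hy => simp only [smul_add, map_add, hx, hy]
  rw [h1, h2, h3, hz']

theorem smul_right_mem (e : Eᵐᵒᵖ) {z : BTensor B M N} (hz : z ∈ cotensor s.toRight t.toLeft) :
    e • z ∈ cotensor s.toRight t.toLeft := by
  have hz' : BTensor.assoc M D N (BTensor.map s.toRight.coact LinearMap.id z) =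
    BTensor.map LinearMap.id t.toLeft.coact z := hz
  change BTensor.assoc M D N (BTensor.map s.toRight.coact LinearMap.id (e • z)) =
    BTensor.map LinearMap.id t.toLeft.coact (e • z)
  have h1 : BTensor.map s.toRight.coact LinearMap.id (e • z) =
      e • BTensor.map s.toRight.coact (LinearMap.id : N →ₗ[B] N) z := by
    clear hz hz'
    induction z using BTensor.induction with
    | tmul' m n => rfl
    | add' x y hx hy => simp only [smul_add, map_add, hx, hy]
  have h2 : ∀ w : BTensor B (BTensor B M D) N,
      BTensor.assoc M D N (e • w) = e • BTensor.assoc M D N w := by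
    intro w
    induction w using BTensor.induction with
    | tmul' w n =>
      induction w using BTensor.induction with
      | tmul' m d => rfl
      | add' x y hx hy =>
        simp only [BTensor.smul_tmul_right] at hx hy ⊢
        simp only [BTensor.add_tmul, smul_add, map_add, hx, hy]
    | add' x y hx hy => simp only [smul_add, map_add, hx, hy]
  have h3 : BTensor.map LinearMap.id t.toLeft.coact (e • z) =
      e • BTensor.map (LinearMap.id : M →ₗ[Bᵐᵒᵖ] M) t.toLeft.coact z := by
    clear hz hz' h1
    induction z using BTensor.induction with
    | tmul' m n =>
      simp only [BTensor.smul_tmul_right, BTensor.map_tmul]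
      congr 1
      exact t.lcoact.map_smul_right (unop e) n
    | add' x y hx hy => simp only [smul_add, map_add, hx, hy]
  rw [h1, h2, h3, hz']

instance instLeftCotensor : Module A (Cotensor s t) where
  smul a z := ⟨a • z.1, smul_left_mem s t a z.2⟩
  one_smul z := Subtype.ext (one_smul A z.1)
  mul_smul a b z := Subtype.ext (mul_smul a b z.1)
  smul_zero a := Subtype.ext (smul_zero a)
  smul_add a z w := Subtype.ext (smul_add a z.1 w.1)
  add_smul a b z := Subtype.ext (add_smul a b z.1)
  zero_smul z := Subtype.ext (zero_smul A z.1)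

instance instRightCotensor : Module Eᵐᵒᵖ (Cotensor s t) where
  smul a z := ⟨a • z.1, smul_right_mem s t a z.2⟩
  one_smul z := Subtype.ext (one_smul Eᵐᵒᵖ z.1)
  mul_smul a b z := Subtype.ext (mul_smul a b z.1)
  smul_zero a := Subtype.ext (smul_zero a)
  smul_add a z w := Subtype.ext (smul_add a z.1 w.1)
  add_smul a b z := Subtype.ext (add_smul a b z.1)
  zero_smul z := Subtype.ext (zero_smul Eᵐᵒᵖ z.1)

instance : SMulCommClass A Eᵐᵒᵖ (Cotensor s t) where
  smul_comm a e z := Subtype.ext (smul_comm a e z.1)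

/-- The inclusion `M □_D N → M ⊗_B N`, a bimodule map. -/
def Cotensor.incl : BimodHom A E (Cotensor s t) (BTensor B M N) where
  toAddMonoidHom := (cotensor s.toRight t.toLeft).subtype
  map_smul_left _ _ := rfl
  map_smul_right _ _ := rfl

variable {s t} in
/-- The cotensor product `f □_D g` of two bicomodule morphisms. -/
def Cotensor.map {M' : Type u} [AddCommGroup M'] [Module A M'] [Module Bᵐᵒᵖ M']
    [SMulCommClass A Bᵐᵒᵖ M'] {N' : Type u} [AddCommGroup N'] [Module B N'] [Module Eᵐᵒᵖ N']
    [SMulCommClass B Eᵐᵒᵖ N'] {s' : Bicomodule K H M'} {t' : Bicomodule H J N'}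
    (f : BicomodHom s s') (g : BicomodHom t t') : Cotensor s t →+ Cotensor s' t' :=
  cotensorMap f.right g.left f.right_colinear g.left_colinear

/-- The bicomodule structure `c` on `M □_D N` is the canonical one, that is, the inclusion into
`M ⊗_B N` (with the coactions `λ_M ⊗ N` and `M ⊗ ρ_N`) is bicolinear. -/
def IsCanonicalBicomodule (c : Bicomodule K J (Cotensor s t)) : Prop :=
  (∀ z, BTensor.map LinearMap.id (Cotensor.incl s t).left (c.lcoact z) =
    BTensor.assoc C M N (BTensor.map s.lcoact.right LinearMap.id (Cotensor.incl s t z))) ∧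
  (∀ z, BTensor.assoc M N G (BTensor.map (Cotensor.incl s t).right LinearMap.id (c.rcoact z)) =
    BTensor.map LinearMap.id t.rcoact.left (Cotensor.incl s t z))

/-- The isomorphism `M ≃ M □_D D` given by the coaction. -/
def toCotensorRegular (m : M) : Cotensor s H.regular := ⟨s.rcoact m, s.rcoassoc m⟩

/-- The isomorphism `N ≃ D □_D N` given by the coaction. -/
def toRegularCotensor (n : N) : Cotensor H.regular t := ⟨t.lcoact n, t.lcoassoc n⟩

end CotensorBimodule

/-- `α` is the canonical isomorphism `(L □_C M) □_D N ≃ L □_C (M □_D N)`, that is, the one compatible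
with the isomorphism `(L ⊗_A M) ⊗_B N ≃ L ⊗_A (M ⊗_B N)`. Here `c` and `d` are the
bicomodule structures on `L □_C M` and `M □_D N`. -/
def IsCanonicalAssoc {F P : Type u} [Ring F] [AddCommGroup P] [Module F P] [Module Fᵐᵒᵖ P]
    [SMulCommClass F Fᵐᵒᵖ P]
    {K : Coring A C} {H : Coring B D} {J : Coring E G} {I : Coring F P}
    {L : Type u} [AddCommGroup L] [Module F L] [Module Aᵐᵒᵖ L] [SMulCommClass F Aᵐᵒᵖ L]
    {M : Type u} [AddCommGroup M] [Module A M] [Module Bᵐᵒᵖ M] [SMulCommClass A Bᵐᵒᵖ M]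
    {N : Type u} [AddCommGroup N] [Module B N] [Module Eᵐᵒᵖ N] [SMulCommClass B Eᵐᵒᵖ N]
    (r : Bicomodule I K L) (s : Bicomodule K H M) (t : Bicomodule H J N)
    (c : Bicomodule I H (Cotensor r s)) (d : Bicomodule K J (Cotensor s t))
    (α : Cotensor c t ≃+ Cotensor r d) : Prop :=
  ∀ z, BTensor.map LinearMap.id (Cotensor.incl s t).left (Cotensor.incl r d (α z)) =
    BTensor.assoc L M N
      (BTensor.map (Cotensor.incl r s).right LinearMap.id (Cotensor.incl c t z))

section Context

variable {K : Coring A C} {H : Coring B D}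
  {X : Type u} [AddCommGroup X] [Module A X] [Module Bᵐᵒᵖ X] [SMulCommClass A Bᵐᵒᵖ X]
  {Y : Type u} [AddCommGroup Y] [Module B Y] [Module Aᵐᵒᵖ Y] [SMulCommClass B Aᵐᵒᵖ Y]

/-- For `ψ : C → X □_D Y`, the composite
`X → C ⊗_A X → (X □_D Y) ⊗_A X → (X ⊗_B Y) ⊗_A X ≃ X ⊗_B (Y ⊗_A X)`
of the coaction of `X`, `ψ ⊗ X`, the inclusion and the associativity isomorphism. -/
def insertion (sX : Bicomodule K H X) (sY : Bicomodule H K Y)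
    (ψ : BimodHom A A C (Cotensor sX sY)) : X →ₗ[A] BTensor B X (BTensor A Y X) where
  toFun x := BTensor.assoc X Y X (BTensor.map (Cotensor.incl sX sY).right LinearMap.id
    (BTensor.map ψ.right LinearMap.id (sX.lcoact x)))
  map_add' x y := by
    change BTensor.assoc X Y X (BTensor.map _ _ (BTensor.map _ _ (sX.lcoact.left (x + y)))) = _
    rw [map_add, map_add, map_add, map_add]
    rfl
  map_smul' a x := by
    change BTensor.assoc X Y X (BTensor.map _ _ (BTensor.map _ _ (sX.lcoact.left (a • x)))) =
      a • BTensor.assoc X Y X (BTensor.map _ _ (BTensor.map _ _ (sX.lcoact.left x)))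
    rw [map_smul, BTensor.map_map, BTensor.map_map]
    generalize sX.lcoact.left x = w
    induction w using BTensor.induction with
    | tmul' c x =>
      rw [BTensor.smul_tmul_left, BTensor.map_tmul, BTensor.map_tmul]
      have h : ((Cotensor.incl sX sY).right ∘ₗ ψ.right) (a • c) =
          a • ((Cotensor.incl sX sY).right ∘ₗ ψ.right) c := by
        change Cotensor.incl sX sY (ψ (a • c)) = a • Cotensor.incl sX sY (ψ c)
        rw [ψ.map_smul_left]
        rfl
      rw [h]
      generalize ((Cotensor.incl sX sY).right ∘ₗ ψ.right) c = v
      induction v using BTensor.induction with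
      | tmul' m n => rfl
      | add' p q hp hq => rw [smul_add, BTensor.add_tmul, BTensor.add_tmul, map_add, map_add,
          smul_add, hp, hq]
    | add' p q hp hq => rw [smul_add, map_add, map_add, map_add, map_add, smul_add, hp, hq]

/-- `δ` is the coproduct induced by `ψ : C → X □_D Y` on `Y □_C X`, that is, the composite
`Y □ X ≃ Y □ (C □ X) → Y □ ((X □ Y) □ X) ≃ (Y □ X) □ (Y □ X) → (Y □ X) ⊗_B (Y □ X)`
whose second map is `Y □ (ψ □ X)`. Every map in it is a restriction of the corresponding map of
tensor products, so the composite is described by its image in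
`(Y ⊗_A X) ⊗_B (Y ⊗_A X) ≃ Y ⊗_A (X ⊗_B (Y ⊗_A X))`; `d` is the bicomodule structure on `Y □_C X`. -/
def IsInducedCoproduct (sX : Bicomodule K H X) (sY : Bicomodule H K Y)
    (d : Bicomodule H H (Cotensor sY sX)) (ψ : BimodHom A A C (Cotensor sX sY))
    (δ : Cotensor sY sX → BTensor B (Cotensor sY sX) (Cotensor sY sX)) : Prop :=
  ∀ z, δ z ∈ cotensor d.toRight d.toLeft ∧
    BTensor.assoc Y X (BTensor A Y X)
      (BTensor.map (Cotensor.incl sY sX).right (Cotensor.incl sY sX).left (δ z)) =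
    BTensor.map LinearMap.id (insertion sX sY ψ) (Cotensor.incl sY sX z)

end Context

end Bicomodules

end NCCoring

open NCCoring

/-!
# The coring structure on `Y □_C X`

Write `Z = Y □_C X`. Everything takes place inside tensor products of `X` and `Y`: a structure on a
cotensor product is obtained by restricting the corresponding structure of the tensor product, and
an identity is checked after applying the inclusion. This needs two kinds of purity for an
equalizer `M □_D N ⊆ M ⊗ N`, namely that `W ⊗ -` (`CotensorPureLeft`) or `- ⊗ W`
(`CotensorPureRight`) preserves it. `cotensor_purity` extracts them from the three alternative
hypotheses:

* over a von Neumann regular ring all modules are flat (`IsVonNeumannRegular.isFlatLeft`,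
  `IsVonNeumannRegular.isFlatRight`), because a finite set in a submodule of a free module is fixed
  by an endomorphism with image in that submodule;
* if `D` is coseparable, the pair of maps defining `M □_D N` is contractible by bimodule maps
  (`IsCoseparable.exists_splitting`), so every additive functor preserves its equalizer;
* if `D` is flat and `N` is coflat, then `N` is flat (`IsCoflatLeft.isFlatLeft`) and
  `W ⊗ (M □ N) ≃ (W ⊗ M) □ N` for every `W` (`IsCoflatLeft.cotensorPureLeft`), by comparison with a
  free cover of `W`.

Given purity, the coactions of `M ⊗ N` restrict to `M □_D N`, because the two maps defining the
cotensor product are bicolinear (`existsUnique_isCanonicalBicomodule`), and both iterated cotensor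
products are the same subgroup of `L ⊗ M ⊗ N` (`existsUnique_isCanonicalAssoc`).

For the coring structure, `ψ` induces a coaction `i : X → X ⊗ Z`, `x ↦ ψ x₋₁ ⊗ x₀`, and a coaction
`k : Y → Z ⊗ Y`, `y ↦ y₀ ⊗ ψ y₁`. Since `i` is left `C`-colinear, `∑ y ⊗ i x` lies in `Z ⊗ Z` whenever
`∑ y ⊗ x` lies in `Z`; this is the coproduct. It is coassociative because `i` is compatible with it
(`ComatrixContext.i_coassoc`), which amounts to the colinearity of `i`. The triangle identities say
that `X ⊗ ω` takes `i` to the coaction of `X` and that `ω ⊗ Y` takes `k` to that of `Y`; as the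
coproduct is `Y ⊗ i` as well as `k ⊗ X`, the two counit laws follow from those of `X` and `Y`.
-/

/-! ### Bimodule homomorphisms -/

namespace NCCoring

namespace BimodHom

variable {A B M N P : Type u} [Ring A] [Ring B] [AddCommGroup M] [Module A M]
    [Module Bᵐᵒᵖ M] [AddCommGroup N] [Module A N] [Module Bᵐᵒᵖ N]
    [AddCommGroup P] [Module A P] [Module Bᵐᵒᵖ P]

@[ext]
theorem ext {f g : BimodHom A B M N} (h : ∀ m, f m = g m) : f = g := by
  obtain ⟨f, hf, hf'⟩ := f
  obtain ⟨g, hg, hg'⟩ := g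
  have : f = g := AddMonoidHom.ext h
  subst this
  rfl

@[simp] protected theorem map_add (f : BimodHom A B M N) (x y : M) : f (x + y) = f x + f y :=
  map_add f.toAddMonoidHom x y

@[simp] protected theorem map_zero (f : BimodHom A B M N) : f 0 = 0 :=
  map_zero f.toAddMonoidHom

protected theorem smul_left (f : BimodHom A B M N) (a : A) (m : M) : f (a • m) = a • f m :=
  f.map_smul_left a m

protected theorem smul_right (f : BimodHom A B M N) (b : Bᵐᵒᵖ) (m : M) : f (b • m) = b • f m :=
  f.map_smul_right (unop b) m

variable (A B M) in
/-- The identity bimodule homomorphism. -/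
def id : BimodHom A B M M where
  toAddMonoidHom := AddMonoidHom.id M
  map_smul_left _ _ := rfl
  map_smul_right _ _ := rfl

/-- The composite of bimodule homomorphisms. -/
def comp (g : BimodHom A B N P) (f : BimodHom A B M N) : BimodHom A B M P where
  toAddMonoidHom := g.toAddMonoidHom.comp f.toAddMonoidHom
  map_smul_left a m := (congrArg g (f.map_smul_left a m)).trans (g.map_smul_left a _)
  map_smul_right a m := (congrArg g (f.map_smul_right a m)).trans (g.map_smul_right a _)

/-- The factorization of `F : M → P` through an injective `j : N → P` whose image contains that
of `F`. -/
noncomputable def factor (j : BimodHom A B N P) (hj : Function.Injective j) (F : BimodHom A B M P)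
    (h : ∀ m, ∃ n, j n = F m) : BimodHom A B M N where
  toFun m := (h m).choose
  map_zero' := hj (by rw [(h 0).choose_spec, F.map_zero, j.map_zero])
  map_add' x y := hj (by
    rw [(h (x + y)).choose_spec, F.map_add, j.map_add, (h x).choose_spec, (h y).choose_spec])
  map_smul_left a m := hj (by
    rw [(h (a • m)).choose_spec, F.smul_left, j.smul_left, (h m).choose_spec])
  map_smul_right b m := hj (by
    rw [(h (op b • m)).choose_spec, F.smul_right, j.smul_right, (h m).choose_spec])

theorem factor_spec (j : BimodHom A B N P) (hj : Function.Injective j) (F : BimodHom A B M P)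
    (h : ∀ m, ∃ n, j n = F m) (m : M) : j (factor j hj F h m) = F m :=
  (h m).choose_spec

end BimodHom

/-! ### Functoriality of the tensor product -/

namespace BTensor

section Basic

variable {R : Type u} [Ring R] {M N P : Type u} [AddCommGroup M] [Module Rᵐᵒᵖ M]
  [AddCommGroup N] [Module R N] [AddCommGroup P]
  {M' N' : Type u} [AddCommGroup M'] [Module Rᵐᵒᵖ M'] [AddCommGroup N'] [Module R N']

theorem map_id (t : BTensor R M N) : map LinearMap.id LinearMap.id t = t := by
  induction t using BTensor.induction with
  | tmul' m n => rfl
  | add' x y hx hy => rw [map_add, hx, hy]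

theorem map_congr {f f' : M →ₗ[Rᵐᵒᵖ] M'} {g g' : N →ₗ[R] N'} (hf : ∀ m, f m = f' m)
    (hg : ∀ n, g n = g' n) (t : BTensor R M N) : map f g t = map f' g' t := by
  rw [LinearMap.ext hf, LinearMap.ext hg]

theorem zero_tmul (n : N) : tmul R (0 : M) n = 0 := by
  have h : tmul R (0 : M) n + tmul R (0 : M) n = tmul R (0 : M) n := by rw [← add_tmul, add_zero]
  simpa using h

theorem tmul_zero (m : M) : tmul R m (0 : N) = 0 := by
  have h : tmul R m (0 : N) + tmul R m (0 : N) = tmul R m (0 : N) := by rw [← tmul_add, add_zero]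
  simpa using h

theorem map_sub_left (f f' : M →ₗ[Rᵐᵒᵖ] M') (g : N →ₗ[R] N') (t : BTensor R M N) :
    map (f - f') g t = map f g t - map f' g t := by
  induction t using BTensor.induction with
  | tmul' m n =>
    rw [map_tmul, map_tmul, map_tmul, eq_sub_iff_add_eq, ← add_tmul, LinearMap.sub_apply,
      sub_add_cancel]
  | add' x y hx hy => rw [map_add, map_add, map_add, hx, hy]; abel

theorem map_sub_right (f : M →ₗ[Rᵐᵒᵖ] M') (g g' : N →ₗ[R] N') (t : BTensor R M N) :
    map f (g - g') t = map f g t - map f g' t := by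
  induction t using BTensor.induction with
  | tmul' m n =>
    rw [map_tmul, map_tmul, map_tmul, eq_sub_iff_add_eq, ← tmul_add, LinearMap.sub_apply,
      sub_add_cancel]
  | add' x y hx hy => rw [map_add, map_add, map_add, hx, hy]; abel

theorem map_zero_left (g : N →ₗ[R] N') (t : BTensor R M N) :
    map (0 : M →ₗ[Rᵐᵒᵖ] M') g t = 0 := by
  simpa using map_sub_left (0 : M →ₗ[Rᵐᵒᵖ] M') 0 g t

theorem map_zero_right (f : M →ₗ[Rᵐᵒᵖ] M') (t : BTensor R M N) :
    map f (0 : N →ₗ[R] N') t = 0 := by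
  simpa using map_sub_right f (0 : N →ₗ[R] N') 0 t

theorem map_surjective {f : M →ₗ[Rᵐᵒᵖ] M'} {g : N →ₗ[R] N'} (hf : Function.Surjective f)
    (hg : Function.Surjective g) : Function.Surjective (map f g) := fun t => by
  induction t using BTensor.induction with
  | tmul' m n =>
    obtain ⟨m, rfl⟩ := hf m
    obtain ⟨n, rfl⟩ := hg n
    exact ⟨tmul R m n, rfl⟩
  | add' x y hx hy =>
    obtain ⟨x, rfl⟩ := hx
    obtain ⟨y, rfl⟩ := hy
    exact ⟨x + y, map_add _ x y⟩

end Basic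

section Bimodules

variable {S R T U : Type u} [Ring S] [Ring R] [Ring T] [Ring U]
  {M M' N N' L L' : Type u} [AddCommGroup M] [AddCommGroup M'] [AddCommGroup N] [AddCommGroup N']
  [AddCommGroup L] [AddCommGroup L']
  [Module Rᵐᵒᵖ M] [Module Rᵐᵒᵖ M'] [Module R N] [Module R N']

section

variable [Module S M] [SMulCommClass S Rᵐᵒᵖ M] [Module S M'] [SMulCommClass S Rᵐᵒᵖ M']

theorem map_smul_left (f : BimodHom S R M M') (g : N →ₗ[R] N') (s : S) (t : BTensor R M N) :
    map f.right g (s • t) = s • map f.right g t := by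
  induction t using BTensor.induction with
  | tmul' m n =>
    rw [smul_tmul_left, map_tmul, map_tmul, smul_tmul_left]
    exact congrArg (tmul R · (g n)) (f.map_smul_left s m)
  | add' x y hx hy => rw [smul_add, map_add, map_add, smul_add, hx, hy]

/-- `f ⊗ g` as a homomorphism of left modules. -/
def mapLeft (f : BimodHom S R M M') (g : N →ₗ[R] N') : BTensor R M N →ₗ[S] BTensor R M' N' :=
  { map f.right g with map_smul' := map_smul_left f g }

end

section

variable [Module Tᵐᵒᵖ N] [SMulCommClass R Tᵐᵒᵖ N] [Module Tᵐᵒᵖ N'] [SMulCommClass R Tᵐᵒᵖ N']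

theorem map_smul_right (f : M →ₗ[Rᵐᵒᵖ] M') (g : BimodHom R T N N') (s : Tᵐᵒᵖ)
    (t : BTensor R M N) : map f g.left (s • t) = s • map f g.left t := by
  induction t using BTensor.induction with
  | tmul' m n =>
    rw [smul_tmul_right, map_tmul, map_tmul, smul_tmul_right]
    exact congrArg (tmul R (f m)) (g.map_smul_right s.unop n)
  | add' x y hx hy => rw [smul_add, map_add, map_add, smul_add, hx, hy]

/-- `f ⊗ g` as a homomorphism of right modules. -/
def mapRight (f : M →ₗ[Rᵐᵒᵖ] M') (g : BimodHom R T N N') :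
    BTensor R M N →ₗ[Tᵐᵒᵖ] BTensor R M' N' :=
  { map f g.left with map_smul' := map_smul_right f g }

variable [Module S M] [SMulCommClass S Rᵐᵒᵖ M] [Module S M'] [SMulCommClass S Rᵐᵒᵖ M']

/-- `f ⊗ g` as a homomorphism of bimodules. -/
def mapBi (f : BimodHom S R M M') (g : BimodHom R T N N') :
    BimodHom S T (BTensor R M N) (BTensor R M' N') where
  toAddMonoidHom := map f.right g.left
  map_smul_left := map_smul_left f g.left
  map_smul_right b := map_smul_right f.right g (op b)

end

section

variable [Module Tᵐᵒᵖ N] [SMulCommClass R Tᵐᵒᵖ N] [Module Tᵐᵒᵖ N'] [SMulCommClass R Tᵐᵒᵖ N']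
  [Module T L] [Module T L']

/-- Naturality of the associativity isomorphism. -/
theorem assoc_map_map (f : M →ₗ[Rᵐᵒᵖ] M') (g : BimodHom R T N N') (h : L →ₗ[T] L')
    (w : BTensor T (BTensor R M N) L) :
    assoc M' N' L' (map (mapRight f g) h w) = map f (mapLeft g h) (assoc M N L w) := by
  induction w using BTensor.induction with
  | tmul' t n =>
    induction t using BTensor.induction with
    | tmul' m c => rfl
    | add' x y hx hy => rw [add_tmul, map_add, map_add, hx, hy, map_add, map_add]
  | add' x y hx hy => rw [map_add, map_add, hx, hy, map_add, map_add]

theorem assoc_smul_right [Module Uᵐᵒᵖ L] [SMulCommClass T Uᵐᵒᵖ L] (s : Uᵐᵒᵖ)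
    (w : BTensor T (BTensor R M N) L) :
    assoc M N L (s • w) = s • assoc M N L w := by
  induction w using BTensor.induction with
  | tmul' w n =>
    induction w using BTensor.induction with
    | tmul' m d => rfl
    | add' x y hx hy =>
      rw [add_tmul, smul_add, map_add, map_add, smul_add, hx, hy]
  | add' x y hx hy => rw [smul_add, map_add, map_add, smul_add, hx, hy]

variable [Module S M] [SMulCommClass S Rᵐᵒᵖ M]

theorem assoc_smul_left (s : S) (w : BTensor T (BTensor R M N) L) :
    assoc M N L (s • w) = s • assoc M N L w := by
  induction w using BTensor.induction with
  | tmul' w n =>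
    induction w using BTensor.induction with
    | tmul' m d => rfl
    | add' x y hx hy => rw [add_tmul, smul_add, map_add, map_add, smul_add, hx, hy]
  | add' x y hx hy => rw [smul_add, map_add, map_add, smul_add, hx, hy]

variable [Module Uᵐᵒᵖ L] [SMulCommClass T Uᵐᵒᵖ L]

variable (S R T U M N L) in
/-- The associativity isomorphism as a homomorphism of bimodules. -/
def assocBi : BimodHom S U (BTensor T (BTensor R M N) L) (BTensor R M (BTensor T N L)) where
  toAddMonoidHom := (assoc M N L).toAddMonoidHom
  map_smul_left := assoc_smul_left
  map_smul_right b := assoc_smul_right (op b)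

variable (S R T U M N L) in
/-- The inverse of the associativity isomorphism as a homomorphism of bimodules. -/
def assocSymmBi : BimodHom S U (BTensor R M (BTensor T N L)) (BTensor T (BTensor R M N) L) where
  toAddMonoidHom := (assoc M N L).symm.toAddMonoidHom
  map_smul_left s w := (assoc M N L).injective (by
    change assoc M N L ((assoc M N L).symm _) = assoc M N L (s • (assoc M N L).symm _)
    rw [assoc_smul_left, AddEquiv.apply_symm_apply, AddEquiv.apply_symm_apply])
  map_smul_right s w := (assoc M N L).injective (by
    change assoc M N L ((assoc M N L).symm _) = assoc M N L (op s • (assoc M N L).symm _)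
    rw [assoc_smul_right, AddEquiv.apply_symm_apply, AddEquiv.apply_symm_apply])

end

section

variable [Module Tᵐᵒᵖ N] [SMulCommClass R Tᵐᵒᵖ N]

variable (R T N) in
/-- The homomorphism `n ↦ m ⊗ n`. -/
def tmulLeft (m : M) : N →ₗ[Tᵐᵒᵖ] BTensor R M N where
  toFun n := tmul R m n
  map_add' := tmul_add m
  map_smul' _ _ := rfl

theorem assoc_symm_tmul_left [Module T L] (m : M) (u : BTensor T N L) :
    (assoc M N L).symm (tmul R m u) = map (tmulLeft R T N m) LinearMap.id u := by
  induction u using BTensor.induction with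
  | tmul' n l => rfl
  | add' x y hx hy => rw [tmul_add, map_add, map_add, hx, hy]

end

section

variable [Module S M] [SMulCommClass S Rᵐᵒᵖ M]

variable (S R M) in
/-- The homomorphism `m ↦ m ⊗ n`. -/
def tmulRight (n : N) : M →ₗ[S] BTensor R M N where
  toFun m := tmul R m n
  map_add' m m' := add_tmul m m' n
  map_smul' _ _ := rfl

theorem assoc_tmul_right [Module Sᵐᵒᵖ L] (n : N) (u : BTensor S L M) :
    assoc L M N (tmul R u n) = map LinearMap.id (tmulRight S R M n) u := by
  induction u using BTensor.induction with
  | tmul' n l => rfl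
  | add' x y hx hy => rw [add_tmul, map_add, map_add, hx, hy]

end

end Bimodules

section Unit

variable {R : Type u} [Ring R] {M M' N N' : Type u} [AddCommGroup M] [Module Rᵐᵒᵖ M]
  [AddCommGroup M'] [Module Rᵐᵒᵖ M']
  [AddCommGroup N] [Module R N] [AddCommGroup N'] [Module R N']

theorem lid_map (g : N →ₗ[R] N') (t : BTensor R R N) :
    lid R N' (map LinearMap.id g t) = g (lid R N t) := by
  induction t using BTensor.induction with
  | tmul' r n => exact (g.map_smul r n).symm
  | add' x y hx hy => rw [map_add, map_add, map_add, map_add, hx, hy]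

theorem rid_map (g : M →ₗ[Rᵐᵒᵖ] M') (t : BTensor R M R) :
    rid R M' (map g LinearMap.id t) = g (rid R M t) := by
  induction t using BTensor.induction with
  | tmul' m r => exact (g.map_smul (op r) m).symm
  | add' x y hx hy => rw [map_add, map_add, map_add, map_add, hx, hy]

end Unit

end BTensor

end NCCoring

/-! ### Right exactness and flatness -/

namespace NCCoring

namespace BTensor

variable {R : Type u} [Ring R]

section RightExact

variable {P P' P'' N : Type u} [AddCommGroup P] [AddCommGroup P'] [AddCommGroup P'']
  [AddCommGroup N]

/-- Right exactness of `- ⊗ N`. The inverse of `(P' ⊗ N) / im → P'' ⊗ N` sends `g p ⊗ n` to the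
class of `p ⊗ n`. -/
theorem exists_map_left_of_map_eq_zero [Module Rᵐᵒᵖ P] [Module Rᵐᵒᵖ P'] [Module Rᵐᵒᵖ P'']
    [Module R N] {f : P →ₗ[Rᵐᵒᵖ] P'} {g : P' →ₗ[Rᵐᵒᵖ] P''} (hfg : ∀ p, g p = 0 → ∃ q, f q = p)
    (hg : Function.Surjective g) {t : BTensor R P' N}
    (ht : map g (LinearMap.id : N →ₗ[R] N) t = 0) :
    ∃ s, map f (LinearMap.id : N →ₗ[R] N) s = t := by
  set I := (map f (LinearMap.id : N →ₗ[R] N)).range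
  have key : ∀ p p' n, g p = g p' →
      (QuotientAddGroup.mk (tmul R p n) : BTensor R P' N ⧸ I) =
        QuotientAddGroup.mk (tmul R p' n) := by
    intro p p' n h
    obtain ⟨q, hq⟩ := hfg (p - p') (by rw [map_sub, h, sub_self])
    refine QuotientAddGroup.eq_iff_sub_mem.2 ⟨tmul R q n, ?_⟩
    rw [map_tmul, hq, eq_sub_iff_add_eq, LinearMap.id_apply, ← add_tmul, sub_add_cancel]
  let φ : BTensor R P'' N →+ BTensor R P' N ⧸ I :=
    lift (mk2 (fun p n => QuotientAddGroup.mk (tmul R (Function.surjInv hg p) n))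
      (fun p p' n => by
        rw [← QuotientAddGroup.mk_add, ← add_tmul]
        exact key _ _ _ (by simp only [map_add, Function.surjInv_eq]))
      (fun p n n' => by rw [← QuotientAddGroup.mk_add, ← tmul_add]))
      (fun r p n => by
        rw [mk2_apply, mk2_apply, ← smul_tmul]
        exact key _ _ _ (by simp only [map_smul, Function.surjInv_eq]))
  have hφ : ∀ t, φ (map g LinearMap.id t) = QuotientAddGroup.mk t := by
    intro t
    induction t using BTensor.induction with
    | tmul' p n => exact key _ _ _ (Function.surjInv_eq hg (g p))
    | add' x y hx hy => rw [map_add, map_add, hx, hy]; rfl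
  have h0 := hφ t
  rw [ht, map_zero] at h0
  exact (QuotientAddGroup.eq_zero_iff t).1 h0.symm

/-- Right exactness of `N ⊗ -`. -/
theorem exists_map_right_of_map_eq_zero [Module R P] [Module R P'] [Module R P'']
    [Module Rᵐᵒᵖ N] {f : P →ₗ[R] P'} {g : P' →ₗ[R] P''} (hfg : ∀ p, g p = 0 → ∃ q, f q = p)
    (hg : Function.Surjective g) {t : BTensor R N P'}
    (ht : map (LinearMap.id : N →ₗ[Rᵐᵒᵖ] N) g t = 0) :
    ∃ s, map (LinearMap.id : N →ₗ[Rᵐᵒᵖ] N) f s = t := by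
  set I := (map (LinearMap.id : N →ₗ[Rᵐᵒᵖ] N) f).range
  have key : ∀ p p' n, g p = g p' →
      (QuotientAddGroup.mk (tmul R n p) : BTensor R N P' ⧸ I) =
        QuotientAddGroup.mk (tmul R n p') := by
    intro p p' n h
    obtain ⟨q, hq⟩ := hfg (p - p') (by rw [map_sub, h, sub_self])
    refine QuotientAddGroup.eq_iff_sub_mem.2 ⟨tmul R n q, ?_⟩
    rw [map_tmul, hq, eq_sub_iff_add_eq, LinearMap.id_apply, ← tmul_add, sub_add_cancel]
  let φ : BTensor R N P'' →+ BTensor R N P' ⧸ I :=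
    lift (mk2 (fun n p => QuotientAddGroup.mk (tmul R n (Function.surjInv hg p)))
      (fun n n' p => by rw [← QuotientAddGroup.mk_add, ← add_tmul])
      (fun n p p' => by
        rw [← QuotientAddGroup.mk_add, ← tmul_add]
        exact key _ _ _ (by simp only [map_add, Function.surjInv_eq])))
      (fun r n p => by
        rw [mk2_apply, mk2_apply, smul_tmul]
        exact key _ _ _ (by simp only [map_smul, Function.surjInv_eq]))
  have hφ : ∀ t, φ (map LinearMap.id g t) = QuotientAddGroup.mk t := by
    intro t
    induction t using BTensor.induction with
    | tmul' n p => exact key _ _ _ (Function.surjInv_eq hg (g p))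
    | add' x y hx hy => rw [map_add, map_add, hx, hy]; rfl
  have h0 := hφ t
  rw [ht, map_zero] at h0
  exact (QuotientAddGroup.eq_zero_iff t).1 h0.symm

end RightExact

end BTensor

open BTensor

section Equalizer

variable {R : Type u} [Ring R] {E P Q : Type u} [AddCommGroup E] [AddCommGroup P] [AddCommGroup Q]

/-- `W ⊗ -` maps `j : E → P` to the equalizer of `W ⊗ f` and `W ⊗ g`. -/
structure PreservesEqualizerLeft (W : Type u) [AddCommGroup W] [Module Rᵐᵒᵖ W] [Module R E]
    [Module R P] [Module R Q] (j : E →ₗ[R] P) (f g : P →ₗ[R] Q) : Prop where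
  injective : Function.Injective (map (LinearMap.id : W →ₗ[Rᵐᵒᵖ] W) j)
  exists_eq : ∀ t, map (LinearMap.id : W →ₗ[Rᵐᵒᵖ] W) f t = map LinearMap.id g t →
    ∃ s, map (LinearMap.id : W →ₗ[Rᵐᵒᵖ] W) j s = t

/-- `- ⊗ W` maps `j : E → P` to the equalizer of `f ⊗ W` and `g ⊗ W`. -/
structure PreservesEqualizerRight (W : Type u) [AddCommGroup W] [Module R W] [Module Rᵐᵒᵖ E]
    [Module Rᵐᵒᵖ P] [Module Rᵐᵒᵖ Q] (j : E →ₗ[Rᵐᵒᵖ] P) (f g : P →ₗ[Rᵐᵒᵖ] Q) : Prop where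
  injective : Function.Injective (map j (LinearMap.id : W →ₗ[R] W))
  exists_eq : ∀ t, map f (LinearMap.id : W →ₗ[R] W) t = map g LinearMap.id t →
    ∃ s, map j (LinearMap.id : W →ₗ[R] W) s = t

/-- The kernel of `f - g` is preserved because `W ⊗ im (f - g) → W ⊗ Q` is injective. -/
theorem IsFlatRight.preservesEqualizerLeft {W : Type u} [AddCommGroup W] [Module Rᵐᵒᵖ W]
    [Module R E] [Module R P] [Module R Q] (hW : IsFlatRight R W) {j : E →ₗ[R] P} {f g : P →ₗ[R] Q}
    (hj : Function.Injective j) (he : ∀ p, f p = g p → ∃ e, j e = p) :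
    PreservesEqualizerLeft W j f g where
  injective := hW _ _ j hj
  exists_eq t ht := by
    refine exists_map_right_of_map_eq_zero (g := (f - g).rangeRestrict) (fun p hp => he p ?_)
      (f - g).surjective_rangeRestrict ?_
    · rw [← sub_eq_zero]
      exact congrArg Subtype.val hp
    · refine hW _ _ (LinearMap.range (f - g)).subtype Subtype.val_injective ?_
      rw [map_map, map_zero]
      exact (map_sub_right LinearMap.id f g t).trans (sub_eq_zero.2 ht)

theorem IsFlatLeft.preservesEqualizerRight {W : Type u} [AddCommGroup W] [Module R W]
    [Module Rᵐᵒᵖ E] [Module Rᵐᵒᵖ P] [Module Rᵐᵒᵖ Q] (hW : IsFlatLeft R W) {j : E →ₗ[Rᵐᵒᵖ] P}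
    {f g : P →ₗ[Rᵐᵒᵖ] Q} (hj : Function.Injective j) (he : ∀ p, f p = g p → ∃ e, j e = p) :
    PreservesEqualizerRight W j f g where
  injective := hW _ _ j hj
  exists_eq t ht := by
    refine exists_map_left_of_map_eq_zero (g := (f - g).rangeRestrict) (fun p hp => he p ?_)
      (f - g).surjective_rangeRestrict ?_
    · rw [← sub_eq_zero]
      exact congrArg Subtype.val hp
    · refine hW _ _ (LinearMap.range (f - g)).subtype Subtype.val_injective ?_
      rw [map_map, map_zero]
      exact (map_sub_left f g LinearMap.id t).trans (sub_eq_zero.2 ht)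

end Equalizer

section Flat

variable {R S : Type u} [Ring R] [Ring S]

/-- The tensor product of flat modules is flat. -/
theorem IsFlatLeft.tensor {M N : Type u} [AddCommGroup M] [Module R M] [Module Sᵐᵒᵖ M]
    [SMulCommClass R Sᵐᵒᵖ M] [AddCommGroup N] [Module S N] (hM : IsFlatLeft R M)
    (hN : IsFlatLeft S N) : IsFlatLeft R (BTensor S M N) := by
  intro P Q _ _ _ _ f hf
  have h := hN _ _ (mapRight f (BimodHom.id R S M)) (hM P Q f hf)
  intro x y hxy
  obtain ⟨x, rfl⟩ := (assoc P M N).surjective x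
  obtain ⟨y, rfl⟩ := (assoc P M N).surjective y
  congr 1
  apply h
  apply (assoc Q M N).injective
  rw [assoc_map_map, assoc_map_map]
  have e : mapLeft (BimodHom.id R S M) (LinearMap.id : N →ₗ[S] N) = LinearMap.id :=
    LinearMap.ext map_id
  rw [e]
  exact hxy

/-- A free left module is flat: `P ⊗ R^(ι)` embeds into `P^(ι)`. -/
theorem isFlatLeft_finsupp (ι : Type u) : IsFlatLeft R (ι →₀ R) := by
  intro P Q _ _ _ _ f hf
  let coeff (P : Type u) [AddCommGroup P] [Module Rᵐᵒᵖ P] : BTensor R P (ι →₀ R) →+ (ι →₀ P) :=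
    lift (mk2 (fun p v => v.mapRange (fun r => op r • p) (by simp))
      (fun p p' v => by ext; simp)
      (fun p v v' => by ext; simp [add_smul])) (fun r p v => by ext; simp [mul_smul])
  let back (P : Type u) [AddCommGroup P] [Module Rᵐᵒᵖ P] : (ι →₀ P) →+ BTensor R P (ι →₀ R) :=
    Finsupp.liftAddHom fun i =>
      AddMonoidHom.mk' (fun p => tmul R p (Finsupp.single i 1)) (fun p p' => add_tmul _ _ _)
  have h1 : ∀ t, back P (coeff P t) = t := by
    intro t
    induction t using BTensor.induction with
    | tmul' p v =>
      induction v using Finsupp.induction_linear with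
      | zero => rw [BTensor.tmul_zero, map_zero, map_zero]
      | add v w hv hw => rw [BTensor.tmul_add, map_add, map_add, hv, hw]
      | single i r =>
        change back P (Finsupp.mapRange (fun r => op r • p) (by simp) (Finsupp.single i r)) = _
        rw [Finsupp.mapRange_single, Finsupp.liftAddHom_apply_single]
        change tmul R (op r • p) _ = _
        rw [BTensor.smul_tmul, Finsupp.smul_single, smul_eq_mul, mul_one]
    | add' x y hx hy => rw [map_add, map_add, hx, hy]
  have h2 : ∀ t, coeff Q (map f LinearMap.id t) = (coeff P t).mapRange f (map_zero f) := by
    intro t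
    induction t using BTensor.induction with
    | tmul' p v =>
      ext i
      exact (f.map_smul (op (v i)) p).symm
    | add' x y hx hy => rw [map_add, map_add, hx, hy, map_add]; ext; simp
  intro x y hxy
  rw [← h1 x, ← h1 y]
  congr 1
  apply Finsupp.mapRange_injective f (map_zero f) hf
  rw [← h2, ← h2, hxy]

/-- A free right module is flat. -/
theorem isFlatRight_finsupp (ι : Type u) : IsFlatRight R (ι →₀ Rᵐᵒᵖ) := by
  intro P Q _ _ _ _ f hf
  let coeff (P : Type u) [AddCommGroup P] [Module R P] : BTensor R (ι →₀ Rᵐᵒᵖ) P →+ (ι →₀ P) :=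
    lift (mk2 (fun v p => v.mapRange (fun r => unop r • p) (by simp))
      (fun v v' p => by ext; simp [add_smul])
      (fun v p p' => by ext; simp)) (fun r v p => by ext; simp [mul_smul])
  let back (P : Type u) [AddCommGroup P] [Module R P] : (ι →₀ P) →+ BTensor R (ι →₀ Rᵐᵒᵖ) P :=
    Finsupp.liftAddHom fun i =>
      AddMonoidHom.mk' (fun p => tmul R (Finsupp.single i 1) p) (fun p p' => tmul_add _ _ _)
  have h1 : ∀ t, back P (coeff P t) = t := by
    intro t
    induction t using BTensor.induction with
    | tmul' v p =>
      induction v using Finsupp.induction_linear with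
      | zero => rw [BTensor.zero_tmul, map_zero, map_zero]
      | add v w hv hw => rw [BTensor.add_tmul, map_add, map_add, hv, hw]
      | single i r =>
        change back P (Finsupp.mapRange (fun r => unop r • p) (by simp) (Finsupp.single i r)) = _
        rw [Finsupp.mapRange_single, Finsupp.liftAddHom_apply_single]
        change tmul R _ (unop r • p) = _
        rw [← BTensor.smul_tmul, op_unop, Finsupp.smul_single, smul_eq_mul, mul_one]
    | add' x y hx hy => rw [map_add, map_add, hx, hy]
  have h2 : ∀ t, coeff Q (map LinearMap.id f t) = (coeff P t).mapRange f (map_zero f) := by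
    intro t
    induction t using BTensor.induction with
    | tmul' v p =>
      ext i
      exact (f.map_smul (unop (v i)) p).symm
    | add' x y hx hy => rw [map_add, map_add, hx, hy, map_add]; ext; simp
  intro x y hxy
  rw [← h1 x, ← h1 y]
  congr 1
  apply Finsupp.mapRange_injective f (map_zero f) hf
  rw [← h2, ← h2, hxy]

end Flat

/-! ### Modules over von Neumann regular rings -/

section Regular

variable {R : Type u} [Ring R]

theorem IsVonNeumannRegular.op (hR : IsVonNeumannRegular R) : IsVonNeumannRegular Rᵐᵒᵖ := by
  intro a
  obtain ⟨x, hx⟩ := hR a.unop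
  exact ⟨MulOpposite.op x, unop_injective (by simpa [mul_assoc] using hx)⟩

/-- Every element `v` of a free module over a regular ring satisfies `φ v • v = v` for some linear
form `φ`. One coordinate of `v` is removed at a time by subtracting `(v i * x) • v`, where
`v i * x * v i = v i`. -/
theorem IsVonNeumannRegular.exists_form (hR : IsVonNeumannRegular R) {ι : Type u} (v : ι →₀ R) :
    ∃ φ : (ι →₀ R) →ₗ[R] R, φ v • v = v := by
  classical
  induction hn : v.support.card using Nat.strong_induction_on generalizing v with
  | _ n ih =>
    rcases v.support.eq_empty_or_nonempty with h | ⟨i, hi⟩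
    · exact ⟨0, by rw [Finsupp.support_eq_empty.1 h, smul_zero]⟩
    · obtain ⟨x, hx⟩ := hR (v i)
      let w := v - (v i * x) • v
      have hwi : w i = 0 := by simp [w, hx]
      have hsub : w.support ⊂ v.support := by
        refine (Finset.ssubset_iff_of_subset fun k hk => ?_).2 ⟨i, hi, by simp [hwi]⟩
        rw [Finsupp.mem_support_iff] at hk ⊢
        intro h0
        exact hk (by simp [w, h0])
      obtain ⟨φ, hφ⟩ := ih _ (hn ▸ Finset.card_lt_card hsub) w rfl
      let c := 1 - v i * x
      have hw : w = c • v := by simp [w, c, sub_smul]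
      let φ₁ : (ι →₀ R) →ₗ[R] R := (LinearMap.toSpanSingleton R R x).comp (Finsupp.lapply i)
      have hφ₁ : φ₁ v = v i * x := rfl
      refine ⟨φ₁ + (LinearMap.toSpanSingleton R R c).comp φ -
        (LinearMap.toSpanSingleton R R (φ v * c)).comp φ₁, ?_⟩
      have e : (φ₁ + (LinearMap.toSpanSingleton R R c).comp φ -
          (LinearMap.toSpanSingleton R R (φ v * c)).comp φ₁) v =
          v i * x + φ w * c := by
        simp only [LinearMap.sub_apply, LinearMap.add_apply, LinearMap.comp_apply, hφ₁,
          LinearMap.toSpanSingleton_apply, smul_eq_mul, hw, map_smul, c]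
        noncomm_ring
      rw [e, add_smul, mul_smul (φ w), ← hw, hφ, hw, ← add_smul]
      simp [c]

/-- A finite subset of a submodule of a free module over a regular ring is fixed by an endomorphism
with image in the submodule. -/
theorem IsVonNeumannRegular.exists_endomorphism (hR : IsVonNeumannRegular R) {ι : Type u}
    (N : Submodule R (ι →₀ R)) (s : Finset (ι →₀ R)) (hs : ∀ v ∈ s, v ∈ N) :
    ∃ e : (ι →₀ R) →ₗ[R] (ι →₀ R), (∀ v ∈ s, e v = v) ∧ ∀ v, e v ∈ N := by
  classical
  induction s using Finset.induction_on with
  | empty => exact ⟨0, by simp, fun v => N.zero_mem⟩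
  | insert v s hv ih =>
    obtain ⟨e, he, heN⟩ := ih fun w hw => hs w (Finset.mem_insert_of_mem hw)
    obtain ⟨φ, hφ⟩ := hR.exists_form (v - e v)
    refine ⟨e + (LinearMap.toSpanSingleton R _ (v - e v)).comp (φ.comp (LinearMap.id - e)),
      fun w hw => ?_, fun w => N.add_mem (heN w) (N.smul_mem _
        (N.sub_mem (hs v (Finset.mem_insert_self _ _)) (heN v)))⟩
    simp only [LinearMap.add_apply, LinearMap.comp_apply, LinearMap.sub_apply, LinearMap.id_apply,
      LinearMap.toSpanSingleton_apply]
    rcases Finset.mem_insert.1 hw with rfl | hw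
    · rw [hφ]; abel
    · rw [he w hw]; simp

/-- Over a von Neumann regular ring all left modules are flat. For a free cover `p : F → M` with
kernel `N`, a lift `z ∈ P ⊗ F` of an element that vanishes in `Q ⊗ M` becomes `∑ q ⊗ n` with `n ∈ N`
in `Q ⊗ F`; an endomorphism of `F` with image in `N` that fixes these `n` then fixes `z`. -/
theorem IsVonNeumannRegular.isFlatLeft (hR : IsVonNeumannRegular R) (M : Type u) [AddCommGroup M]
    [Module R M] : IsFlatLeft R M := by
  classical
  intro P Q _ _ _ _ f hf
  let p : (M →₀ R) →ₗ[R] M := Finsupp.linearCombination R _root_.id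
  have hp : Function.Surjective p := fun m => ⟨Finsupp.single m 1, by simp [p]⟩
  rw [injective_iff_map_eq_zero]
  intro z hz
  obtain ⟨z, rfl⟩ := map_surjective (f := (LinearMap.id : P →ₗ[Rᵐᵒᵖ] P)) Function.surjective_id hp z
  obtain ⟨w, hw⟩ := exists_map_right_of_map_eq_zero (f := (LinearMap.ker p).subtype) (g := p)
    (fun v (hv : p v = 0) => ⟨(⟨v, hv⟩ : LinearMap.ker p), rfl⟩) hp (t := map f LinearMap.id z) (by
      rw [map_map] at hz ⊢
      exact hz)
  have hfix : ∀ w : BTensor R Q (LinearMap.ker p), ∃ s : Finset (M →₀ R), (∀ v ∈ s, p v = 0) ∧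
      ∀ e : (M →₀ R) →ₗ[R] (M →₀ R), (∀ v ∈ s, e v = v) →
        map LinearMap.id e (map LinearMap.id (LinearMap.ker p).subtype w) =
          map LinearMap.id (LinearMap.ker p).subtype w := by
    intro w
    induction w using BTensor.induction with
    | tmul' q n =>
      refine ⟨{n.1}, fun v hv => ?_, fun e he => ?_⟩
      · rw [Finset.mem_singleton.1 hv]; exact n.2
      · exact congrArg (tmul R q) (he _ (Finset.mem_singleton_self _))
    | add' x y hx hy =>
      obtain ⟨s, hs, hs'⟩ := hx
      obtain ⟨t, ht, ht'⟩ := hy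
      refine ⟨s ∪ t, fun v hv => (Finset.mem_union.1 hv).elim (hs v) (ht v), fun e he => ?_⟩
      rw [map_add, map_add, hs' e fun v hv => he v (Finset.mem_union_left _ hv),
        ht' e fun v hv => he v (Finset.mem_union_right _ hv)]
  obtain ⟨s, hs, hs'⟩ := hfix w
  obtain ⟨e, he, heN⟩ := hR.exists_endomorphism (LinearMap.ker p) s hs
  have h := hs' e he
  rw [hw] at h
  have hz' : map LinearMap.id e z = z := by
    apply isFlatLeft_finsupp M P Q f hf
    rw [← h, map_map, map_map]
    rfl
  rw [← hz', map_map]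
  have : p ∘ₗ e = 0 := LinearMap.ext heN
  rw [this, map_zero_right]

/-- Over a von Neumann regular ring all right modules are flat, for the same reason. -/
theorem IsVonNeumannRegular.isFlatRight (hR : IsVonNeumannRegular R) (M : Type u) [AddCommGroup M]
    [Module Rᵐᵒᵖ M] : IsFlatRight R M := by
  classical
  intro P Q _ _ _ _ f hf
  let p : (M →₀ Rᵐᵒᵖ) →ₗ[Rᵐᵒᵖ] M := Finsupp.linearCombination Rᵐᵒᵖ _root_.id
  have hp : Function.Surjective p := fun m => ⟨Finsupp.single m 1, by simp [p]⟩
  rw [injective_iff_map_eq_zero]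
  intro z hz
  obtain ⟨z, rfl⟩ := map_surjective (g := (LinearMap.id : P →ₗ[R] P)) hp Function.surjective_id z
  obtain ⟨w, hw⟩ := exists_map_left_of_map_eq_zero (f := (LinearMap.ker p).subtype) (g := p)
    (fun v (hv : p v = 0) => ⟨(⟨v, hv⟩ : LinearMap.ker p), rfl⟩) hp (t := map LinearMap.id f z) (by
      rw [map_map] at hz ⊢
      exact hz)
  have hfix : ∀ w : BTensor R (LinearMap.ker p) Q, ∃ s : Finset (M →₀ Rᵐᵒᵖ), (∀ v ∈ s, p v = 0) ∧
      ∀ e : (M →₀ Rᵐᵒᵖ) →ₗ[Rᵐᵒᵖ] (M →₀ Rᵐᵒᵖ), (∀ v ∈ s, e v = v) →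
        map e LinearMap.id (map (LinearMap.ker p).subtype LinearMap.id w) =
          map (LinearMap.ker p).subtype LinearMap.id w := by
    intro w
    induction w using BTensor.induction with
    | tmul' n q =>
      refine ⟨{n.1}, fun v hv => ?_, fun e he => ?_⟩
      · rw [Finset.mem_singleton.1 hv]; exact n.2
      · exact congrArg (tmul R · q) (he _ (Finset.mem_singleton_self _))
    | add' x y hx hy =>
      obtain ⟨s, hs, hs'⟩ := hx
      obtain ⟨t, ht, ht'⟩ := hy
      refine ⟨s ∪ t, fun v hv => (Finset.mem_union.1 hv).elim (hs v) (ht v), fun e he => ?_⟩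
      rw [map_add, map_add, hs' e fun v hv => he v (Finset.mem_union_left _ hv),
        ht' e fun v hv => he v (Finset.mem_union_right _ hv)]
  obtain ⟨s, hs, hs'⟩ := hfix w
  obtain ⟨e, he, heN⟩ := hR.op.exists_endomorphism (LinearMap.ker p) s hs
  have h := hs' e he
  rw [hw] at h
  have hz' : map e LinearMap.id z = z := by
    apply isFlatRight_finsupp M P Q f hf
    rw [← h, map_map, map_map]
    rfl
  rw [← hz', map_map]
  have : p ∘ₗ e = 0 := LinearMap.ext heN
  rw [this, map_zero_left]

end Regular

end NCCoring

namespace NCCoring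

open BTensor

namespace BTensor

variable {R T U : Type u} [Ring R] [Ring T] [Ring U]
  {M M' N N' L L' : Type u} [AddCommGroup M] [AddCommGroup M'] [AddCommGroup N] [AddCommGroup N']
  [AddCommGroup L] [AddCommGroup L']
  [Module Rᵐᵒᵖ M] [Module Rᵐᵒᵖ M'] [Module R N] [Module R N']
  [Module Tᵐᵒᵖ N] [SMulCommClass R Tᵐᵒᵖ N] [Module Tᵐᵒᵖ N'] [SMulCommClass R Tᵐᵒᵖ N']
  [Module T L] [Module T L']

/-- Naturality of the associativity isomorphism, for linear maps that agree pointwise with tensor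
products of maps. -/
theorem assoc_naturality {F : BTensor R M N →ₗ[Tᵐᵒᵖ] BTensor R M' N'}
    {G : BTensor T N L →ₗ[R] BTensor T N' L'} {f : M →ₗ[Rᵐᵒᵖ] M'} {g : N →ₗ[R] N'}
    {g' : N →ₗ[Tᵐᵒᵖ] N'} {h : L →ₗ[T] L'} (hF : ∀ t, F t = map f g t) (hG : ∀ t, G t = map g' h t)
    (hg : ∀ n, g n = g' n) (w : BTensor T (BTensor R M N) L) :
    assoc M' N' L' (map F h w) = map f G (assoc M N L w) := by
  induction w using BTensor.induction with
  | tmul' t n =>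
    induction t using BTensor.induction with
    | tmul' m c => rw [map_tmul, hF, assoc_tmul, map_tmul, map_tmul, assoc_tmul, hG, map_tmul, hg]
    | add' x y hx hy => rw [add_tmul, map_add, map_add, hx, hy, map_add, map_add]
  | add' x y hx hy => rw [map_add, map_add, hx, hy, map_add, map_add]

theorem assoc_symm_naturality {F : BTensor R M N →ₗ[Tᵐᵒᵖ] BTensor R M' N'}
    {G : BTensor T N L →ₗ[R] BTensor T N' L'} {f : M →ₗ[Rᵐᵒᵖ] M'} {g : N →ₗ[R] N'}
    {g' : N →ₗ[Tᵐᵒᵖ] N'} {h : L →ₗ[T] L'} (hF : ∀ t, F t = map f g t) (hG : ∀ t, G t = map g' h t)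
    (hg : ∀ n, g n = g' n) (w : BTensor R M (BTensor T N L)) :
    (assoc M' N' L').symm (map f G w) = map F h ((assoc M N L).symm w) := by
  rw [AddEquiv.symm_apply_eq, assoc_naturality hF hG hg, AddEquiv.apply_symm_apply]

theorem assoc_map_id (h : L →ₗ[T] L') (w : BTensor T (BTensor R M N) L) :
    assoc M N L' (map LinearMap.id h w) = map LinearMap.id (lTensor N h) (assoc M N L w) :=
  assoc_naturality (fun t => (BTensor.map_id t).symm) (fun _ => rfl) (fun _ => rfl) w

end BTensor

/-! ### Coactions and their naturality -/

section Naturality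

variable {A C : Type u} [Ring A] [AddCommGroup C] [Module A C] [Module Aᵐᵒᵖ C]
  [SMulCommClass A Aᵐᵒᵖ C] {M M' : Type u} [AddCommGroup M] [AddCommGroup M']

section Right

variable [Module Aᵐᵒᵖ M] [Module Aᵐᵒᵖ M'] {ρ : M →ₗ[Aᵐᵒᵖ] BTensor A M C}
  {ρ' : M' →ₗ[Aᵐᵒᵖ] BTensor A M' C} {h : M →ₗ[Aᵐᵒᵖ] M'}

/-- A colinear map `h` commutes with both sides of the coassociativity law. Coassociativity can hence
be transported forward along a jointly surjective family of such maps, and backward along an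
injective one. -/
theorem coact_coact_right (hh : ∀ m, ρ' (h m) = map h LinearMap.id (ρ m)) (m : M) :
    assoc M' C C (map ρ' LinearMap.id (ρ' (h m))) =
      map h LinearMap.id (assoc M C C (map ρ LinearMap.id (ρ m))) := by
  rw [hh, map_map, ← assoc_naturality (F := rTensor C h) (fun _ => rfl)
    (fun t => (BTensor.map_id t).symm) (fun _ => rfl), map_map]
  exact congrArg _ (map_congr hh (fun _ => rfl) _)

theorem comul_coact_right (K : Coring A C) (hh : ∀ m, ρ' (h m) = map h LinearMap.id (ρ m))
    (m : M) : map LinearMap.id K.comul.left (ρ' (h m)) =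
      map h LinearMap.id (map LinearMap.id K.comul.left (ρ m)) := by
  rw [hh, map_map, map_map]; rfl

theorem counit_coact_right (K : Coring A C) (hh : ∀ m, ρ' (h m) = map h LinearMap.id (ρ m))
    (m : M) : rid A M' (map LinearMap.id K.counit.left (ρ' (h m))) =
      h (rid A M (map LinearMap.id K.counit.left (ρ m))) := by
  rw [hh, ← rid_map, map_map, map_map]; rfl

end Right

section Left

variable [Module A M] [Module A M'] {l : M →ₗ[A] BTensor A C M}
  {l' : M' →ₗ[A] BTensor A C M'} {h : M →ₗ[A] M'}

theorem coact_coact_left (hh : ∀ m, l' (h m) = map LinearMap.id h (l m)) (m : M) :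
    map LinearMap.id l' (l' (h m)) =
      map LinearMap.id (lTensor C h) (map LinearMap.id l (l m)) := by
  rw [hh, map_map, map_map]
  exact map_congr (fun _ => rfl) hh _

theorem comul_coact_left (K : Coring A C) (hh : ∀ m, l' (h m) = map LinearMap.id h (l m))
    (m : M) : assoc C C M' (map K.comul.right LinearMap.id (l' (h m))) =
      map LinearMap.id (lTensor C h) (assoc C C M (map K.comul.right LinearMap.id (l m))) := by
  rw [← assoc_map_id, hh, map_map, map_map]
  rfl

theorem counit_coact_left (K : Coring A C) (hh : ∀ m, l' (h m) = map LinearMap.id h (l m))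
    (m : M) : lid A M' (map K.counit.right LinearMap.id (l' (h m))) =
      h (lid A M (map K.counit.right LinearMap.id (l m))) := by
  rw [hh, ← lid_map, map_map, map_map]; rfl

end Left

end Naturality

variable {A B E : Type u} [Ring A] [Ring B] [Ring E]
  {C : Type u} [AddCommGroup C] [Module A C] [Module Aᵐᵒᵖ C] [SMulCommClass A Aᵐᵒᵖ C]
  {D : Type u} [AddCommGroup D] [Module B D] [Module Bᵐᵒᵖ D] [SMulCommClass B Bᵐᵒᵖ D]
  {G : Type u} [AddCommGroup G] [Module E G] [Module Eᵐᵒᵖ G] [SMulCommClass E Eᵐᵒᵖ G]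
  {K : Coring A C} {H : Coring B D} {J : Coring E G}
  {M : Type u} [AddCommGroup M] [Module A M] [Module Bᵐᵒᵖ M] [SMulCommClass A Bᵐᵒᵖ M]
  {N : Type u} [AddCommGroup N] [Module B N] [Module Eᵐᵒᵖ N] [SMulCommClass B Eᵐᵒᵖ N]

section Tensor

/-- The right coaction `W ⊗ ρ_N` on `W ⊗_B N`. -/
def tensorRight (W : Type u) [AddCommGroup W] [Module Bᵐᵒᵖ W] (t : Bicomodule H J N) :
    RightComodule J (BTensor B W N) :=
  let ρ : BTensor B W N →ₗ[Eᵐᵒᵖ] BTensor E (BTensor B W N) G :=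
    { toFun := fun u => (assoc W N G).symm (map LinearMap.id t.rcoact.left u)
      map_add' := fun x y => by rw [map_add, map_add]
      map_smul' := fun e u => (assoc W N G).injective (by
        rw [RingHom.id_apply, assoc_smul_right, AddEquiv.apply_symm_apply,
          AddEquiv.apply_symm_apply, map_smul_right]) }
  have hρ : ∀ w n, ρ (tmulLeft B E N w n) =
      map (tmulLeft B E N w) LinearMap.id (t.toRight.coact n) :=
    fun w n => assoc_symm_tmul_left w _
  { coact := ρ
    coassoc := fun u => by
      induction u using BTensor.induction with
      | tmul' w n =>
        exact (coact_coact_right (hρ w) n).trans ((congrArg _ (t.rcoassoc n)).trans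
          (comul_coact_right J (hρ w) n).symm)
      | add' x y hx hy => simp only [map_add, hx, hy]
    counit := fun u => by
      induction u using BTensor.induction with
      | tmul' w n =>
        exact (counit_coact_right J (hρ w) n).trans (congrArg _ (t.rcounit n))
      | add' x y hx hy => simp only [map_add, hx, hy] }

variable (s : Bicomodule K H M) (t : Bicomodule H J N)

/-- The left coaction `λ_M ⊗ N` on `M ⊗_B N`. -/
def tensorLcoact : BimodHom A E (BTensor B M N) (BTensor A C (BTensor B M N)) :=
  (assocBi A A B E C M N).comp (mapBi s.lcoact (BimodHom.id B E N))

/-- The right coaction `M ⊗ ρ_N` on `M ⊗_B N`. -/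
def tensorRcoact : BimodHom A E (BTensor B M N) (BTensor E (BTensor B M N) G) :=
  (assocSymmBi A B E E M N G).comp (mapBi (BimodHom.id A B M) t.rcoact)

theorem tensorLcoact_tmulRight (n : N) (m : M) :
    (tensorLcoact s : BimodHom A E _ _).left (tmulRight A B M n m) =
      map LinearMap.id (tmulRight A B M n) (s.toLeft.coact m) :=
  assoc_tmul_right n _

theorem tensor_lcoassoc (u : BTensor B M N) :
    assoc C C _ (map K.comul.right LinearMap.id ((tensorLcoact s : BimodHom A E _ _) u)) =
      map LinearMap.id (tensorLcoact s : BimodHom A E _ _).left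
        ((tensorLcoact s : BimodHom A E _ _) u) := by
  induction u using BTensor.induction with
  | tmul' m n =>
    exact (comul_coact_left K (tensorLcoact_tmulRight s n) m).trans
      ((congrArg _ (s.lcoassoc m)).trans (coact_coact_left (tensorLcoact_tmulRight s n) m).symm)
  | add' x y hx hy => simp only [BimodHom.map_add, map_add, hx, hy]

theorem tensor_lcounit (u : BTensor B M N) :
    lid A _ (map K.counit.right LinearMap.id ((tensorLcoact s : BimodHom A E _ _) u)) = u := by
  induction u using BTensor.induction with
  | tmul' m n =>
    exact (counit_coact_left K (tensorLcoact_tmulRight s n) m).trans (congrArg _ (s.lcounit m))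
  | add' x y hx hy => simp only [BimodHom.map_add, map_add, hx, hy]

theorem tensor_lcoact_rcoact (m : M) (q : BTensor E N G) :
    assoc C _ G (map (tensorLcoact s).right LinearMap.id ((assoc M N G).symm (tmul B m q))) =
      map LinearMap.id (assocSymmBi A B E E M N G).left
        (assoc C M (BTensor E N G) (tmul B (s.lcoact m) q)) := by
  induction q using BTensor.induction with
  | tmul' n g =>
    change assoc C _ G (tmul E (assoc C M N (tmul B (s.lcoact m) n)) g) = _
    generalize s.lcoact m = p
    induction p using BTensor.induction with
    | tmul' c m => rfl
    | add' x y hx hy => simp only [add_tmul, map_add, hx, hy]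
  | add' x y hx hy => simp only [tmul_add, map_add, hx, hy]

theorem tensor_comm (u : BTensor B M N) :
    assoc C _ G (map (tensorLcoact s).right LinearMap.id ((tensorRcoact (A := A) t) u)) =
      map LinearMap.id (tensorRcoact t).left ((tensorLcoact s : BimodHom A E _ _) u) := by
  induction u using BTensor.induction with
  | tmul' m n =>
    refine (tensor_lcoact_rcoact s m (t.rcoact n)).trans ?_
    change _ = map LinearMap.id (tensorRcoact t).left (assoc C M N (tmul B (s.lcoact m) n))
    generalize s.lcoact m = p
    induction p using BTensor.induction with
    | tmul' c m => rfl
    | add' x y hx hy => simp only [add_tmul, map_add, hx, hy]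
  | add' x y hx hy => simp only [BimodHom.map_add, map_add, hx, hy]

/-- The tensor product `M ⊗_B N` of a `(C, D)`-bicomodule and a `(D, G)`-bicomodule, as a
`(C, G)`-bicomodule with the coactions `λ_M ⊗ N` and `M ⊗ ρ_N`. -/
def tensorBicomodule : Bicomodule K J (BTensor B M N) where
  lcoact := tensorLcoact s
  rcoact := tensorRcoact t
  lcoassoc := tensor_lcoassoc s
  lcounit := tensor_lcounit s
  rcoassoc u := by
    have h : (tensorRcoact (A := A) (M := M) t).right = (tensorRight M t).coact := rfl
    rw [h]
    exact (tensorRight M t).coassoc u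
  rcounit := (tensorRight M t).counit
  comm := tensor_comm s t

theorem tensorBicomodule_lcoact (u : BTensor B M N) : (tensorBicomodule s t).lcoact u =
    assoc C M N (map s.lcoact.right LinearMap.id u) := rfl

end Tensor

/-! ### Sub-bicomodules -/

section Sub

variable {V Z : Type u} [AddCommGroup V] [Module A V] [Module Eᵐᵒᵖ V] [SMulCommClass A Eᵐᵒᵖ V]
  [AddCommGroup Z] [Module A Z] [Module Eᵐᵒᵖ Z] [SMulCommClass A Eᵐᵒᵖ Z]

/-- A sub-bimodule `Z` of a bicomodule `V` whose coactions factor through `C ⊗ Z` and `Z ⊗ G`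
is a bicomodule in a unique way, as soon as tensoring `j : Z → V` with the corings
preserves injectivity. -/
theorem existsUnique_subBicomodule (v : Bicomodule K J V) (j : BimodHom A E Z V)
    (hj : Function.Injective j)
    (hl : Function.Injective (map (LinearMap.id : C →ₗ[Aᵐᵒᵖ] C) j.left))
    (hll : Function.Injective (map (LinearMap.id : BTensor A C C →ₗ[Aᵐᵒᵖ] _) j.left))
    (hG : IsFlatLeft E G)
    (el : ∀ z, ∃ w, map (LinearMap.id : C →ₗ[Aᵐᵒᵖ] C) j.left w = v.lcoact (j z))
    (er : ∀ z, ∃ w, map j.right (LinearMap.id : G →ₗ[E] G) w = v.rcoact (j z)) :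
    ∃! c : Bicomodule K J Z, (∀ z, map LinearMap.id j.left (c.lcoact z) = v.lcoact (j z)) ∧
      ∀ z, map j.right LinearMap.id (c.rcoact z) = v.rcoact (j z) := by
  have hr := hG _ _ j.right hj
  have hrr := (hG.tensor hG) _ _ j.right hj
  have hll' : Function.Injective (map (LinearMap.id : C →ₗ[Aᵐᵒᵖ] C) (lTensor C j.left)) := by
    intro x y hxy
    obtain ⟨x, rfl⟩ := (assoc C C Z).surjective x
    obtain ⟨y, rfl⟩ := (assoc C C Z).surjective y
    congr 1
    apply hll
    apply (assoc C C V).injective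
    rw [assoc_map_id, assoc_map_id]
    exact hxy
  have hlr : Function.Injective (map (LinearMap.id : C →ₗ[Aᵐᵒᵖ] C)
      (mapLeft j (LinearMap.id : G →ₗ[E] G))) := by
    have h := hG _ _ (mapRight (LinearMap.id : C →ₗ[Aᵐᵒᵖ] C) j) hl
    intro x y hxy
    obtain ⟨x, rfl⟩ := (assoc C Z G).surjective x
    obtain ⟨y, rfl⟩ := (assoc C Z G).surjective y
    congr 1
    apply h
    apply (assoc C V G).injective
    rw [assoc_map_map, assoc_map_map]
    exact hxy
  let l : BimodHom A E Z (BTensor A C Z) :=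
    BimodHom.factor (mapBi (BimodHom.id A A C) j) hl (v.lcoact.comp j) el
  let r : BimodHom A E Z (BTensor E Z G) :=
    BimodHom.factor (mapBi j (BimodHom.id E E G)) hr (v.rcoact.comp j) er
  have hl' : ∀ z, v.lcoact.left (j.left z) = map LinearMap.id j.left (l.left z) := fun z =>
    (BimodHom.factor_spec (mapBi (BimodHom.id A A C) j) hl (v.lcoact.comp j) el z).symm
  have hr' : ∀ z, v.rcoact.right (j.right z) = map j.right LinearMap.id (r.right z) := fun z =>
    (BimodHom.factor_spec (mapBi j (BimodHom.id E E G)) hr (v.rcoact.comp j) er z).symm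
  refine ⟨⟨l, r, fun z => ?_, fun z => ?_, fun z => ?_, fun z => ?_, fun z => ?_⟩,
    ⟨fun z => (hl' z).symm, fun z => (hr' z).symm⟩, ?_⟩
  · apply hll'
    exact (comul_coact_left K hl' z).symm.trans ((v.lcoassoc (j z)).trans (coact_coact_left hl' z))
  · exact hj ((counit_coact_left K hl' z).symm.trans (v.lcounit (j z)))
  · apply hrr
    exact (coact_coact_right hr' z).symm.trans ((v.rcoassoc (j z)).trans
      (comul_coact_right J hr' z))
  · exact hj ((counit_coact_right J hr' z).symm.trans (v.rcounit (j z)))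
  · apply hlr
    have h := v.comm (j z)
    have e1 : v.lcoact (j z) = map LinearMap.id j.left (l z) := hl' z
    have e2 : v.rcoact (j z) = map j.right LinearMap.id (r z) := hr' z
    rw [e1, e2, map_map, map_map] at h
    rw [← assoc_map_map, map_map, map_map]
    refine Eq.trans (congrArg _ (map_congr (fun m => (hl' m).symm) (fun _ => rfl) _)) (h.trans ?_)
    exact map_congr (fun _ => rfl) hr' _
  · rintro c ⟨h1, h2⟩
    ext z
    · exact hl ((h1 z).trans (hl' z))
    · exact hr ((h2 z).trans (hr' z))

end Sub

/-! ### The bicomodule structure on a cotensor product -/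

section Cotensor

/-- The map `ρ_M ⊗ N : M ⊗ N → M ⊗ (D ⊗ N)`. It does not depend on the coactions of `N`; the
second argument fixes the module `N`. -/
def coactMid (s : Bicomodule K H M) (_t : Bicomodule H J N) : BimodHom A E (BTensor B M N) (BTensor B M (BTensor B D N)) :=
  (assocBi A B B E M D N).comp (mapBi s.rcoact (BimodHom.id B E N))

/-- The map `M ⊗ λ_N : M ⊗ N → M ⊗ (D ⊗ N)`. It does not depend on the coactions of `M`; the
first argument fixes the module `M`. -/
def midCoact (_s : Bicomodule K H M) (t : Bicomodule H J N) : BimodHom A E (BTensor B M N) (BTensor B M (BTensor B D N)) :=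
  mapBi (BimodHom.id A B M) t.lcoact

variable (s : Bicomodule K H M) (t : Bicomodule H J N)

theorem coactMid_apply (u : BTensor B M N) : coactMid s t u =
    assoc M D N (map s.rcoact.right LinearMap.id u) := rfl

theorem midCoact_apply (u : BTensor B M N) : midCoact s t u =
    map LinearMap.id t.lcoact.left u := rfl

theorem mem_cotensor_iff (u : BTensor B M N) : u ∈ cotensor s.toRight t.toLeft ↔
    coactMid s t u = midCoact s t u := Iff.rfl

theorem Cotensor.incl_injective : Function.Injective (Cotensor.incl s t) := Subtype.val_injective

theorem Cotensor.incl_spec (z : Cotensor s t) :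
    coactMid s t (Cotensor.incl s t z) = midCoact s t (Cotensor.incl s t z) := z.2

/-- `ρ_M ⊗ N` is left colinear. -/
theorem coactMid_lcoact (u : BTensor B M N) :
    map LinearMap.id (coactMid s t).left ((tensorBicomodule s t).lcoact u) =
      (tensorBicomodule s (tensorBicomodule H.regular t)).lcoact
        (coactMid s t u) := by
  induction u using BTensor.induction with
  | tmul' m n =>
    have h1 : ∀ y : BTensor B M D, (tensorBicomodule s (tensorBicomodule H.regular t)).lcoact
        (assoc M D N (tmul B y n)) = map LinearMap.id ((assocBi A B B E M D N).left ∘ₗ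
          tmulRight A B (BTensor B M D) n) (assoc C M D (map s.lcoact.right LinearMap.id y)) := by
      intro y
      induction y using BTensor.induction with
      | tmul' m d =>
        change assoc C M _ (tmul B (s.lcoact m) (tmul B d n)) =
          map LinearMap.id _ (assoc C M D (tmul B (s.lcoact m) d))
        generalize s.lcoact m = p
        induction p using BTensor.induction with
        | tmul' c m => rfl
        | add' x y hx hy => simp only [add_tmul, map_add, hx, hy]
      | add' x y hx hy => simp only [add_tmul, map_add, BimodHom.map_add, hx, hy]
    refine Eq.trans ?_ (h1 (s.rcoact m)).symm
    rw [s.comm]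
    change map LinearMap.id _ (assoc C M N (tmul B (s.lcoact m) n)) = _
    rw [assoc_tmul_right, map_map, map_map]
    rfl
  | add' x y hx hy => simp only [map_add, BimodHom.map_add, hx, hy]

/-- `M ⊗ λ_N` is left colinear. -/
theorem midCoact_lcoact (u : BTensor B M N) :
    map LinearMap.id (midCoact s t).left ((tensorBicomodule s t).lcoact u) =
      (tensorBicomodule s (tensorBicomodule H.regular t)).lcoact
        (midCoact s t u) := by
  have h := assoc_map_id t.lcoact.left (map s.lcoact.right LinearMap.id u)
  rw [map_map] at h
  rw [tensorBicomodule_lcoact, tensorBicomodule_lcoact, midCoact_apply, map_map]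
  exact h.symm

/-- `ρ_M ⊗ N` is right colinear. -/
theorem coactMid_rcoact (u : BTensor B M N) :
    map (coactMid s t).right LinearMap.id ((tensorBicomodule s t).rcoact u) =
      (tensorBicomodule s (tensorBicomodule H.regular t)).rcoact
        (coactMid s t u) := by
  induction u using BTensor.induction with
  | tmul' m n =>
    change map (coactMid s t).right LinearMap.id ((assoc M N G).symm (tmul B m (t.rcoact n))) =
      (assoc M _ G).symm (map LinearMap.id (tensorBicomodule H.regular t).rcoact.left
        (assoc M D N (tmul B (s.rcoact m) n)))
    have h1 : ∀ p : BTensor B M D, (assoc M _ G).symm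
        (map LinearMap.id (tensorBicomodule H.regular t).rcoact.left (assoc M D N (tmul B p n))) =
        map (assocBi A B B E M D N).right LinearMap.id
          ((assoc (BTensor B M D) N G).symm (tmul B p (t.rcoact n))) := by
      intro p
      induction p using BTensor.induction with
      | tmul' m d =>
        change (assoc M _ G).symm (tmul B m ((assoc D N G).symm (tmul B d (t.rcoact n)))) = _
        generalize t.rcoact n = q
        induction q using BTensor.induction with
        | tmul' n g => rfl
        | add' x y hx hy => simp only [tmul_add, map_add, hx, hy]
      | add' x y hx hy => simp only [add_tmul, map_add, hx, hy]
    rw [h1]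
    generalize t.rcoact n = q
    induction q using BTensor.induction with
    | tmul' n g => rfl
    | add' x y hx hy => simp only [tmul_add, map_add, hx, hy]
  | add' x y hx hy => simp only [map_add, BimodHom.map_add, hx, hy]

/-- `M ⊗ λ_N` is right colinear. -/
theorem midCoact_rcoact (u : BTensor B M N) :
    map (midCoact s t).right LinearMap.id ((tensorBicomodule s t).rcoact u) =
      (tensorBicomodule s (tensorBicomodule H.regular t)).rcoact
        (midCoact s t u) := by
  induction u using BTensor.induction with
  | tmul' m n =>
    change map (midCoact s t).right LinearMap.id ((assoc M N G).symm (tmul B m (t.rcoact n))) =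
      (assoc M _ G).symm (tmul B m ((assoc D N G).symm
        (map LinearMap.id t.rcoact.left (t.lcoact n))))
    rw [← t.comm, AddEquiv.symm_apply_apply]
    generalize t.rcoact n = q
    induction q using BTensor.induction with
    | tmul' n g => rfl
    | add' x y hx hy => simp only [tmul_add, map_add, hx, hy]
  | add' x y hx hy => simp only [map_add, BimodHom.map_add, hx, hy]

/-- `W ⊗ -` preserves the equalizer defining `M □_D N`. -/
abbrev CotensorPureLeft (W : Type u) [AddCommGroup W] [Module Aᵐᵒᵖ W] : Prop :=
  PreservesEqualizerLeft W (Cotensor.incl s t).left (coactMid s t).left (midCoact s t).left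

/-- `- ⊗ W` preserves the equalizer defining `M □_D N`. -/
abbrev CotensorPureRight (W : Type u) [AddCommGroup W] [Module E W] : Prop :=
  PreservesEqualizerRight W (Cotensor.incl s t).right (coactMid s t).right (midCoact s t).right

theorem IsFlatRight.cotensorPureLeft {W : Type u} [AddCommGroup W] [Module Aᵐᵒᵖ W]
    (hW : IsFlatRight A W) : CotensorPureLeft s t W :=
  hW.preservesEqualizerLeft (Cotensor.incl_injective s t) fun p hp => ⟨⟨p, hp⟩, rfl⟩

theorem IsFlatLeft.cotensorPureRight {W : Type u} [AddCommGroup W] [Module E W]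
    (hW : IsFlatLeft E W) : CotensorPureRight s t W :=
  hW.preservesEqualizerRight (Cotensor.incl_injective s t) fun p hp => ⟨⟨p, hp⟩, rfl⟩

theorem isCanonicalBicomodule_iff (c : Bicomodule K J (Cotensor s t)) :
    IsCanonicalBicomodule s t c ↔
      (∀ z, map LinearMap.id (Cotensor.incl s t).left (c.lcoact z) =
        (tensorBicomodule s t).lcoact (Cotensor.incl s t z)) ∧
      ∀ z, map (Cotensor.incl s t).right LinearMap.id (c.rcoact z) =
        (tensorBicomodule s t).rcoact (Cotensor.incl s t z) := by
  refine and_congr Iff.rfl (forall_congr' fun z => ?_)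
  exact (AddEquiv.eq_symm_apply _).symm

/-- The coactions of `M ⊗ N` restrict to `M □_D N` because they commute with the two maps whose
equalizer is `M □_D N`. -/
theorem existsUnique_isCanonicalBicomodule (hl : CotensorPureLeft s t C)
    (hll : CotensorPureLeft s t (BTensor A C C)) (hG : IsFlatLeft E G) :
    ∃! c : Bicomodule K J (Cotensor s t), IsCanonicalBicomodule s t c := by
  simp only [isCanonicalBicomodule_iff]
  refine existsUnique_subBicomodule _ _ (Cotensor.incl_injective s t) hl.injective hll.injective hG
    (fun z => hl.exists_eq _ ?_) (fun z => (hG.cotensorPureRight s t).exists_eq _ ?_)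
  · rw [coactMid_lcoact, midCoact_lcoact, Cotensor.incl_spec]
  · rw [coactMid_rcoact, midCoact_rcoact, Cotensor.incl_spec]

end Cotensor

end NCCoring

/-! ### Split cotensor products and coseparable corings -/

namespace NCCoring

open BTensor

variable {A B E : Type u} [Ring A] [Ring B] [Ring E]
  {C : Type u} [AddCommGroup C] [Module A C] [Module Aᵐᵒᵖ C] [SMulCommClass A Aᵐᵒᵖ C]
  {D : Type u} [AddCommGroup D] [Module B D] [Module Bᵐᵒᵖ D] [SMulCommClass B Bᵐᵒᵖ D]
  {G : Type u} [AddCommGroup G] [Module E G] [Module Eᵐᵒᵖ G] [SMulCommClass E Eᵐᵒᵖ G]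
  {K : Coring A C} {H : Coring B D} {J : Coring E G}
  {M : Type u} [AddCommGroup M] [Module A M] [Module Bᵐᵒᵖ M] [SMulCommClass A Bᵐᵒᵖ M]
  {N : Type u} [AddCommGroup N] [Module B N] [Module Eᵐᵒᵖ N] [SMulCommClass B Eᵐᵒᵖ N]

/-- The pair of maps whose equalizer is `M □_D N` is contractible by bimodule maps: `σ` splits
`M ⊗ λ_N`, and `r` is the resulting projection of `M ⊗ N` onto `M □_D N`. -/
structure CotensorSplitting (s : Bicomodule K H M) (t : Bicomodule H J N) where
  σ : BimodHom A E (BTensor B M (BTensor B D N)) (BTensor B M N)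
  r : BimodHom A E (BTensor B M N) (Cotensor s t)
  σ_midCoact : ∀ u, σ (midCoact s t u) = u
  σ_coactMid : ∀ u, σ (coactMid s t u) = Cotensor.incl s t (r u)

namespace CotensorSplitting

variable {s : Bicomodule K H M} {t : Bicomodule H J N} (h : CotensorSplitting s t)

include h

theorem r_incl (z : Cotensor s t) : h.r (Cotensor.incl s t z) = z :=
  Cotensor.incl_injective s t (by rw [← h.σ_coactMid, Cotensor.incl_spec, h.σ_midCoact])

theorem cotensorPureLeft (W : Type u) [AddCommGroup W] [Module Aᵐᵒᵖ W] :
    CotensorPureLeft s t W where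
  injective := by
    refine Function.LeftInverse.injective (g := map LinearMap.id h.r.left) fun x => ?_
    rw [map_map]
    exact (map_congr (fun _ => rfl) h.r_incl x).trans (BTensor.map_id x)
  exists_eq u hu := by
    refine ⟨map LinearMap.id h.r.left u, ?_⟩
    have := congrArg (map LinearMap.id h.σ.left) hu
    rw [map_map, map_map] at this
    rw [map_map]
    refine (map_congr (fun _ => rfl) (fun v => (h.σ_coactMid v).symm) u).trans (this.trans ?_)
    exact (map_congr (fun _ => rfl) h.σ_midCoact u).trans (BTensor.map_id u)

theorem cotensorPureRight (W : Type u) [AddCommGroup W] [Module E W] :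
    CotensorPureRight s t W where
  injective := by
    refine Function.LeftInverse.injective (g := map h.r.right LinearMap.id) fun x => ?_
    rw [map_map]
    exact (map_congr h.r_incl (fun _ => rfl) x).trans (BTensor.map_id x)
  exists_eq u hu := by
    refine ⟨map h.r.right LinearMap.id u, ?_⟩
    have := congrArg (map h.σ.right LinearMap.id) hu
    rw [map_map, map_map] at this
    rw [map_map]
    refine (map_congr (fun v => (h.σ_coactMid v).symm) (fun _ => rfl) u).trans (this.trans ?_)
    exact (map_congr h.σ_midCoact (fun _ => rfl) u).trans (BTensor.map_id u)

end CotensorSplitting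

section Coseparable

/-- The canonical map `R ⊗_R N → N` is bilinear. -/
def lidBi (B E N : Type u) [Ring B] [Ring E] [AddCommGroup N] [Module B N] [Module Eᵐᵒᵖ N]
    [SMulCommClass B Eᵐᵒᵖ N] : BimodHom B E (BTensor B B N) N where
  toAddMonoidHom := lid B N
  map_smul_left b u := by
    change lid B N (b • u) = b • lid B N u
    induction u using BTensor.induction with
    | tmul' c n => exact mul_smul b c n
    | add' x y hx hy => rw [smul_add, map_add, map_add, smul_add, hx, hy]
  map_smul_right e u := by
    change lid B N (op e • u) = op e • lid B N u
    induction u using BTensor.induction with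
    | tmul' c n => exact smul_comm c (op e) n
    | add' x y hx hy => rw [smul_add, map_add, map_add, smul_add, hx, hy]

variable (γ : BimodHom B B (BTensor B D D) B)

/-- The contraction `d ⊗ d' ⊗ v ↦ γ (d ⊗ d') v`. -/
def contract (V : Type u) [AddCommGroup V] [Module B V] :
    BTensor B D (BTensor B D V) →+ V :=
  (lid B V).comp ((map γ.right LinearMap.id).comp (assoc D D V).symm.toAddMonoidHom)

theorem contract_apply (V : Type u) [AddCommGroup V] [Module B V]
    (u : BTensor B D (BTensor B D V)) : contract γ V u =
      lid B V (map γ.right LinearMap.id ((assoc D D V).symm u)) := rfl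

theorem contract_map {V V' : Type u} [AddCommGroup V] [Module B V] [AddCommGroup V'] [Module B V']
    (f : V →ₗ[B] V') (u : BTensor B D (BTensor B D V)) :
    contract γ V' (map LinearMap.id (lTensor D f) u) = f (contract γ V u) := by
  rw [contract_apply, contract_apply, assoc_symm_naturality (F := LinearMap.id)
    (fun t => (BTensor.map_id t).symm) (fun _ => rfl) (fun _ => rfl), ← lid_map, map_map, map_map]
  rfl

theorem contract_tensor (d : D) (p : BTensor B D D) (n : N) :
    contract γ (BTensor B D N) (tmul B d (assoc D D N (tmul B p n))) =
      tmul B (contract γ D (tmul B d p)) n := by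
  induction p using BTensor.induction with
  | tmul' d1 d2 => rfl
  | add' x y hx hy => simp only [tmul_add, add_tmul, map_add, hx, hy]

variable (H) (π : BimodHom B B (BTensor B D D) D) (t : Bicomodule H J N)

/-- The map `D ⊗ N → N`, `d ⊗ n ↦ ε (π (d ⊗ n₋₁)) n₀`, attached to `π : D ⊗ D → D`. -/
def coactRetraction : BimodHom B E (BTensor B D N) N :=
  (lidBi B E N).comp ((mapBi (H.counit.comp π) (BimodHom.id B E N)).comp
    ((assocSymmBi B B B E D D N).comp (mapBi (BimodHom.id B B D) t.lcoact)))

theorem coactRetraction_apply (u : BTensor B D N) : coactRetraction H π t u =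
    contract (H.counit.comp π) N (map LinearMap.id t.lcoact.left u) := rfl

variable {H π}

theorem coactRetraction_lcoact (hπ : ∀ c, π (H.comul c) = c) (n : N) :
    coactRetraction H π t (t.lcoact n) = n := by
  rw [coactRetraction_apply, contract_apply, ← t.lcoassoc, AddEquiv.symm_apply_apply, map_map]
  refine Eq.trans (congrArg _ (map_congr (fun d => ?_) (fun _ => rfl) _)) (t.lcounit n)
  exact congrArg H.counit (hπ d)

theorem lcoact_coactRetraction
    (hπ : ∀ t, H.comul (π t) = map π.right LinearMap.id
      ((assoc D D D).symm (map LinearMap.id H.comul.left t))) (d : D) (n : N) :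
    t.lcoact (coactRetraction H π t (tmul B d n)) =
      map π.right LinearMap.id ((assoc D D N).symm (tmul B d (t.lcoact n))) := by
  have hc : ∀ d d', contract (H.counit.comp π) D (tmul B d (H.comul d')) = π (tmul B d d') := by
    intro d d'
    rw [← H.counit_comul (π (tmul B d d')), hπ, map_map]
    rfl
  have h1 : ∀ q : BTensor B D N, contract (H.counit.comp π) (BTensor B D N)
      (tmul B d (assoc D D N (map H.comul.right LinearMap.id q))) =
        map π.right LinearMap.id ((assoc D D N).symm (tmul B d q)) := by
    intro q
    induction q using BTensor.induction with
    | tmul' d' n => exact (contract_tensor _ d _ n).trans (congrArg (tmul B · n) (hc d d'))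
    | add' x y hx hy => simp only [tmul_add, map_add, hx, hy]
  rw [← h1, t.lcoassoc, coactRetraction_apply]
  exact (contract_map (H.counit.comp π) t.lcoact.left _).symm

theorem map_coactRetraction
    (hπ : ∀ t, H.comul (π t) = map LinearMap.id π.left
      (assoc D D D (map H.comul.right LinearMap.id t))) (d : D) (n : N) :
    map LinearMap.id (coactRetraction H π t).left (assoc D D N (tmul B (H.comul d) n)) =
      map π.right LinearMap.id ((assoc D D N).symm (tmul B d (t.lcoact n))) := by
  have hc : ∀ d d', rid B D (map LinearMap.id (H.counit.comp π).left
      (assoc D D D (tmul B (H.comul d) d'))) = π (tmul B d d') := by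
    intro d d'
    rw [← H.comul_counit (π (tmul B d d')), hπ, map_map]
    rfl
  let κ : BimodHom B E (BTensor B D (BTensor B D N)) N :=
    (lidBi B E N).comp ((mapBi (H.counit.comp π) (BimodHom.id B E N)).comp
      (assocSymmBi B B B E D D N))
  have h1 : ∀ p : BTensor B D D, map LinearMap.id (coactRetraction H π t).left
      (assoc D D N (tmul B p n)) =
        map LinearMap.id κ.left (assoc D D (BTensor B D N) (tmul B p (t.lcoact n))) := by
    intro p
    induction p using BTensor.induction with
    | tmul' d1 d2 => rfl
    | add' x y hx hy => simp only [add_tmul, map_add, hx, hy]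
  have h2 : ∀ (d' : D) (n : N) (p : BTensor B D D),
      map LinearMap.id κ.left (assoc D D (BTensor B D N) (tmul B p (tmul B d' n))) =
        tmul B (rid B D (map LinearMap.id (H.counit.comp π).left (assoc D D D (tmul B p d')))) n := by
    intro d' n p
    induction p using BTensor.induction with
    | tmul' d1 d2 => exact (BTensor.smul_tmul (H.counit (π (tmul B d2 d'))) d1 n).symm
    | add' x y hx hy => simp only [add_tmul, map_add, hx, hy]
  rw [h1]
  generalize t.lcoact n = q
  induction q using BTensor.induction with
  | tmul' d' n => rw [h2, hc]; rfl
  | add' x y hx hy => simp only [tmul_add, map_add, hx, hy]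

/-- If `D` is coseparable, every left `D`-comodule `N` is a direct summand of `D ⊗ N`, and this
splits the equalizer defining `M □_D N`. -/
theorem IsCoseparable.exists_splitting (hH : IsCoseparable H) (s : Bicomodule K H M)
    (t : Bicomodule H J N) : Nonempty (CotensorSplitting s t) := by
  obtain ⟨π, hπl, hπr, hπ⟩ := hH
  let τ := coactRetraction H π t
  have hτ : ∀ u, t.lcoact (τ u) =
      map LinearMap.id τ.left (assoc D D N (map H.comul.right LinearMap.id u)) := by
    intro u
    induction u using BTensor.induction with
    | tmul' d n =>
      exact (lcoact_coactRetraction t hπr d n).trans (map_coactRetraction t hπl d n).symm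
    | add' x y hx hy => simp only [BimodHom.map_add, map_add, hx, hy]
  let σ : BimodHom A E (BTensor B M (BTensor B D N)) (BTensor B M N) :=
    mapBi (BimodHom.id A B M) τ
  have key : ∀ u, coactMid s t (σ (coactMid s t u)) = midCoact s t (σ (coactMid s t u)) := by
    intro u
    induction u using BTensor.induction with
    | tmul' m n =>
      -- Both sides are `m₀ ⊗ m₁ ⊗ τ (m₂ ⊗ n)`.
      let Θ : BTensor B M (BTensor B D D) →+ BTensor B M (BTensor B D N) :=
        map LinearMap.id (lTensor D τ.left ∘ₗ (assocBi B B B E D D N).left ∘ₗ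
          tmulRight B B (BTensor B D D) n)
      have h1 : ∀ y : BTensor B M D, coactMid s t (σ (assoc M D N (tmul B y n))) =
          Θ (assoc M D D (map s.rcoact.right LinearMap.id y)) := by
        intro y
        induction y using BTensor.induction with
        | tmul' m d =>
          change assoc M D N (tmul B (s.rcoact m) (τ (tmul B d n))) =
            Θ (assoc M D D (tmul B (s.rcoact m) d))
          generalize s.rcoact m = p
          induction p using BTensor.induction with
          | tmul' m d => rfl
          | add' x y hx hy => simp only [add_tmul, map_add, hx, hy]
        | add' x y hx hy => simp only [add_tmul, BimodHom.map_add, map_add, hx, hy]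
      have h2 : ∀ y : BTensor B M D, midCoact s t (σ (assoc M D N (tmul B y n))) =
          Θ (map LinearMap.id H.comul.left y) := by
        intro y
        induction y using BTensor.induction with
        | tmul' m d => exact congrArg (tmul B m) (hτ (tmul B d n))
        | add' x y hx hy => simp only [add_tmul, BimodHom.map_add, map_add, hx, hy]
      exact (h1 (s.rcoact m)).trans ((congrArg Θ (s.rcoassoc m)).trans (h2 (s.rcoact m)).symm)
    | add' x y hx hy => simp only [BimodHom.map_add, hx, hy]
  refine ⟨⟨σ, BimodHom.factor (Cotensor.incl s t) (Cotensor.incl_injective s t)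
    (σ.comp (coactMid s t)) fun u => ⟨⟨_, key u⟩, rfl⟩, fun u => ?_, fun u => ?_⟩⟩
  · change map _ τ.left (map _ t.lcoact.left u) = u
    rw [map_map]
    exact (map_congr (fun _ => rfl) (coactRetraction_lcoact t hπ) u).trans (BTensor.map_id u)
  · exact (BimodHom.factor_spec (Cotensor.incl s t) _ (σ.comp (coactMid s t)) _ u).symm

end Coseparable

end NCCoring

/-! ### Coflat comodules -/

namespace NCCoring

open BTensor

section Coflat

theorem LinearMap.exists_factor {R M N P : Type u} [Ring R] [AddCommGroup M] [AddCommGroup N]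
    [AddCommGroup P] [Module R M] [Module R N] [Module R P] {j : N →ₗ[R] P}
    (hj : Function.Injective j) {F : M →ₗ[R] P} (h : ∀ m, ∃ n, j n = F m) :
    ∃ F' : M →ₗ[R] N, ∀ m, j (F' m) = F m := by
  choose F' hF' using h
  exact ⟨⟨⟨F', fun x y => hj (by rw [hF', map_add, map_add, hF', hF'])⟩,
    fun r x => hj (by rw [hF', map_smul, RingHom.id_apply, map_smul, ← hF'])⟩, hF'⟩

variable {A B E : Type u} [Ring A] [Ring B] [Ring E]
  {C : Type u} [AddCommGroup C] [Module A C] [Module Aᵐᵒᵖ C] [SMulCommClass A Aᵐᵒᵖ C]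
  {D : Type u} [AddCommGroup D] [Module B D] [Module Bᵐᵒᵖ D] [SMulCommClass B Bᵐᵒᵖ D]
  {G : Type u} [AddCommGroup G] [Module E G] [Module Eᵐᵒᵖ G] [SMulCommClass E Eᵐᵒᵖ G]
  {K : Coring A C} {H : Coring B D} {J : Coring E G}
  {M : Type u} [AddCommGroup M] [Module A M] [Module Bᵐᵒᵖ M] [SMulCommClass A Bᵐᵒᵖ M]
  {N : Type u} [AddCommGroup N] [Module B N] [Module Eᵐᵒᵖ N] [SMulCommClass B Eᵐᵒᵖ N]

/-- A submodule of a right comodule whose image under the coaction comes from `Q ⊗ D` is a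
subcomodule if `D` is flat. -/
theorem RightComodule.exists_sub (hD : IsFlatLeft B D) {V Q : Type u} [AddCommGroup V]
    [Module Bᵐᵒᵖ V] [AddCommGroup Q] [Module Bᵐᵒᵖ Q] (ρ : RightComodule H V) {j : Q →ₗ[Bᵐᵒᵖ] V}
    (hj : Function.Injective j)
    (h : ∀ q, ∃ w, map j (LinearMap.id : D →ₗ[B] D) w = ρ.coact (j q)) :
    ∃ ρ' : RightComodule H Q, IsRightColinear ρ' ρ j := by
  obtain ⟨l, hl⟩ := LinearMap.exists_factor (j := rTensor D j) (F := ρ.coact ∘ₗ j) (hD _ _ j hj) h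
  have hl' : ∀ q, ρ.coact (j q) = map j LinearMap.id (l q) := fun q => (hl q).symm
  refine ⟨⟨l, fun q => ?_, fun q => ?_⟩, hl'⟩
  · apply (hD.tensor hD) _ _ j hj
    exact (coact_coact_right hl' q).symm.trans ((ρ.coassoc (j q)).trans
      (comul_coact_right H hl' q))
  · exact hj ((counit_coact_right H hl' q).symm.trans (ρ.counit (j q)))

theorem tensorRight_colinear {W W' : Type u} [AddCommGroup W] [Module Bᵐᵒᵖ W] [AddCommGroup W']
    [Module Bᵐᵒᵖ W'] (t : Bicomodule H J N) (f : W →ₗ[Bᵐᵒᵖ] W') :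
    IsRightColinear (tensorRight W t) (tensorRight W' t) (rTensor N f) := fun u => by
  change (assoc W' N G).symm (map LinearMap.id t.rcoact.left (map f LinearMap.id u)) =
    map (rTensor N f) LinearMap.id ((assoc W N G).symm (map LinearMap.id t.rcoact.left u))
  rw [← assoc_symm_naturality (f := f) (G := LinearMap.id) (fun _ => rfl)
    (fun t => (BTensor.map_id t).symm) (fun _ => rfl), map_map, map_map]
  rfl

theorem tmulLeft_colinear {W : Type u} [AddCommGroup W] [Module Bᵐᵒᵖ W] (t : Bicomodule H J N)
    (w : W) : IsRightColinear t.toRight (tensorRight W t) (tmulLeft B E N w) :=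
  fun _ => assoc_symm_tmul_left w _

/-- A coflat comodule `N` over a flat coring is flat: `P ⊗ N` is a natural direct summand of
`(P ⊗ D) ⊗ N` that lies in `(P ⊗ D) □ N`. -/
theorem IsCoflatLeft.isFlatLeft (hD : IsFlatLeft B D) {t : Bicomodule H J N}
    (ht : IsCoflatLeft t.toLeft) : IsFlatLeft B N := by
  intro P P' _ _ _ _ f hf
  let q := (LinearMap.range f).mkQ
  have hfq : ∀ p, q p = 0 → ∃ p', f p' = p := fun p hp => (Submodule.Quotient.mk_eq_zero _).1 hp
  have hqf : q ∘ₗ f = 0 := LinearMap.ext fun p => (Submodule.Quotient.mk_eq_zero _).2 ⟨p, rfl⟩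
  have hq : Function.Surjective q := Submodule.mkQ_surjective _
  have hex : Function.Exact (rTensor D f : _ →ₗ[Bᵐᵒᵖ] _) (rTensor D q : _ →ₗ[Bᵐᵒᵖ] _) := by
    intro y
    refine ⟨fun hy => exists_map_left_of_map_eq_zero hfq hq hy, ?_⟩
    rintro ⟨y, rfl⟩
    refine (map_map f LinearMap.id q LinearMap.id y).trans ?_
    rw [hqf, map_zero_left]
  have hinj := (ht _ _ _ _ _ _ _ _ (tensorRight_colinear H.regular f)
    (tensorRight_colinear H.regular q) (hD _ _ f hf) hex
    (map_surjective hq Function.surjective_id)).1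
  have hθ : ∀ (P : Type u) [AddCommGroup P] [Module Bᵐᵒᵖ P] (u : BTensor B P N),
      (assoc P D N).symm (map LinearMap.id t.lcoact.left u) ∈
        cotensor (tensorRight P H.regular) t.toLeft := by
    intro P _ _ u
    induction u using BTensor.induction with
    | tmul' p n =>
      have h : t.lcoact n ∈ cotensor H.regular.toRight t.toLeft := t.lcoassoc n
      have h' := map_mem_cotensor (tmulLeft_colinear H.regular p) (isLeftColinear_id t.toLeft) h
      rw [← assoc_symm_tmul_left] at h'
      exact h'
    | add' x y hx hy =>
      rw [map_add, map_add]
      exact add_mem hx hy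
  have hnat : ∀ u : BTensor B P N, map (rTensor D f) LinearMap.id
      ((assoc P D N).symm (map LinearMap.id t.lcoact.left u)) =
        (assoc P' D N).symm (map LinearMap.id t.lcoact.left (map f LinearMap.id u)) := by
    intro u
    rw [← assoc_symm_naturality (f := f) (G := LinearMap.id) (fun _ => rfl)
      (fun t => (BTensor.map_id t).symm) (fun _ => rfl), map_map, map_map]
    rfl
  have hret : ∀ u : BTensor B P N, map LinearMap.id
      ((lidBi B E N).comp (mapBi H.counit (BimodHom.id B E N))).left
        (assoc P D N ((assoc P D N).symm (map LinearMap.id t.lcoact.left u))) = u := by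
    intro u
    rw [AddEquiv.apply_symm_apply, map_map]
    exact (map_congr (fun _ => rfl) t.lcounit u).trans (BTensor.map_id u)
  intro x y hxy
  have h := @hinj ⟨_, hθ P x⟩ ⟨_, hθ P y⟩ (Subtype.ext
    ((hnat x).trans ((congrArg _ (congrArg _ hxy)).trans (hnat y).symm)))
  rw [← hret x, ← hret y]
  exact congrArg _ (congrArg _ (congrArg Subtype.val h))

/-- For a coflat `N` over a flat coring, the cotensor product with `N` turns a surjective colinear map
`g` into a surjective one, whose kernel is the cotensor product of `ker g` with `N`. -/
theorem IsCoflatLeft.cotensor_surjective (hD : IsFlatLeft B D) {l : LeftComodule H N}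
    (hl : IsCoflatLeft l) {V V' : Type u} [AddCommGroup V] [Module Bᵐᵒᵖ V] [AddCommGroup V']
    [Module Bᵐᵒᵖ V'] {ρ : RightComodule H V} {ρ' : RightComodule H V'} {g : V →ₗ[Bᵐᵒᵖ] V'}
    (hg : IsRightColinear ρ ρ' g) (hs : Function.Surjective g) :
    (∀ z ∈ cotensor ρ' l, ∃ y ∈ cotensor ρ l, map g LinearMap.id y = z) ∧
    ∃ ρ₀ : RightComodule H (LinearMap.ker g), IsRightColinear ρ₀ ρ (LinearMap.ker g).subtype ∧
      ∀ y ∈ cotensor ρ l, map g LinearMap.id y = 0 →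
        ∃ q ∈ cotensor ρ₀ l, map (LinearMap.ker g).subtype LinearMap.id q = y := by
  have hpres := hD.preservesEqualizerRight (j := (LinearMap.ker g).subtype) (f := g) (g := 0)
    Subtype.val_injective (fun p hp => ⟨⟨p, hp⟩, rfl⟩)
  obtain ⟨ρ₀, hρ₀⟩ := RightComodule.exists_sub hD ρ (j := (LinearMap.ker g).subtype)
    Subtype.val_injective (fun q => hpres.exists_eq _ (by
      rw [map_zero_left, ← hg]
      exact (congrArg ρ'.coact q.2).trans (map_zero _)))
  have hex : Function.Exact (LinearMap.ker g).subtype g := fun y =>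
    ⟨fun hy => ⟨⟨y, hy⟩, rfl⟩, by rintro ⟨y, rfl⟩; exact y.2⟩
  obtain ⟨-, h2, h3⟩ := hl _ _ _ ρ₀ ρ ρ' _ _ hρ₀ hg Subtype.val_injective hex hs
  refine ⟨fun z hz => ?_, ρ₀, hρ₀, fun y hy hy0 => ?_⟩
  · obtain ⟨y, hy⟩ := h3 ⟨z, hz⟩
    exact ⟨y.1, y.2, congrArg Subtype.val hy⟩
  · obtain ⟨q, hq⟩ := (h2 ⟨y, hy⟩).1 (Subtype.ext hy0)
    exact ⟨q.1, q.2, congrArg Subtype.val hq⟩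

variable (s : Bicomodule K H M) (t : Bicomodule H J N)

theorem mem_cotensor_tensorRight_iff {W : Type u} [AddCommGroup W] [Module Aᵐᵒᵖ W]
    (v : BTensor B (BTensor A W M) N) : v ∈ cotensor (tensorRight W s) t.toLeft ↔
      map LinearMap.id (coactMid s t).left (assoc W M N v) =
        map LinearMap.id (midCoact s t).left (assoc W M N v) := by
  have h1 : ∀ v : BTensor B (BTensor A W M) N, assoc W M (BTensor B D N) (assoc (BTensor A W M) D N
      (map (tensorRight W s).coact LinearMap.id v)) =
        map LinearMap.id (coactMid s t).left (assoc W M N v) := by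
    intro v
    induction v using BTensor.induction with
    | tmul' u n =>
      induction u using BTensor.induction with
      | tmul' w m =>
        change assoc W M _ (assoc _ D N (tmul B ((assoc W M D).symm (tmul A w (s.rcoact m))) n)) =
          tmul A w (assoc M D N (tmul B (s.rcoact m) n))
        generalize s.rcoact m = p
        induction p using BTensor.induction with
        | tmul' m d => rfl
        | add' x y hx hy => simp only [tmul_add, add_tmul, map_add, hx, hy]
      | add' x y hx hy => simp only [add_tmul, map_add, hx, hy]
    | add' x y hx hy => simp only [map_add, hx, hy]
  have h2 : ∀ v : BTensor B (BTensor A W M) N, assoc W M (BTensor B D N)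
      (map LinearMap.id t.toLeft.coact v) =
        map LinearMap.id (midCoact s t).left (assoc W M N v) :=
    assoc_naturality (fun t => (BTensor.map_id t).symm) (fun _ => rfl) (fun _ => rfl)
  rw [← h1, ← h2]
  exact (assoc W M (BTensor B D N)).injective.eq_iff.symm

/-- For `p : F → W` surjective, `ker p ⊗ M` covers the kernel `j : Q → F ⊗ M` of `p ⊗ M`, colinearly. -/
theorem exists_colinear_cover (hD : IsFlatLeft B D) {F W Q : Type u} [AddCommGroup F]
    [Module Aᵐᵒᵖ F] [AddCommGroup W] [Module Aᵐᵒᵖ W] [AddCommGroup Q] [Module Bᵐᵒᵖ Q]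
    {p : F →ₗ[Aᵐᵒᵖ] W} (hp : Function.Surjective p) {j : Q →ₗ[Bᵐᵒᵖ] BTensor A F M}
    (hj : Function.Injective j) (hjp : ∀ u, (∃ q, j q = u) ↔ map p LinearMap.id u = 0)
    {ρ₀ : RightComodule H Q} (hρ₀ : IsRightColinear ρ₀ (tensorRight F s) j) :
    ∃ κ : BTensor A (LinearMap.ker p) M →ₗ[Bᵐᵒᵖ] Q, Function.Surjective κ ∧
      IsRightColinear (tensorRight (LinearMap.ker p) s) ρ₀ κ ∧
      ∀ x, j (κ x) = map (LinearMap.ker p).subtype LinearMap.id x := by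
  have h0 : p ∘ₗ (LinearMap.ker p).subtype = 0 := LinearMap.ext fun x => x.2
  obtain ⟨κ, hκ⟩ := LinearMap.exists_factor (F := rTensor M (LinearMap.ker p).subtype) hj
    fun x => (hjp _).2 ((map_map _ _ p LinearMap.id x).trans (by rw [h0, map_zero_left]))
  refine ⟨κ, fun q => ?_, fun x => ?_, hκ⟩
  · obtain ⟨x, hx⟩ := exists_map_left_of_map_eq_zero (f := (LinearMap.ker p).subtype) (g := p)
      (fun v (hv : p v = 0) => ⟨(⟨v, hv⟩ : LinearMap.ker p), rfl⟩) hp ((hjp _).1 ⟨q, rfl⟩)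
    exact ⟨x, hj ((hκ x).trans hx)⟩
  · apply hD _ _ j hj
    rw [← hρ₀, map_map, hκ, tensorRight_colinear]
    exact map_congr (fun y => (hκ y).symm) (fun _ => rfl) _

/-- For a coflat `N` over a flat coring, `W ⊗ (M □ N) ≃ (W ⊗ M) □ N` for every right module `W`.
This holds for free modules, which are flat, and carries over to `W` along a free cover
because the cotensor product with `N` is exact. -/
theorem IsCoflatLeft.cotensorPureLeft (hD : IsFlatLeft B D) (ht : IsCoflatLeft t.toLeft)
    (W : Type u) [AddCommGroup W] [Module Aᵐᵒᵖ W] : CotensorPureLeft s t W := by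
  let cover (W : Type u) [AddCommGroup W] [Module Aᵐᵒᵖ W] : (W →₀ Aᵐᵒᵖ) →ₗ[Aᵐᵒᵖ] W :=
    Finsupp.linearCombination Aᵐᵒᵖ _root_.id
  have hcover : ∀ (W : Type u) [AddCommGroup W] [Module Aᵐᵒᵖ W], Function.Surjective (cover W) :=
    fun W _ _ w => ⟨Finsupp.single w 1, by simp [cover]⟩
  have hfree : ∀ ι : Type u, CotensorPureLeft s t (ι →₀ Aᵐᵒᵖ) := fun ι =>
    (isFlatRight_finsupp ι).cotensorPureLeft s t
  have hnat : ∀ {W W' : Type u} [AddCommGroup W] [Module Aᵐᵒᵖ W] [AddCommGroup W']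
      [Module Aᵐᵒᵖ W'] (p : W →ₗ[Aᵐᵒᵖ] W') (y : BTensor B (BTensor A W M) N),
      assoc W' M N (map (rTensor M p) LinearMap.id y) = map p LinearMap.id (assoc W M N y) :=
    fun p => assoc_naturality (fun _ => rfl) (fun t => (BTensor.map_id t).symm) (fun _ => rfl)
  have hcomm : ∀ {W W' : Type u} [AddCommGroup W] [Module Aᵐᵒᵖ W] [AddCommGroup W']
      [Module Aᵐᵒᵖ W'] (p : W →ₗ[Aᵐᵒᵖ] W') (e : BTensor A W (Cotensor s t)),
      map LinearMap.id (Cotensor.incl s t).left (map p LinearMap.id e) =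
        map p LinearMap.id (map LinearMap.id (Cotensor.incl s t).left e) := by
    intro W W' _ _ _ _ p e
    rw [map_map, map_map]
    rfl
  have hsurj : ∀ (W : Type u) [AddCommGroup W] [Module Aᵐᵒᵖ W] (u : BTensor A W (BTensor B M N)),
      map LinearMap.id (coactMid s t).left u = map LinearMap.id (midCoact s t).left u →
        ∃ e, map LinearMap.id (Cotensor.incl s t).left e = u := by
    intro W _ _ u hu
    obtain ⟨v, rfl⟩ := (assoc W M N).surjective u
    obtain ⟨y, hy, rfl⟩ := (ht.cotensor_surjective hD (tensorRight_colinear s (cover W))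
      (map_surjective (hcover W) Function.surjective_id)).1 v
        ((mem_cotensor_tensorRight_iff s t v).2 hu)
    obtain ⟨e, he⟩ := (hfree W).exists_eq _ ((mem_cotensor_tensorRight_iff s t y).1 hy)
    exact ⟨map (cover W) LinearMap.id e, by rw [hcomm, he, hnat]⟩
  refine ⟨?_, hsurj W⟩
  rw [injective_iff_map_eq_zero]
  intro e he
  obtain ⟨e, rfl⟩ := map_surjective (g := (LinearMap.id : Cotensor s t →ₗ[A] _)) (hcover W)
    Function.surjective_id e
  obtain ⟨v, hv⟩ := (assoc _ M N).surjective (map LinearMap.id (Cotensor.incl s t).left e)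
  obtain ⟨-, ρ₀, hρ₀, hker⟩ := ht.cotensor_surjective hD (tensorRight_colinear s (cover W))
    (map_surjective (hcover W) Function.surjective_id)
  obtain ⟨q, hq, hqv⟩ := hker v ((mem_cotensor_tensorRight_iff s t v).2 (by
      rw [hv, map_map, map_map]
      exact map_congr (fun _ => rfl) (Cotensor.incl_spec s t) e)) (by
    apply (assoc W M N).injective
    rw [map_zero, ← he, hcomm, ← hv, ← hnat])
  obtain ⟨κ, hκs, hκ, hκj⟩ := exists_colinear_cover s hD (hcover W) Subtype.val_injective
    (fun u => ⟨fun ⟨q, hq⟩ => hq ▸ q.2, fun hu => ⟨⟨u, hu⟩, rfl⟩⟩) hρ₀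
  obtain ⟨y, hy, rfl⟩ := (ht.cotensor_surjective hD hκ hκs).1 q hq
  obtain ⟨e', he'⟩ := hsurj _ _ ((mem_cotensor_tensorRight_iff s t y).1 hy)
  have : map (LinearMap.ker (cover W)).subtype LinearMap.id e' = e := by
    apply (hfree W).injective
    rw [hcomm, he', ← hv, ← hnat, ← hqv, map_map]
    exact congrArg _ (map_congr (fun x => (hκj x).symm) (fun _ => rfl) y)
  rw [← this, map_map]
  have h : cover W ∘ₗ (LinearMap.ker (cover W)).subtype = 0 := LinearMap.ext fun x => x.2
  rw [h, map_zero_left]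

end Coflat

end NCCoring

/-! ### Associativity of the cotensor product -/

namespace NCCoring

open BTensor

section Assoc

theorem existsUnique_addEquiv {X Y T : Type u} [AddCommGroup X] [AddCommGroup Y] [AddCommGroup T]
    {f : X →+ T} {g : Y →+ T} (hf : Function.Injective f) (hg : Function.Injective g)
    (h : ∀ w, (∃ x, f x = w) ↔ ∃ y, g y = w) : ∃! α : X ≃+ Y, ∀ x, g (α x) = f x := by
  choose a ha using fun x => (h (f x)).1 ⟨x, rfl⟩
  choose b hb using fun y => (h (g y)).2 ⟨y, rfl⟩
  refine ⟨⟨⟨a, b, fun x => hf (by rw [hb, ha]), fun y => hg (by rw [ha, hb])⟩,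
    fun x y => hg (by simp only [map_add, ha])⟩, ha, fun α hα => ?_⟩
  ext x
  exact hg ((hα x).trans (ha x).symm)

variable {A B E : Type u} [Ring A] [Ring B] [Ring E]
  {C : Type u} [AddCommGroup C] [Module A C] [Module Aᵐᵒᵖ C] [SMulCommClass A Aᵐᵒᵖ C]
  {D : Type u} [AddCommGroup D] [Module B D] [Module Bᵐᵒᵖ D] [SMulCommClass B Bᵐᵒᵖ D]
  {G : Type u} [AddCommGroup G] [Module E G] [Module Eᵐᵒᵖ G] [SMulCommClass E Eᵐᵒᵖ G]
  {F P : Type u} [Ring F] [AddCommGroup P] [Module F P] [Module Fᵐᵒᵖ P] [SMulCommClass F Fᵐᵒᵖ P]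
  {K : Coring A C} {H : Coring B D} {J : Coring E G} {I : Coring F P}
  {L : Type u} [AddCommGroup L] [Module F L] [Module Aᵐᵒᵖ L] [SMulCommClass F Aᵐᵒᵖ L]
  {M : Type u} [AddCommGroup M] [Module A M] [Module Bᵐᵒᵖ M] [SMulCommClass A Bᵐᵒᵖ M]
  {N : Type u} [AddCommGroup N] [Module B N] [Module Eᵐᵒᵖ N] [SMulCommClass B Eᵐᵒᵖ N]

section Naturality

variable {M' : Type u} [AddCommGroup M'] [Module A M'] [Module Bᵐᵒᵖ M'] [SMulCommClass A Bᵐᵒᵖ M']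
  {N' : Type u} [AddCommGroup N'] [Module B N'] [Module Eᵐᵒᵖ N'] [SMulCommClass B Eᵐᵒᵖ N']
  {s : Bicomodule K H M} {s' : Bicomodule K H M'} {t : Bicomodule H J N} {t' : Bicomodule H J N'}

theorem coactMid_map_left {h : M →ₗ[Bᵐᵒᵖ] M'}
    (hh : ∀ m, s'.rcoact (h m) = map h LinearMap.id (s.rcoact m)) (u : BTensor B M N) :
    coactMid s' t (map h LinearMap.id u) = map h LinearMap.id (coactMid s t u) := by
  rw [coactMid_apply, coactMid_apply, ← assoc_naturality (F := rTensor D h) (fun _ => rfl)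
    (fun t => (BTensor.map_id t).symm) (fun _ => rfl), map_map, map_map]
  exact congrArg _ (map_congr hh (fun _ => rfl) _)

theorem midCoact_map_left (h : M →ₗ[Bᵐᵒᵖ] M') (u : BTensor B M N) :
    midCoact s' t (map h LinearMap.id u) = map h LinearMap.id (midCoact s t u) := by
  rw [midCoact_apply, midCoact_apply, map_map, map_map]
  rfl

theorem coactMid_map_right (h : N →ₗ[B] N') (u : BTensor B M N) :
    coactMid s t' (map LinearMap.id h u) = map LinearMap.id (lTensor D h) (coactMid s t u) := by
  rw [coactMid_apply, coactMid_apply, ← assoc_map_id, map_map, map_map]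
  rfl

theorem midCoact_map_right {h : N →ₗ[B] N'}
    (hh : ∀ n, t'.lcoact (h n) = map LinearMap.id h (t.lcoact n)) (u : BTensor B M N) :
    midCoact s t' (map LinearMap.id h u) = map LinearMap.id (lTensor D h) (midCoact s t u) := by
  rw [midCoact_apply, midCoact_apply, map_map, map_map]
  exact map_congr (fun _ => rfl) hh u

end Naturality

variable (r : Bicomodule I K L) (s : Bicomodule K H M) (t : Bicomodule H J N)

theorem mem_cotensor_tensorBicomodule_iff (v : BTensor B (BTensor A L M) N) :
    assoc L M N v ∈ cotensor r.toRight (tensorBicomodule s t).toLeft ↔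
      map (coactMid r s).right LinearMap.id v = map (midCoact r s).right LinearMap.id v := by
  let Ω : BTensor B (BTensor A L (BTensor A C M)) N →+ BTensor A L (BTensor A C (BTensor B M N)) :=
    (map LinearMap.id (assocBi A A B E C M N).left).comp
      (assoc L (BTensor A C M) N).toAddMonoidHom
  have hΩ : Function.Injective Ω := by
    refine Function.Injective.comp (g := map LinearMap.id (assocBi A A B E C M N).left) ?_
      (assoc L (BTensor A C M) N).injective
    refine Function.LeftInverse.injective
      (g := map LinearMap.id (assocSymmBi A A B E C M N).left) fun x => ?_
    rw [map_map]
    exact (map_congr (fun _ => rfl) (assoc C M N).symm_apply_apply x).trans (BTensor.map_id x)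
  have h1 : ∀ v : BTensor B (BTensor A L M) N, Ω (map (coactMid r s).right LinearMap.id v) =
      coactMid r (tensorBicomodule s t) (assoc L M N v) := by
    intro v
    induction v using BTensor.induction with
    | tmul' u n =>
      induction u using BTensor.induction with
      | tmul' l m =>
        change Ω (tmul B (assoc L C M (tmul A (r.rcoact l) m)) n) =
          assoc L C _ (tmul A (r.rcoact l) (tmul B m n))
        generalize r.rcoact l = p
        induction p using BTensor.induction with
        | tmul' l c => rfl
        | add' x y hx hy => simp only [add_tmul, map_add, hx, hy]
      | add' x y hx hy => simp only [add_tmul, map_add, BimodHom.map_add, hx, hy]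
    | add' x y hx hy => simp only [map_add, BimodHom.map_add, hx, hy]
  have h2 : ∀ v : BTensor B (BTensor A L M) N, Ω (map (midCoact r s).right LinearMap.id v) =
      midCoact r (tensorBicomodule s t) (assoc L M N v) := by
    intro v
    induction v using BTensor.induction with
    | tmul' u n =>
      induction u using BTensor.induction with
      | tmul' l m => rfl
      | add' x y hx hy => simp only [add_tmul, map_add, BimodHom.map_add, hx, hy]
    | add' x y hx hy => simp only [map_add, BimodHom.map_add, hx, hy]
  rw [mem_cotensor_iff, ← h1, ← h2]
  exact hΩ.eq_iff

/-- An element of `(L □ M) ⊗ N` lies in `(L □ M) □ N` if the coactions of `M` and `N` agree on its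
image in `L ⊗ (M ⊗ N)`. -/
theorem mem_cotensor_canonical_iff {c : Bicomodule I H (Cotensor r s)}
    (hc : ∀ z, map (Cotensor.incl r s).right LinearMap.id (c.rcoact z) =
      (tensorBicomodule r s).rcoact (Cotensor.incl r s z))
    (hDN : CotensorPureRight r s (BTensor B D N)) (u : BTensor B (Cotensor r s) N) :
    u ∈ cotensor c.toRight t.toLeft ↔
      map LinearMap.id (coactMid s t).left
        (assoc L M N (map (Cotensor.incl r s).right LinearMap.id u)) =
      map LinearMap.id (midCoact s t).left
        (assoc L M N (map (Cotensor.incl r s).right LinearMap.id u)) := by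
  rw [← mem_cotensor_tensorRight_iff, mem_cotensor_iff, ← hDN.injective.eq_iff,
    ← coactMid_map_left (s' := tensorBicomodule r s) (fun z => (hc z).symm),
    ← midCoact_map_left (s' := tensorBicomodule r s)]
  rfl

/-- Both iterated cotensor products are the subgroup of `L ⊗ M ⊗ N` on which the coactions on either
side of `M` agree. -/
theorem existsUnique_isCanonicalAssoc {c : Bicomodule I H (Cotensor r s)}
    {d : Bicomodule K J (Cotensor s t)} (hc : IsCanonicalBicomodule r s c)
    (hd : IsCanonicalBicomodule s t d) (hN : CotensorPureRight r s N)
    (hDN : CotensorPureRight r s (BTensor B D N)) (hL : CotensorPureLeft s t L)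
    (hLC : CotensorPureLeft s t (BTensor A L C)) :
    ∃! α : Cotensor c t ≃+ Cotensor r d, IsCanonicalAssoc r s t c d α := by
  rw [isCanonicalBicomodule_iff] at hc hd
  let f : Cotensor c t →+ BTensor A L (BTensor B M N) := (assoc L M N).toAddMonoidHom.comp
    ((map (Cotensor.incl r s).right LinearMap.id).comp (Cotensor.incl c t).toAddMonoidHom)
  let g : Cotensor r d →+ BTensor A L (BTensor B M N) :=
    (map LinearMap.id (Cotensor.incl s t).left).comp (Cotensor.incl r d).toAddMonoidHom
  have hf : Function.Injective f := (assoc L M N).injective.comp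
    (hN.injective.comp (Cotensor.incl_injective c t))
  have hg : Function.Injective g := hL.injective.comp (Cotensor.incl_injective r d)
  have hinj : Function.Injective (map (LinearMap.id : L →ₗ[Aᵐᵒᵖ] L)
      (lTensor C (Cotensor.incl s t).left)) := by
    intro x y hxy
    obtain ⟨x, rfl⟩ := (assoc L C _).surjective x
    obtain ⟨y, rfl⟩ := (assoc L C _).surjective y
    congr 1
    apply hLC.injective
    apply (assoc L C _).injective
    rw [assoc_map_id, assoc_map_id]
    exact hxy
  have hmem1 := mem_cotensor_canonical_iff r s t hc.2 hDN
  have hmem2 : ∀ v : BTensor A L (Cotensor s t), v ∈ cotensor r.toRight d.toLeft ↔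
      map LinearMap.id (Cotensor.incl s t).left v ∈
        cotensor r.toRight (tensorBicomodule s t).toLeft := by
    intro v
    rw [mem_cotensor_iff, mem_cotensor_iff, ← hinj.eq_iff,
      ← coactMid_map_right (t' := tensorBicomodule s t),
      ← midCoact_map_right (t' := tensorBicomodule s t) (fun z => (hd.1 z).symm)]
  refine existsUnique_addEquiv hf hg fun w => ⟨?_, ?_⟩
  · rintro ⟨z, rfl⟩
    obtain ⟨v, hv⟩ := hL.exists_eq _ ((hmem1 _).1 z.2)
    refine ⟨⟨v, (hmem2 v).2 ?_⟩, hv⟩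
    rw [hv, mem_cotensor_tensorBicomodule_iff, map_map, map_map]
    exact map_congr (Cotensor.incl_spec r s) (fun _ => rfl) _
  · rintro ⟨z, rfl⟩
    obtain ⟨v, hv⟩ := (assoc L M N).surjective (g z)
    have hz := (hmem2 _).1 z.2
    have hv' : assoc L M N v = map LinearMap.id (Cotensor.incl s t).left z.1 := hv
    rw [← hv', mem_cotensor_tensorBicomodule_iff] at hz
    obtain ⟨u, rfl⟩ := hN.exists_eq _ hz
    refine ⟨⟨u, (hmem1 u).2 ?_⟩, hv⟩
    rw [hv', map_map, map_map]
    exact map_congr (fun _ => rfl) (Cotensor.incl_spec s t) _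

end Assoc

end NCCoring

/-! ### The induced coring -/

namespace NCCoring

open BTensor

variable {A B : Type u} [Ring A] [Ring B]
  {C : Type u} [AddCommGroup C] [Module A C] [Module Aᵐᵒᵖ C] [SMulCommClass A Aᵐᵒᵖ C]
  {D : Type u} [AddCommGroup D] [Module B D] [Module Bᵐᵒᵖ D] [SMulCommClass B Bᵐᵒᵖ D]
  {K : Coring A C} {H : Coring B D}
  {X : Type u} [AddCommGroup X] [Module A X] [Module Bᵐᵒᵖ X] [SMulCommClass A Bᵐᵒᵖ X]
  {Y : Type u} [AddCommGroup Y] [Module B Y] [Module Aᵐᵒᵖ Y] [SMulCommClass B Aᵐᵒᵖ Y]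

/-- The canonical map `M ⊗_R R → M` is bilinear. -/
def ridBi (A B M : Type u) [Ring A] [Ring B] [AddCommGroup M] [Module A M] [Module Bᵐᵒᵖ M]
    [SMulCommClass A Bᵐᵒᵖ M] : BimodHom A B (BTensor B M B) M where
  toAddMonoidHom := rid B M
  map_smul_left a u := by
    change rid B M (a • u) = a • rid B M u
    induction u using BTensor.induction with
    | tmul' m b => exact (smul_comm a (op b) m).symm
    | add' x y hx hy => rw [smul_add, map_add, map_add, smul_add, hx, hy]
  map_smul_right b u := by
    change rid B M (op b • u) = op b • rid B M u
    induction u using BTensor.induction with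
    | tmul' m b' => exact mul_smul (op b) (op b') m
    | add' x y hx hy => rw [smul_add, map_add, map_add, smul_add, hx, hy]

/-- For `ψ : C → X ⊗ Y`, the map `ψ ⊗ X : C ⊗ X → X ⊗ (Y ⊗ X)`. -/
def insertMap (ψ : BimodHom A A C (BTensor B X Y)) :
    BimodHom A B (BTensor A C X) (BTensor B X (BTensor A Y X)) :=
  (assocBi A B A B X Y X).comp (mapBi ψ (BimodHom.id A B X))

variable (sX : Bicomodule K H X) (sY : Bicomodule H K Y) (d : Bicomodule H H (Cotensor sY sX))

/-- Maps `ψ : C → X ⊗ Y` and `ω : Z → D` for `Z = Y □_C X`, together with the coactions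
`i : X → X ⊗ Z` and `k : Z → Z ⊗ Y` they induce. In terms of the inclusion of `Z` into `Y ⊗ X`, `i` is
`x ↦ ψ x₋₁ ⊗ x₀` and `k` is `y ↦ y₀ ⊗ ψ y₁`; the fields `ω_i` and `ω_k` are the triangle identities. -/
structure ComatrixContext where
  canonical : IsCanonicalBicomodule sY sX d
  ψ : BimodHom A A C (BTensor B X Y)
  ψ_lcoact : ∀ c, assoc C X Y (map sX.lcoact.right LinearMap.id (ψ c)) =
    map LinearMap.id ψ.left (K.comul c)
  ω : BimodHom B B (Cotensor sY sX) D
  i : BimodHom A B X (BTensor B X (Cotensor sY sX))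
  i_spec : ∀ x, map LinearMap.id (Cotensor.incl sY sX).left (i x) = insertMap ψ (sX.lcoact x)
  i_mem : ∀ x, i x ∈ cotensor sX.toRight d.toLeft
  ω_i : ∀ x, map LinearMap.id ω.left (i x) = sX.rcoact x
  k : BimodHom B A Y (BTensor B (Cotensor sY sX) Y)
  k_spec : ∀ y, assoc Y X Y (map (Cotensor.incl sY sX).right LinearMap.id (k y)) =
    map LinearMap.id ψ.left (sY.rcoact y)
  ω_k : ∀ y, map ω.right LinearMap.id (k y) = sY.lcoact y

namespace ComatrixContext

variable {sX sY d} (S : ComatrixContext sX sY d)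

/-- `ψ ⊗ X` is left `C`-colinear. -/
theorem lcoact_insertMap (u : BTensor A C X) :
    assoc C X (BTensor A Y X) (map sX.lcoact.right LinearMap.id (insertMap S.ψ u)) =
      map LinearMap.id (insertMap S.ψ).left
        (assoc C C X (map K.comul.right LinearMap.id u)) := by
  induction u using BTensor.induction with
  | tmul' c x =>
    have h1 : ∀ p : BTensor B X Y, assoc C X (BTensor A Y X)
        (map sX.lcoact.right LinearMap.id (assoc X Y X (tmul A p x))) =
          map LinearMap.id ((assocBi A B A B X Y X).left ∘ₗ tmulRight A A (BTensor B X Y) x)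
            (assoc C X Y (map sX.lcoact.right LinearMap.id p)) := by
      intro p
      induction p using BTensor.induction with
      | tmul' x' y =>
        change assoc C X _ (tmul B (sX.lcoact x') (tmul A y x)) =
          map LinearMap.id _ (assoc C X Y (tmul B (sX.lcoact x') y))
        generalize sX.lcoact x' = q
        induction q using BTensor.induction with
        | tmul' c x' => rfl
        | add' a b ha hb => simp only [add_tmul, map_add, ha, hb]
      | add' a b ha hb => simp only [add_tmul, map_add, ha, hb]
    refine (h1 (S.ψ c)).trans ?_
    rw [S.ψ_lcoact]
    change _ = map LinearMap.id (insertMap S.ψ).left (assoc C C X (tmul A (K.comul c) x))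
    rw [assoc_tmul_right, map_map, map_map]
    rfl
  | add' a b ha hb => simp only [BimodHom.map_add, map_add, ha, hb]

/-- The coaction `i` is left `C`-colinear. -/
theorem i_lcoact (hCX : CotensorPureLeft sY sX (BTensor A C X)) (x : X) :
    assoc C X (Cotensor sY sX) (map sX.lcoact.right LinearMap.id (S.i x)) =
      map LinearMap.id S.i.left (sX.lcoact x) := by
  let j := Cotensor.incl sY sX
  have hinj : Function.Injective (map (LinearMap.id : C →ₗ[Aᵐᵒᵖ] C) (lTensor X j.left)) := by
    intro p q hpq
    obtain ⟨p, rfl⟩ := (assoc C X _).surjective p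
    obtain ⟨q, rfl⟩ := (assoc C X _).surjective q
    congr 1
    apply hCX.injective
    apply (assoc C X _).injective
    rw [assoc_map_id, assoc_map_id]
    exact hpq
  apply hinj
  have h := S.lcoact_insertMap (sX.lcoact x)
  rw [sX.lcoassoc, ← S.i_spec, map_map, map_map] at h
  rw [← assoc_map_id, map_map, map_map]
  exact h.trans (map_congr (fun _ => rfl) (fun x => (S.i_spec x).symm) _)

/-- The element `∑ y ⊗ i x` of `(Y ⊗ X) ⊗ Z` comes from `Z ⊗ Z`, because `i` is left colinear. -/
theorem exists_comul (hCX : CotensorPureLeft sY sX (BTensor A C X))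
    (hZ : CotensorPureRight sY sX (Cotensor sY sX)) (z : Cotensor sY sX) :
    ∃ w, map (Cotensor.incl sY sX).right LinearMap.id w = (assoc Y X (Cotensor sY sX)).symm
      (map LinearMap.id S.i.left (Cotensor.incl sY sX z)) := by
  refine hZ.exists_eq _ ?_
  rw [← mem_cotensor_tensorBicomodule_iff sY sX d, AddEquiv.apply_symm_apply]
  exact map_mem_cotensor (isRightColinear_id sY.toRight)
    (g := S.i.left) (l := sX.toLeft) (l' := (tensorBicomodule sX d).toLeft) (S.i_lcoact hCX) z.2

/-- The coproduct of `Z = Y □_C X`. It sends `∑ y ⊗ x` to the element of `Z ⊗ Z` whose image in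
`(Y ⊗ X) ⊗ Z` is `∑ y ⊗ i x`. -/
noncomputable def comul (hCX : CotensorPureLeft sY sX (BTensor A C X))
    (hZ : CotensorPureRight sY sX (Cotensor sY sX)) :
    BimodHom B B (Cotensor sY sX) (BTensor B (Cotensor sY sX) (Cotensor sY sX)) :=
  BimodHom.factor (mapBi (Cotensor.incl sY sX) (BimodHom.id B B _)) hZ.injective
    ((assocSymmBi B A B B Y X _).comp ((mapBi (BimodHom.id B A Y) S.i).comp
      (Cotensor.incl sY sX))) (S.exists_comul hCX hZ)

/-- The counit `ε_D ∘ ω` of `Z = Y □_C X`. -/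
def counit : BimodHom B B (Cotensor sY sX) B := H.counit.comp S.ω

variable (hCX : CotensorPureLeft sY sX (BTensor A C X))
  (hZ : CotensorPureRight sY sX (Cotensor sY sX))

theorem comul_spec' (z : Cotensor sY sX) :
    map (Cotensor.incl sY sX).right LinearMap.id (S.comul hCX hZ z) =
      (assoc Y X (Cotensor sY sX)).symm
        (map LinearMap.id S.i.left (Cotensor.incl sY sX z)) :=
  BimodHom.factor_spec (mapBi (Cotensor.incl sY sX) (BimodHom.id B B _)) hZ.injective
    ((assocSymmBi B A B B Y X _).comp ((mapBi (BimodHom.id B A Y) S.i).comp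
      (Cotensor.incl sY sX))) (S.exists_comul hCX hZ) z

theorem comul_spec (z : Cotensor sY sX) :
    assoc Y X (Cotensor sY sX)
      (map (Cotensor.incl sY sX).right LinearMap.id (S.comul hCX hZ z)) =
        map LinearMap.id S.i.left (Cotensor.incl sY sX z) := by
  rw [comul_spec', AddEquiv.apply_symm_apply]

theorem comul_mem (hDZ : CotensorPureRight sY sX (BTensor B D (Cotensor sY sX)))
    (z : Cotensor sY sX) : S.comul hCX hZ z ∈ cotensor d.toRight d.toLeft := by
  rw [mem_cotensor_canonical_iff sY sX d ((isCanonicalBicomodule_iff sY sX d).1 S.canonical).2 hDZ,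
    comul_spec, map_map, map_map]
  exact map_congr (fun _ => rfl) S.i_mem _

theorem comul_incl_incl (z : Cotensor sY sX) :
    assoc Y X (BTensor A Y X) (map (Cotensor.incl sY sX).right (Cotensor.incl sY sX).left
      (S.comul hCX hZ z)) = map LinearMap.id ((insertMap S.ψ).comp sX.lcoact).left
        (Cotensor.incl sY sX z) := by
  have h : map (Cotensor.incl sY sX).right (Cotensor.incl sY sX).left (S.comul hCX hZ z) =
      map LinearMap.id (Cotensor.incl sY sX).left (map (Cotensor.incl sY sX).right LinearMap.id
        (S.comul hCX hZ z)) := by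
    rw [map_map]
    rfl
  rw [h, assoc_map_id, comul_spec, map_map]
  exact map_congr (fun _ => rfl) S.i_spec _

/-- The coaction `i` is compatible with the coproduct of `Z`. -/
theorem i_coassoc (hXZ : Function.Injective (map (LinearMap.id : X →ₗ[Bᵐᵒᵖ] X)
      (mapLeft (Cotensor.incl sY sX) (LinearMap.id : Cotensor sY sX →ₗ[B] _)))) (x : X) :
    assoc X _ _ (map S.i.right LinearMap.id (S.i x)) =
      map LinearMap.id (S.comul hCX hZ).left (S.i x) := by
  let Φ : BTensor A Y X →ₗ[B] BTensor B (BTensor A Y X) (Cotensor sY sX) :=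
    ((assocSymmBi B A B B Y X (Cotensor sY sX)).comp (mapBi (BimodHom.id B A Y) S.i)).left
  have key : ∀ w : BTensor A C X, assoc X (BTensor A Y X) (Cotensor sY sX)
      (map (insertMap S.ψ).right LinearMap.id ((assoc C X _).symm (map LinearMap.id S.i.left w))) =
        map LinearMap.id Φ (insertMap S.ψ w) := by
    intro w
    induction w using BTensor.induction with
    | tmul' c x =>
      have h1 : ∀ q : BTensor B X (Cotensor sY sX), assoc X (BTensor A Y X) (Cotensor sY sX)
          (map (insertMap S.ψ).right LinearMap.id ((assoc C X _).symm (tmul A c q))) =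
            map LinearMap.id (assocSymmBi B A B B Y X (Cotensor sY sX)).left
              (assoc X Y _ (tmul A (S.ψ c) q)) := by
        intro q
        induction q using BTensor.induction with
        | tmul' x z =>
          change assoc X (BTensor A Y X) (Cotensor sY sX)
            (tmul B (assoc X Y X (tmul A (S.ψ c) x)) z) = _
          generalize S.ψ c = p
          induction p using BTensor.induction with
          | tmul' x' y => rfl
          | add' a b ha hb => simp only [add_tmul, map_add, ha, hb]
        | add' a b ha hb => simp only [tmul_add, map_add, ha, hb]
      refine (h1 (S.i x)).trans ?_
      change _ = map LinearMap.id Φ (assoc X Y X (tmul A (S.ψ c) x))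
      generalize S.ψ c = p
      induction p using BTensor.induction with
      | tmul' x' y => rfl
      | add' a b ha hb => simp only [add_tmul, map_add, ha, hb]
    | add' a b ha hb => simp only [BimodHom.map_add, map_add, ha, hb]
  apply hXZ
  have h := key (sX.lcoact x)
  rw [← S.i_lcoact hCX, AddEquiv.symm_apply_apply, map_map, ← S.i_spec, map_map] at h
  rw [← assoc_map_map, map_map, map_map]
  refine Eq.trans (congrArg _ (map_congr (fun x => ?_) (fun _ => rfl) _)) (h.trans ?_)
  · exact S.i_spec x
  · exact map_congr (fun _ => rfl) (fun z => (S.comul_spec' hCX hZ z).symm) _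

theorem comul_coassoc (hZZ : CotensorPureRight sY sX (BTensor B (Cotensor sY sX) (Cotensor sY sX)))
    (hXZ : Function.Injective (map (LinearMap.id : X →ₗ[Bᵐᵒᵖ] X)
      (mapLeft (Cotensor.incl sY sX) (LinearMap.id : Cotensor sY sX →ₗ[B] _))))
    (z : Cotensor sY sX) :
    assoc _ _ _ (map (S.comul hCX hZ).right LinearMap.id (S.comul hCX hZ z)) =
      map LinearMap.id (S.comul hCX hZ).left (S.comul hCX hZ z) := by
  let j := Cotensor.incl sY sX
  let Φ : BTensor A Y X →ₗ[Bᵐᵒᵖ] BTensor B (BTensor A Y X) (Cotensor sY sX) :=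
    ((assocSymmBi B A B B Y X (Cotensor sY sX)).comp (mapBi (BimodHom.id B A Y) S.i)).right
  have key : ∀ v : BTensor A Y (BTensor B X (Cotensor sY sX)),
      assoc Y X _ (assoc (BTensor A Y X) (Cotensor sY sX) (Cotensor sY sX)
        (map Φ LinearMap.id ((assoc Y X _).symm v))) =
          map LinearMap.id ((assocBi A B B B X (Cotensor sY sX) (Cotensor sY sX)).comp
            (mapBi S.i (BimodHom.id B B _))).left v := by
    intro v
    induction v using BTensor.induction with
    | tmul' y w =>
      induction w using BTensor.induction with
      | tmul' x z =>
        change assoc Y X _ (assoc (BTensor A Y X) (Cotensor sY sX) (Cotensor sY sX)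
          (tmul B ((assoc Y X _).symm (tmul A y (S.i x))) z)) =
            tmul A y (assoc X _ _ (tmul B (S.i x) z))
        generalize S.i x = q
        induction q using BTensor.induction with
        | tmul' x z => rfl
        | add' a b ha hb => simp only [tmul_add, add_tmul, map_add, ha, hb]
      | add' a b ha hb => simp only [tmul_add, map_add, ha, hb]
    | add' a b ha hb => simp only [map_add, ha, hb]
  apply hZZ.injective
  apply (assoc Y X _).injective
  trans map LinearMap.id ((assocBi A B B B X (Cotensor sY sX) (Cotensor sY sX)).comp
      (mapBi S.i (BimodHom.id B B _))).left (map LinearMap.id S.i.left (j z))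
  · rw [← key, ← S.comul_spec' hCX hZ, ← assoc_naturality (F := rTensor _ j.right)
      (fun _ => rfl) (fun t => (BTensor.map_id t).symm) (fun _ => rfl), map_map, map_map]
    exact congrArg _ (congrArg _ (map_congr (S.comul_spec' hCX hZ) (fun _ => rfl) _))
  · have h : map j.right LinearMap.id (map LinearMap.id (S.comul hCX hZ).left
        (S.comul hCX hZ z)) = map LinearMap.id (S.comul hCX hZ).left
          (map j.right LinearMap.id (S.comul hCX hZ z)) := by
      rw [map_map, map_map]
      rfl
    rw [h, assoc_map_id, comul_spec, map_map,
      map_map]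
    exact map_congr (fun _ => rfl) (S.i_coassoc hCX hZ hXZ) _

theorem comul_counit (z : Cotensor sY sX) :
    rid B _ (map LinearMap.id S.counit.left (S.comul hCX hZ z)) = z := by
  let j := Cotensor.incl sY sX
  apply Cotensor.incl_injective sY sX
  have key : ∀ v : BTensor A Y (BTensor B X (Cotensor sY sX)),
      rid B (BTensor A Y X) (map LinearMap.id S.counit.left ((assoc Y X _).symm v)) =
        map LinearMap.id ((ridBi A B X).comp (mapBi (BimodHom.id A B X) S.counit)).left v := by
    intro v
    induction v using BTensor.induction with
    | tmul' y w =>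
      induction w using BTensor.induction with
      | tmul' x z => rfl
      | add' a b ha hb => simp only [tmul_add, map_add, ha, hb]
    | add' a b ha hb => simp only [map_add, ha, hb]
  have h := rid_map j.right (map LinearMap.id S.counit.left (S.comul hCX hZ z))
  refine h.symm.trans ?_
  have h2 := key (map LinearMap.id S.i.left (j z))
  rw [← S.comul_spec' hCX hZ, map_map] at h2
  rw [map_map]
  refine h2.trans ?_
  rw [map_map]
  refine (map_congr (fun _ => rfl) (fun x => ?_) _).trans (BTensor.map_id _)
  change rid B X (map LinearMap.id S.counit.left (S.i x)) = x
  refine Eq.trans ?_ (sX.rcounit x)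
  rw [← S.ω_i, map_map]
  rfl

/-- `(Z ⊗ X) Δ` is the coaction `k` on the first factor. -/
theorem incl_comul (hYX : CotensorPureRight sY sX (BTensor A Y X)) (z : Cotensor sY sX) :
    map LinearMap.id (Cotensor.incl sY sX).left (S.comul hCX hZ z) =
      assoc _ Y X (map S.k.right LinearMap.id (Cotensor.incl sY sX z)) := by
  let j := Cotensor.incl sY sX
  let Φ : BTensor A Y C →ₗ[Aᵐᵒᵖ] BTensor B (BTensor A Y X) Y :=
    ((assocSymmBi B A B A Y X Y).comp (mapBi (BimodHom.id B A Y) S.ψ)).right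
  have key : ∀ v : BTensor A (BTensor A Y C) X,
      assoc Y X _ (assoc (BTensor A Y X) Y X (map Φ LinearMap.id v)) =
        map LinearMap.id (insertMap S.ψ).left (assoc Y C X v) := by
    intro v
    induction v using BTensor.induction with
    | tmul' w x =>
      induction w using BTensor.induction with
      | tmul' y c =>
        change assoc Y X _ (assoc (BTensor A Y X) Y X
          (tmul A ((assoc Y X Y).symm (tmul A y (S.ψ c))) x)) =
            tmul A y (assoc X Y X (tmul A (S.ψ c) x))
        generalize S.ψ c = q
        induction q using BTensor.induction with
        | tmul' x' y' => rfl
        | add' a b ha hb => simp only [tmul_add, add_tmul, map_add, ha, hb]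
      | add' a b ha hb => simp only [add_tmul, map_add, ha, hb]
    | add' a b ha hb => simp only [map_add, ha, hb]
  apply hYX.injective
  apply (assoc Y X _).injective
  trans map LinearMap.id ((insertMap S.ψ).comp sX.lcoact).left (j z)
  · rw [← S.comul_incl_incl hCX hZ, map_map]
    rfl
  · have hz : assoc Y C X (map sY.rcoact.right LinearMap.id (j z)) =
        map LinearMap.id sX.lcoact.left (j z) := z.2
    have h := key (map sY.rcoact.right LinearMap.id (j z))
    rw [hz, map_map, map_map] at h
    refine Eq.trans (Eq.trans (map_congr (fun _ => rfl) (fun _ => rfl) _) h.symm) ?_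
    rw [← assoc_naturality (F := rTensor _ j.right)
      (fun _ => rfl) (fun t => (BTensor.map_id t).symm) (fun _ => rfl), map_map]
    refine congrArg _ (congrArg _ (map_congr (fun y => ?_) (fun _ => rfl) _))
    exact (AddEquiv.symm_apply_eq _).2 (S.k_spec y).symm

theorem counit_comul (hYX : CotensorPureRight sY sX (BTensor A Y X)) (z : Cotensor sY sX) :
    lid B _ (map S.counit.right LinearMap.id (S.comul hCX hZ z)) = z := by
  let j := Cotensor.incl sY sX
  apply Cotensor.incl_injective sY sX
  have key : ∀ v : BTensor A (BTensor B (Cotensor sY sX) Y) X,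
      lid B (BTensor A Y X) (map S.counit.right LinearMap.id (assoc _ Y X v)) =
        map ((lidBi B A Y).comp (mapBi S.counit (BimodHom.id B A Y))).right LinearMap.id v := by
    intro v
    induction v using BTensor.induction with
    | tmul' w x =>
      induction w using BTensor.induction with
      | tmul' z y => rfl
      | add' a b ha hb => simp only [add_tmul, map_add, ha, hb]
    | add' a b ha hb => simp only [map_add, ha, hb]
  have h := lid_map j.left (map S.counit.right LinearMap.id (S.comul hCX hZ z))
  refine h.symm.trans ?_
  have h2 := key (map S.k.right LinearMap.id (j z))
  rw [← S.incl_comul hCX hZ hYX, map_map] at h2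
  rw [map_map]
  refine h2.trans ?_
  rw [map_map]
  refine (map_congr (fun y => ?_) (fun _ => rfl) _).trans (BTensor.map_id _)
  change lid B Y (map S.counit.right LinearMap.id (S.k y)) = y
  refine Eq.trans ?_ (sY.lcounit y)
  rw [← S.ω_k, map_map]
  rfl

end ComatrixContext

end NCCoring

/-! ### Purity under each of the three hypotheses, and the coring structure -/

namespace NCCoring

open BTensor

section Purity

variable {A B E : Type u} [Ring A] [Ring B] [Ring E]
  {C : Type u} [AddCommGroup C] [Module A C] [Module Aᵐᵒᵖ C] [SMulCommClass A Aᵐᵒᵖ C]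
  {D : Type u} [AddCommGroup D] [Module B D] [Module Bᵐᵒᵖ D] [SMulCommClass B Bᵐᵒᵖ D]
  {G : Type u} [AddCommGroup G] [Module E G] [Module Eᵐᵒᵖ G] [SMulCommClass E Eᵐᵒᵖ G]
  {K : Coring A C} {H : Coring B D} {J : Coring E G}
  {M : Type u} [AddCommGroup M] [Module A M] [Module Bᵐᵒᵖ M] [SMulCommClass A Bᵐᵒᵖ M]
  {N : Type u} [AddCommGroup N] [Module B N] [Module Eᵐᵒᵖ N] [SMulCommClass B Eᵐᵒᵖ N]
  {s : Bicomodule K H M} {t : Bicomodule H J N}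

/-- A pure cotensor product of flat modules is flat, since `P ⊗ (M □ N) → P' ⊗ (M ⊗ N)` is
injective. -/
theorem isFlatLeft_cotensor (h : ∀ (W : Type u) [AddCommGroup W] [Module Aᵐᵒᵖ W],
    CotensorPureLeft s t W) (hM : IsFlatLeft A M) (hN : IsFlatLeft B N) :
    IsFlatLeft A (Cotensor s t) := by
  intro P P' _ _ _ _ f hf x y hxy
  apply (h P).injective
  apply hM.tensor hN _ _ f hf
  have h' := congrArg (map LinearMap.id (Cotensor.incl s t).left) hxy
  rw [map_map, map_map] at h'
  rw [map_map, map_map]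
  exact h'

theorem cotensorPureRight_of_split_or_flat {W : Type u} [AddCommGroup W] [Module E W]
    (h : Nonempty (CotensorSplitting s t) ∨ IsFlatLeft E W) : CotensorPureRight s t W := by
  rcases h with ⟨⟨h⟩⟩ | h
  · exact h.cotensorPureRight W
  · exact h.cotensorPureRight s t

/-- `U ⊗ (M □ N) ⊗ W → U ⊗ (M ⊗ N) ⊗ W` is injective. -/
theorem map_map_incl_injective {U W : Type u} [AddCommGroup U] [Module Aᵐᵒᵖ U]
    [AddCommGroup W] [Module E W] (hU : CotensorPureLeft s t U)
    (h : Nonempty (CotensorSplitting s t) ∨ IsFlatLeft E W) :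
    Function.Injective (map (LinearMap.id : U →ₗ[Aᵐᵒᵖ] U)
      (mapLeft (Cotensor.incl s t) (LinearMap.id : W →ₗ[E] W))) := by
  have key : Function.Injective (map (mapRight (LinearMap.id : U →ₗ[Aᵐᵒᵖ] U) (Cotensor.incl s t))
      (LinearMap.id : W →ₗ[E] W)) := by
    rcases h with ⟨⟨h⟩⟩ | h
    · refine Function.LeftInverse.injective
        (g := map (mapRight (LinearMap.id : U →ₗ[Aᵐᵒᵖ] U) h.r) LinearMap.id) fun x => ?_
      rw [map_map]
      refine (map_congr (fun y => ?_) (fun _ => rfl) x).trans (BTensor.map_id x)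
      refine (map_map _ _ LinearMap.id h.r.left y).trans ?_
      exact (map_congr (fun _ => rfl) h.r_incl y).trans (BTensor.map_id y)
    · exact h _ _ _ hU.injective
  intro x y hxy
  obtain ⟨x, rfl⟩ := (assoc U _ W).surjective x
  obtain ⟨y, rfl⟩ := (assoc U _ W).surjective y
  congr 1
  apply key
  apply (assoc U _ W).injective
  rw [assoc_map_map, assoc_map_map]
  exact hxy

end Purity

section Main

variable {A B : Type u} [Ring A] [Ring B]
  {C : Type u} [AddCommGroup C] [Module A C] [Module Aᵐᵒᵖ C] [SMulCommClass A Aᵐᵒᵖ C]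
  {D : Type u} [AddCommGroup D] [Module B D] [Module Bᵐᵒᵖ D] [SMulCommClass B Bᵐᵒᵖ D]
  {K : Coring A C} {H : Coring B D}
  {X : Type u} [AddCommGroup X] [Module A X] [Module Bᵐᵒᵖ X] [SMulCommClass A Bᵐᵒᵖ X]
  {Y : Type u} [AddCommGroup Y] [Module B Y] [Module Aᵐᵒᵖ Y] [SMulCommClass B Aᵐᵒᵖ Y]
  {sX : Bicomodule K H X} {sY : Bicomodule H K Y}

/-- What the three alternative hypotheses have in common: the cotensor products are preserved
by tensoring on the left, and on the right either they split or tensoring with flat modules is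
enough. -/
theorem cotensor_purity
    (hyp :
      (IsFlatLeft A C ∧ IsFlatLeft B D ∧ IsFlatRight A C ∧ IsFlatRight B D ∧
        IsCoflatLeft sX.toLeft ∧ IsCoflatLeft sY.toLeft) ∨
      (IsVonNeumannRegular A ∧ IsVonNeumannRegular B) ∨
      (IsFlatLeft A C ∧ IsFlatLeft B D ∧ IsCoseparable K ∧ IsCoseparable H)) :
    IsFlatLeft A C ∧ IsFlatLeft B D ∧
    (∀ (W : Type u) [AddCommGroup W] [Module Aᵐᵒᵖ W], CotensorPureLeft sX sY W) ∧
    (∀ (W : Type u) [AddCommGroup W] [Module Bᵐᵒᵖ W], CotensorPureLeft sY sX W) ∧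
    ((Nonempty (CotensorSplitting sX sY) ∧ Nonempty (CotensorSplitting sY sX)) ∨
      (IsFlatLeft A X ∧ IsFlatLeft B Y)) := by
  rcases hyp with ⟨hC, hD, -, -, hX, hY⟩ | ⟨hA, hB⟩ | ⟨hC, hD, hK, hH⟩
  · exact ⟨hC, hD, fun W _ _ => hY.cotensorPureLeft sX sY hD W,
      fun W _ _ => hX.cotensorPureLeft sY sX hC W,
      Or.inr ⟨hX.isFlatLeft hC, hY.isFlatLeft hD⟩⟩
  · exact ⟨hA.isFlatLeft C, hB.isFlatLeft D,
      fun W _ _ => (hA.isFlatRight W).cotensorPureLeft sX sY,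
      fun W _ _ => (hB.isFlatRight W).cotensorPureLeft sY sX,
      Or.inr ⟨hA.isFlatLeft X, hB.isFlatLeft Y⟩⟩
  · obtain ⟨h1⟩ := hH.exists_splitting sX sY
    obtain ⟨h2⟩ := hK.exists_splitting sY sX
    exact ⟨hC, hD, fun W _ _ => h1.cotensorPureLeft W, fun W _ _ => h2.cotensorPureLeft W,
      Or.inl ⟨⟨h1⟩, ⟨h2⟩⟩⟩

/-- Morphisms `ψ : C → X □_D Y` and `ω : Y □_C X → D` that satisfy the triangle identities give the
data from which the coring structure on `Y □_C X` is built. -/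
theorem exists_comatrixContext {c : Bicomodule K K (Cotensor sX sY)}
    {d : Bicomodule H H (Cotensor sY sX)} (hc : IsCanonicalBicomodule sX sY c)
    (hd : IsCanonicalBicomodule sY sX d) {α : Cotensor d sY ≃+ Cotensor sY c}
    {β : Cotensor c sX ≃+ Cotensor sX d} (hα : IsCanonicalAssoc sY sX sY d c α)
    (hβ : IsCanonicalAssoc sX sY sX c d β) (hX : CotensorPureLeft sY sX X)
    (hY : CotensorPureRight sY sX Y) (ψ : BicomodHom K.regular c) (ω : BicomodHom d H.regular)
    (h1 : ∀ y : Y, Cotensor.map ω (BicomodHom.id sY)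
      (α.symm (Cotensor.map (BicomodHom.id sY) ψ (toCotensorRegular sY y))) =
        toRegularCotensor sY y)
    (h2 : ∀ x : X, Cotensor.map (BicomodHom.id sX) ω
      (β (Cotensor.map ψ (BicomodHom.id sX) (toRegularCotensor sX x))) =
        toCotensorRegular sX x) :
    ∃ S : ComatrixContext sX sY d, S.ω = ω.toBimodHom ∧
      S.ψ = (Cotensor.incl sX sY).comp ψ.toBimodHom := by
  let ψ' : BimodHom A A C (BTensor B X Y) := (Cotensor.incl sX sY).comp ψ.toBimodHom
  let b : X → Cotensor sX d := fun x =>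
    β (Cotensor.map ψ (BicomodHom.id sX) (toRegularCotensor sX x))
  let a : Y → Cotensor d sY := fun y =>
    α.symm (Cotensor.map (BicomodHom.id sY) ψ (toCotensorRegular sY y))
  have hb : ∀ x, map LinearMap.id (Cotensor.incl sY sX).left (b x).1 =
      insertMap ψ' (sX.lcoact x) := by
    intro x
    refine (hβ _).trans (congrArg (assoc X Y X) ?_)
    refine (map_map _ _ (Cotensor.incl sX sY).right LinearMap.id _).trans ?_
    rfl
  have ha : ∀ y, assoc Y X Y (map (Cotensor.incl sY sX).right LinearMap.id (a y).1) =
      map LinearMap.id ψ'.left (sY.rcoact y) := by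
    intro y
    refine (hα (a y)).symm.trans ?_
    have e : α (a y) = _ := α.apply_symm_apply _
    rw [e]
    refine (map_map _ _ LinearMap.id (Cotensor.incl sX sY).left _).trans ?_
    rfl
  let i : BimodHom A B X (BTensor B X (Cotensor sY sX)) :=
    BimodHom.factor (mapBi (BimodHom.id A B X) (Cotensor.incl sY sX)) hX.injective
      ((insertMap ψ').comp sX.lcoact) fun x => ⟨_, hb x⟩
  let k : BimodHom B A Y (BTensor B (Cotensor sY sX) Y) :=
    BimodHom.factor ((assocBi B A B A Y X Y).comp
      (mapBi (Cotensor.incl sY sX) (BimodHom.id B A Y)))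
        ((assoc Y X Y).injective.comp hY.injective)
      ((mapBi (BimodHom.id B A Y) ψ').comp sY.rcoact) fun y => ⟨_, ha y⟩
  have hi : ∀ x, map LinearMap.id (Cotensor.incl sY sX).left (i x) =
      insertMap ψ' (sX.lcoact x) :=
    BimodHom.factor_spec (mapBi (BimodHom.id A B X) (Cotensor.incl sY sX)) hX.injective
      ((insertMap ψ').comp sX.lcoact) fun x => ⟨_, hb x⟩
  have hk : ∀ y, assoc Y X Y (map (Cotensor.incl sY sX).right LinearMap.id (k y)) =
      map LinearMap.id ψ'.left (sY.rcoact y) :=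
    BimodHom.factor_spec ((assocBi B A B A Y X Y).comp
      (mapBi (Cotensor.incl sY sX) (BimodHom.id B A Y)))
        ((assoc Y X Y).injective.comp hY.injective)
      ((mapBi (BimodHom.id B A Y) ψ').comp sY.rcoact) fun y => ⟨_, ha y⟩
  have hib : ∀ x, i x = (b x).1 := fun x => hX.injective ((hi x).trans (hb x).symm)
  have hka : ∀ y, k y = (a y).1 := fun y =>
    ((assoc Y X Y).injective.comp hY.injective) ((hk y).trans (ha y).symm)
  refine ⟨⟨hd, ψ', fun x => ?_, ω.toBimodHom, i, hi, fun x => ?_, fun x => ?_, k, hk,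
    fun y => ?_⟩, rfl, rfl⟩
  · refine (hc.1 (ψ.toBimodHom x)).symm.trans ((congrArg _ (ψ.left_colinear x)).trans ?_)
    exact map_map _ _ LinearMap.id (Cotensor.incl sX sY).left _
  · rw [hib]
    exact (b x).2
  · rw [hib]
    exact congrArg Subtype.val (h2 x)
  · rw [hka]
    exact congrArg Subtype.val (h1 y)

/-- The coring structure on `Z = Y □_C X` exists, and it is unique because `Z ⊗ Z` embeds into
`(Y ⊗ X) ⊗ (Y ⊗ X)`. -/
theorem ComatrixContext.existsUnique_coring {d : Bicomodule H H (Cotensor sY sX)}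
    (S : ComatrixContext sX sY d) {ψ : BimodHom A A C (Cotensor sX sY)}
    (hψ : S.ψ = (Cotensor.incl sX sY).comp ψ)
    (pCX : CotensorPureLeft sY sX (BTensor A C X))
    (pZ : CotensorPureRight sY sX (Cotensor sY sX))
    (pZZ : CotensorPureRight sY sX (BTensor B (Cotensor sY sX) (Cotensor sY sX)))
    (pDZ : CotensorPureRight sY sX (BTensor B D (Cotensor sY sX)))
    (pYX : CotensorPureRight sY sX (BTensor A Y X))
    (pXZ : Function.Injective (map (LinearMap.id : X →ₗ[Bᵐᵒᵖ] X)
      (mapLeft (Cotensor.incl sY sX) (LinearMap.id : Cotensor sY sX →ₗ[B] _))))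
    (pl : CotensorPureLeft sY sX (BTensor A Y X)) :
    ∃! T : Coring B (Cotensor sY sX), IsInducedCoproduct sX sY d ψ T.comul ∧
      ∀ z, T.counit z = H.counit (S.ω z) := by
  have hins : ∀ x, insertMap S.ψ (sX.lcoact x) = insertion sX sY ψ x := by
    intro x
    rw [hψ]
    change _ = assoc X Y X (map (Cotensor.incl sX sY).right LinearMap.id
      (map ψ.right LinearMap.id (sX.lcoact x)))
    rw [map_map]
    rfl
  refine ⟨⟨S.comul pCX pZ, S.counit, S.comul_coassoc pCX pZ pZZ pXZ,
    S.counit_comul pCX pZ pYX, S.comul_counit pCX pZ⟩,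
    ⟨fun z => ⟨S.comul_mem pCX pZ pDZ z, ?_⟩, fun z => rfl⟩, ?_⟩
  · refine (S.comul_incl_incl pCX pZ z).trans ?_
    exact map_congr (fun _ => rfl) hins _
  · rintro ⟨δ, ε, h3, h4, h5⟩ ⟨hδ, hε⟩
    have e1 : δ = S.comul pCX pZ := by
      ext z
      apply pZ.injective
      apply pl.injective
      apply (assoc Y X (BTensor A Y X)).injective
      rw [map_map, map_map]
      refine (hδ z).2.trans (Eq.trans ?_ (S.comul_incl_incl pCX pZ z).symm)
      exact map_congr (fun _ => rfl) (fun x => (hins x).symm) _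
    have e2 : ε = S.counit := by
      ext z
      exact hε z
    subst e1 e2
    rfl

end Main

end NCCoring

theorem mainTheorem6
    {A B : Type u} [Ring A] [Ring B]
    {C : Type u} [AddCommGroup C] [Module A C] [Module Aᵐᵒᵖ C] [SMulCommClass A Aᵐᵒᵖ C]
    {D : Type u} [AddCommGroup D] [Module B D] [Module Bᵐᵒᵖ D] [SMulCommClass B Bᵐᵒᵖ D]
    (K : Coring A C) (H : Coring B D)
    {X : Type u} [AddCommGroup X] [Module A X] [Module Bᵐᵒᵖ X] [SMulCommClass A Bᵐᵒᵖ X]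
    {Y : Type u} [AddCommGroup Y] [Module B Y] [Module Aᵐᵒᵖ Y] [SMulCommClass B Aᵐᵒᵖ Y]
    (sX : Bicomodule K H X) (sY : Bicomodule H K Y)
    (hyp :
      (IsFlatLeft A C ∧ IsFlatLeft B D ∧ IsFlatRight A C ∧ IsFlatRight B D ∧
        IsCoflatLeft sX.toLeft ∧ IsCoflatLeft sY.toLeft) ∨
      (IsVonNeumannRegular A ∧ IsVonNeumannRegular B) ∨
      (IsFlatLeft A C ∧ IsFlatLeft B D ∧ IsCoseparable K ∧ IsCoseparable H)) :
    -- the canonical bicomodule structures on `X □_D Y` and `Y □_C X`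
    (∃! c : Bicomodule K K (Cotensor sX sY), IsCanonicalBicomodule sX sY c) ∧
    (∃! d : Bicomodule H H (Cotensor sY sX), IsCanonicalBicomodule sY sX d) ∧
    ∀ (c : Bicomodule K K (Cotensor sX sY)) (d : Bicomodule H H (Cotensor sY sX)),
      IsCanonicalBicomodule sX sY c → IsCanonicalBicomodule sY sX d →
      -- the canonical associativity isomorphisms
      (∃! α : Cotensor d sY ≃+ Cotensor sY c, IsCanonicalAssoc sY sX sY d c α) ∧
      (∃! β : Cotensor c sX ≃+ Cotensor sX d, IsCanonicalAssoc sX sY sX c d β) ∧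
      ∀ (α : Cotensor d sY ≃+ Cotensor sY c) (β : Cotensor c sX ≃+ Cotensor sX d),
        IsCanonicalAssoc sY sX sY d c α → IsCanonicalAssoc sX sY sX c d β →
        ∀ (ψ : BicomodHom K.regular c) (ω : BicomodHom d H.regular),
          -- the two triangle identities
          (∀ y : Y, Cotensor.map ω (BicomodHom.id sY)
            (α.symm (Cotensor.map (BicomodHom.id sY) ψ (toCotensorRegular sY y))) =
              toRegularCotensor sY y) →
          (∀ x : X, Cotensor.map (BicomodHom.id sX) ω
            (β (Cotensor.map ψ (BicomodHom.id sX) (toRegularCotensor sX x))) =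
              toCotensorRegular sX x) →
          ∃! T : Coring B (Cotensor sY sX),
            IsInducedCoproduct sX sY d ψ.toBimodHom T.comul ∧
            ∀ z, T.counit z = H.counit (ω.toBimodHom z) := by
  obtain ⟨hC, hD, hXY, hYX, hS⟩ := cotensor_purity hyp
  -- Right purity is needed for modules that are flat as soon as `X` and `Y` are.
  have rX : ∀ {W : Type u} [AddCommGroup W] [Module A W],
      (IsFlatLeft A X ∧ IsFlatLeft B Y → IsFlatLeft A W) → CotensorPureRight sX sY W :=
    fun h => cotensorPureRight_of_split_or_flat (hS.imp And.left h)
  have rY : ∀ {W : Type u} [AddCommGroup W] [Module B W],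
      (IsFlatLeft A X ∧ IsFlatLeft B Y → IsFlatLeft B W) → CotensorPureRight sY sX W :=
    fun h => cotensorPureRight_of_split_or_flat (hS.imp And.right h)
  have hZ : IsFlatLeft A X ∧ IsFlatLeft B Y → IsFlatLeft B (Cotensor sY sX) :=
    fun h => isFlatLeft_cotensor (fun W _ _ => hYX W) h.2 h.1
  refine ⟨existsUnique_isCanonicalBicomodule sX sY (hXY _) (hXY _) hC,
    existsUnique_isCanonicalBicomodule sY sX (hYX _) (hYX _) hD, fun c d hc hd =>
    ⟨existsUnique_isCanonicalAssoc sY sX sY hd hc (rY And.right) (rY fun h => hD.tensor h.2)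
      (hXY _) (hXY _),
    existsUnique_isCanonicalAssoc sX sY sX hc hd (rX And.left) (rX fun h => hC.tensor h.1)
      (hYX _) (hYX _), fun α β hα hβ ψ ω h1 h2 => ?_⟩⟩
  obtain ⟨S, hω, hψ⟩ := exists_comatrixContext hc hd hα hβ (hYX X) (rY And.right) ψ ω h1 h2
  have pZ := rY hZ
  have pZZ := rY fun h => (hZ h).tensor (hZ h)
  have pDZ := rY fun h => hD.tensor (hZ h)
  have pYX := rY fun h => h.2.tensor h.1
  have pCX := hYX (BTensor A C X)
  have pXZ := map_map_incl_injective (hYX X) (hS.imp And.right hZ)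
  rw [← hω]
  exact S.existsUnique_coring hψ pCX pZ pZZ pDZ pYX pXZ (hYX _)
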